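/- **Conventions.** For $n\ge 1$, let $P(n)$ be the set of partitions of $[n]=\{1,\dots,n\}$ and $NC(n)\subset P(n)$ the set of non-crossing partitions; $|V|$ is the size of a block $V$, and $|\pi|$ is the number of blocks of $\pi$. For a sequence $(u_k)_{k\ge1}$ put $u_\pi=\prod_{V\in\pi}u_{|V|}$ and $u_{\pi\setminus V}=\prod_{W\in\pi,\,W\ne V}u_{|W|}$. For a permutation $\sigma$, $|\sigma|$ is its number of cycles (fixed points included) and $u_\sigma$ is the product of $u_{|c|}$ over all cycles $c$ of $\sigma$, where $|c|$ is the length of $c$. For $t,s\ge1$ let $\gamma_{t,s}=(1,\dots,t)(t+1,\dots,t+s)$, and let $S_{NC}(t,s)$ be the set of permutations $\sigma$ of $[t+s]$ such that $\langle\sigma,\gamma_{t,s}\rangle$ acts transitively on $[t+s]$ and $|\sigma|+|\sigma^{-1}\gamma_{t,s}|=t+s$. For a probability measure $\mu$ on $\mathbb R$ with finite moments $m_n(\mu)$ of all orders, its free cumulants $(r_n(\mu))_{n\ge1}$ are defined recursively by $m_n(\mu)=\sum_{\pi\in NC(n)}r_\pi(\mu)$. The free additive convolution $\mu\boxplus\nu$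 is a probability measure with finite moments of all orders such that $r_n(\mu\boxplus\nu)=r_n(\mu)+r_n(\nu)$ for all $n\ge1$. (If several measures have this property, the theorem below holds for each of them.) Let $\mathcal P_d(\mathbb R)$ be the set of monic real-rooted polynomials of degree $d$. Write $p\in\mathcal P_d(\mathbb R)$ as $p(x)=\sum_{k=0}^d x^{d-k}(-1)^k\binom dk a_k(p)$, with roots $\lambda_1,\dots,\lambda_d$ counted with multiplicity. Put $m_n(p)=\frac1d\sum_{i=1}^d\lambda_i^n$ and, for $1\le n\le d$, $$\kappa_n(p)=\frac{(-d)^{n-1}}{(n-1)!}\sum_{\pi\in P(n)}(-1)^{|\pi|-1}(|\pi|-1)!\prod_{V\in\pi}a_{|V|}(p).$$ The finite free additive convolution of $p,q\in\mathcal P_d(\mathbb R)$ is $$[p\boxplus_d q](x)=\sum_{k=0}^d x^{d-k}(-1)^k\binom dk\sum_{i=0}^k\binom ki a_i(p)\,a_{k-i}(q).$$ A sequence $\mathfrak p=(p_d)_{d\ge1}$ with $p_d\in\mathcal P_d(\mathbb R)$ has *infinitesimal distribution* $(\mu,\mu')$, where $\mu$ is a probability measure on $\mathbb R$ with finite moments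 of all orders and $\mu':\mathbb R[x]\to\mathbb R$ is a linear functional with $\mu'(1)=0$, if $m_n(p_d)\to m_n(\mu)$ for all $n\ge0$ and $d\,(m_n(p_d)-m_n(\mu))\to m_n(\mu'):=\mu'(x^n)$ for all $n\ge1$, as $d\to\infty$. The *cumulant fluctuations* of such a $\mathfrak p$ are the numbers $\widehat r_n(\mathfrak p)$, $n\ge 1$, such that $\kappa_n(p_d)=r_n(\mu)+\frac1d\,\widehat r_n(\mathfrak p)+o(1/d)$ as $d\to\infty$. **Theorem.** Let $\mathfrak p=(p_d)_{d\ge1}$ and $\mathfrak q=(q_d)_{d\ge1}$ be sequences of polynomials with $p_d,q_d\in\mathcal P_d(\mathbb R)$ and with infinitesimal distributions $(\mu,\mu')$ and $(\nu,\nu')$, respectively. Then the cumulant fluctuations $\widehat r_n(\mathfrak p)$ and $\widehat r_n(\mathfrak q)$ exist for all $n\ge1$, the free additive convolution $\rho=\mu\boxplus\nu$ exists, and $\mathfrak p\boxplus\mathfrak q=(p_d\boxplus_d q_d)_{d\ge1}$ is a sequence of polynomials in $\mathcal P_d(\mathbb R)$ which has an infinitesimal distribution $(\rho,\rho')$. Its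 cumulant fluctuations exist and satisfy $\widehat r_n(\mathfrak p\boxplus\mathfrak q)=\widehat r_n(\mathfrak p)+\widehat r_n(\mathfrak q)$ for all $n\ge1$, and for all $n\ge1$ $$m_n(\rho')=\sum_{\pi\in NC(n)}\sum_{V\in\pi}\big[\widehat r_{|V|}(\mathfrak p)+\widehat r_{|V|}(\mathfrak q)\big]\,r_{\pi\setminus V}(\mu\boxplus\nu)\;-\;\frac n2\sum_{\substack{t+s=n\\ t,s\ge1}}\ \sum_{\sigma\in S_{NC}(t,s)}\frac{r_\sigma(\mu\boxplus\nu)}{ts}.$$ -/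

import Mathlib

open Polynomial MeasureTheory Filter Topology

namespace FiniteFree

/-! ## Non-crossing partitions and annular non-crossing permutations -/

/-- The set `P(n)` of all set partitions of an `n`-element (linearly ordered) set. -/
abbrev SetPartition (n : ℕ) : Type := Finpartition (Finset.univ : Finset (Fin n))

/-- A partition is non-crossing if whenever `a < b < c < d` with `a, c` in a block `V` and
`b, d` in a block `W`, then `V = W`. -/
def IsNonCrossing {n : ℕ} (π : SetPartition n) : Prop :=
  ∀ a b c d : Fin n, a < b → b < c → c < d →
    ∀ V ∈ π.parts, ∀ W ∈ π.parts, a ∈ V → c ∈ V → b ∈ W → d ∈ W → V = W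

open Classical in
/-- The finite set `NC(n)` of non-crossing partitions. -/
noncomputable def NC (n : ℕ) : Finset (SetPartition n) :=
  Finset.univ.filter IsNonCrossing

/-- The multiplicative extension `u_π = ∏_{V ∈ π} u_{|V|}` of a sequence to partitions. -/
noncomputable def partProd {n : ℕ} (u : ℕ → ℝ) (π : SetPartition n) : ℝ :=
  ∏ V ∈ π.parts, u V.card

/-- `∑_{V ∈ π} v_{|V|} · u_{π ∖ V}`. -/
noncomputable def partDeriv {n : ℕ} (u v : ℕ → ℝ) (π : SetPartition n) : ℝ :=
  ∑ V ∈ π.parts, v V.card * ∏ W ∈ π.parts.erase V, u W.card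

/-- The number `|σ|` of cycles of a permutation, fixed points included. -/
noncomputable def numCycles {t s : ℕ} (σ : Equiv.Perm (Fin t ⊕ Fin s)) : ℕ :=
  Multiset.card σ.partition.parts

/-- The multiplicative extension `u_σ = ∏_{c cycle of σ} u_{|c|}` of a sequence to permutations
(fixed points count as cycles of length one). -/
noncomputable def permProd {t s : ℕ} (u : ℕ → ℝ) (σ : Equiv.Perm (Fin t ⊕ Fin s)) : ℝ :=
  (σ.partition.parts.map u).prod

/-- The permutation `γ_{t,s} = (1,2,…,t)(t+1,…,t+s)`; the points `1,…,t` are the left summand and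
`t+1,…,t+s` the right one. -/
def gammaPerm (t s : ℕ) : Equiv.Perm (Fin t ⊕ Fin s) :=
  Equiv.sumCongr (finRotate t) (finRotate s)

/-- `σ` is non-crossing in the `(t,s)`-annulus: `σ` and `γ_{t,s}` generate a transitive group, and
`|σ| + |σ⁻¹ γ_{t,s}| = t + s`. -/
def IsAnnularNonCrossing {t s : ℕ} (σ : Equiv.Perm (Fin t ⊕ Fin s)) : Prop :=
  MulAction.IsPretransitive
      (Subgroup.closure ({σ, gammaPerm t s} : Set (Equiv.Perm (Fin t ⊕ Fin s)))) (Fin t ⊕ Fin s) ∧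
    numCycles σ + numCycles (σ⁻¹ * gammaPerm t s) = t + s

open Classical in
/-- The finite set `S_NC(t,s)`. -/
noncomputable def SNC (t s : ℕ) : Finset (Equiv.Perm (Fin t ⊕ Fin s)) :=
  Finset.univ.filter IsAnnularNonCrossing

/-- `(n/2) ∑_{t + s = n, t, s ≥ 1} ∑_{σ ∈ S_NC(t,s)} u_σ / (t s)`. -/
noncomputable def annularSum (u : ℕ → ℝ) (n : ℕ) : ℝ :=
  (n : ℝ) / 2 *
    ∑ ts ∈ (Finset.HasAntidiagonal.antidiagonal n).filter (fun ts => 1 ≤ ts.1 ∧ 1 ≤ ts.2),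
      ∑ σ ∈ SNC ts.1 ts.2, permProd u σ / ((ts.1 : ℝ) * (ts.2 : ℝ))

/-! ## Moments and free cumulants -/

/-- The free cumulants of a moment sequence `m`, defined recursively by solving
`m_n = ∑_{π ∈ NC(n)} r_π` for the term `r_n` of the one-block partition
(see `moment_eq_sum_NC`). -/
noncomputable def cumulantOfMoments (m : ℕ → ℝ) (n : ℕ) : ℝ :=
  m n - ∑ π ∈ ((NC n).filter (fun π => ∀ V ∈ π.parts, V.card < n)).attach,
    ∏ V ∈ π.1.parts.attach, cumulantOfMoments m V.1.card
termination_by n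
decreasing_by exact (Finset.mem_filter.mp π.2).2 V.1 V.2

theorem cumulantOfMoments_eq (m : ℕ → ℝ) (n : ℕ) :
    cumulantOfMoments m n =
      m n - ∑ π ∈ (NC n).filter (fun π => ∀ V ∈ π.parts, V.card < n),
        partProd (cumulantOfMoments m) π := by
  rw [cumulantOfMoments, ← Finset.sum_attach (Finset.filter _ _)]
  congr 1
  refine Finset.sum_congr rfl fun π _ => ?_
  exact Finset.prod_attach π.1.parts (fun V => cumulantOfMoments m V.card)

/-- The moment-cumulant formula `m_n = ∑_{π ∈ NC(n)} r_π` for `n ≥ 1`. -/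
theorem moment_eq_sum_NC (m : ℕ → ℝ) {n : ℕ} (hn : 1 ≤ n) :
    m n = ∑ π ∈ NC n, partProd (cumulantOfMoments m) π := by
  have hne : (Finset.univ : Finset (Fin n)) ≠ ⊥ := by
    intro h
    have h1 := congrArg Finset.card h
    simp at h1
    omega
  have hfull : ∀ π : SetPartition n, ¬ (∀ V ∈ π.parts, V.card < n) →
      π = Finpartition.indiscrete hne := by
    intro π hπ
    push Not at hπ
    obtain ⟨V, hV, hVn⟩ := hπ
    have hVu : V = Finset.univ := by
      apply Finset.eq_univ_of_card
      have := Finset.card_le_univ V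
      simp only [Fintype.card_fin] at this ⊢
      omega
    subst hVu
    apply Finpartition.ext
    ext W
    simp only [Finpartition.indiscrete_parts, Finset.mem_singleton]
    constructor
    · intro hW
      by_contra hWne
      have hd := π.disjoint hW hV hWne
      simp only [Function.onFun, id] at hd
      exact π.ne_bot hW (hd.eq_bot_of_le (Finset.subset_univ W))
    · rintro rfl
      exact hV
  have hcomp : (NC n).filter (fun π => ¬ ∀ V ∈ π.parts, V.card < n) =
      {Finpartition.indiscrete hne} := by
    ext π
    simp only [Finset.mem_filter, Finset.mem_singleton]
    constructor
    · rintro ⟨-, h⟩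
      exact hfull π h
    · rintro rfl
      refine ⟨?_, ?_⟩
      · simp only [NC, Finset.mem_filter, Finset.mem_univ, true_and]
        intro a b c d _ _ _ V hV W hW _ _ _ _
        simp only [Finpartition.indiscrete_parts, Finset.mem_singleton] at hV hW
        rw [hV, hW]
      · simp
  rw [← Finset.sum_filter_add_sum_filter_not (NC n) (fun π => ∀ V ∈ π.parts, V.card < n), hcomp,
    Finset.sum_singleton]
  have h1 : partProd (cumulantOfMoments m) (Finpartition.indiscrete hne) =
      cumulantOfMoments m n := by
    simp [partProd]
  rw [h1, cumulantOfMoments_eq m n]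
  ring

/-- The `n`-th moment `m_n(μ)` of a measure on the real line. -/
noncomputable def moment (μ : Measure ℝ) (n : ℕ) : ℝ := ∫ x, x ^ n ∂μ

/-- The measure `μ` has finite moments of all orders. -/
def HasFiniteMoments (μ : Measure ℝ) : Prop := ∀ n : ℕ, Integrable (fun x : ℝ => x ^ n) μ

/-- The `n`-th free cumulant `r_n(μ)`. -/
noncomputable def freeCumulant (μ : Measure ℝ) (n : ℕ) : ℝ := cumulantOfMoments (moment μ) n

/-- `ρ` is a free additive convolution `μ ⊞ ν`: a probability measure with finite moments of all
orders whose free cumulants are `r_n(ρ) = r_n(μ) + r_n(ν)`, `n ≥ 1`. -/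
structure IsFreeAddConv (μ ν ρ : Measure ℝ) : Prop where
  isProbabilityMeasure : IsProbabilityMeasure ρ
  finiteMoments : HasFiniteMoments ρ
  freeCumulant_add : ∀ n, 1 ≤ n → freeCumulant ρ n = freeCumulant μ n + freeCumulant ν n

/-! ## Real-rooted polynomials, finite free convolution and cumulants -/

/-- The set `𝒫_d(ℝ)` of monic real-rooted polynomials of degree `d`. -/
def realRooted (d : ℕ) : Set ℝ[X] := {p | p.Monic ∧ p.natDegree = d ∧ p.Splits}

/-- The coefficient `a_k(p)`, `0 ≤ k ≤ d`, in `p = ∑_k x^{d-k} (-1)^k (d choose k) a_k(p)`. -/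
noncomputable def coefA (d k : ℕ) (p : ℝ[X]) : ℝ :=
  (-1) ^ k * p.coeff (d - k) / (d.choose k : ℝ)

/-- The finite free additive convolution `p ⊞_d q`. -/
noncomputable def finiteFreeAdd (d : ℕ) (p q : ℝ[X]) : ℝ[X] :=
  ∑ k ∈ Finset.range (d + 1),
    C ((-1) ^ k * (d.choose k : ℝ) *
      ∑ i ∈ Finset.range (k + 1), (k.choose i : ℝ) * coefA d i p * coefA d (k - i) q) * X ^ (d - k)

/-- The `n`-th moment `m_n(p) = (1/d) ∑ λ^n` of the root distribution of `p ∈ 𝒫_d(ℝ)`, the roots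
`λ` being counted with multiplicity. -/
noncomputable def rootMoment (d : ℕ) (p : ℝ[X]) (n : ℕ) : ℝ :=
  (1 / (d : ℝ)) * (p.roots.map (fun x => x ^ n)).sum

/-- The `n`-th finite free cumulant `κ_n(p)` of `p ∈ 𝒫_d(ℝ)`, `1 ≤ n ≤ d`; the Möbius function of
the partition lattice is `Möb(π, 1_n) = (-1)^{|π|-1} (|π|-1)!`. -/
noncomputable def finiteFreeCumulant (d n : ℕ) (p : ℝ[X]) : ℝ :=
  (-(d : ℝ)) ^ (n - 1) / ((n - 1).factorial : ℝ) *
    ∑ π : SetPartition n,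
      (-1) ^ (π.parts.card - 1) * ((π.parts.card - 1).factorial : ℝ) *
        partProd (fun k => coefA d k p) π

/-! ## Infinitesimal distributions and cumulant fluctuations -/

/-- The sequence `(p_d)_{d ≥ 1}`, `p_d ∈ 𝒫_d(ℝ)`, has infinitesimal distribution `(μ, μ')`: its root
distributions converge in moments to the probability measure `μ`, and
`d (m_n(p_d) - m_n(μ)) → μ'(x^n)` for `n ≥ 1`, while `μ'(1) = 0`. The term `p 0` is irrelevant. -/
structure HasInfinitesimalDistribution (p : ℕ → ℝ[X]) (μ : Measure ℝ) (μ' : ℝ[X] →ₗ[ℝ] ℝ) :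
    Prop where
  realRooted : ∀ d, 1 ≤ d → p d ∈ realRooted d
  isProbabilityMeasure : IsProbabilityMeasure μ
  finiteMoments : HasFiniteMoments μ
  tendsto_moment : ∀ n, Tendsto (fun d => rootMoment d (p d) n) atTop (𝓝 (moment μ n))
  map_one : μ' 1 = 0
  tendsto_infinitesimal : ∀ n, 1 ≤ n →
    Tendsto (fun d : ℕ => (d : ℝ) * (rootMoment d (p d) n - moment μ n)) atTop (𝓝 (μ' (X ^ n)))

/-- `(r_n)_{n ≥ 1}` is the sequence of cumulant fluctuations of `(p_d)_{d ≥ 1}` with limiting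
distribution `μ`, that is, `κ_n(p_d) = r_n(μ) + r_n / d + o(1/d)` for every `n ≥ 1`. -/
def HasCumulantFluctuations (p : ℕ → ℝ[X]) (μ : Measure ℝ) (r : ℕ → ℝ) : Prop :=
  ∀ n, 1 ≤ n →
    Tendsto (fun d : ℕ => (d : ℝ) * (finiteFreeCumulant d n (p d) - freeCumulant μ n))
      atTop (𝓝 (r n))

end FiniteFree

/-! Everything rests on an exact formula, `rootMoment_eq_sum`: for n ≤ d, m_n(p) is 1/(n-1)! times
the sum of (-1/d)^(n+1-|σ|-|σ⁻¹α|) κ_σ(p) over the pairs (σ, α) of permutations of [n] that generate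
a transitive group.

To obtain it, sum the multiplicative weight -d·κ over all permutations of k points: the result is
(-d)^k a_k(p). The constant weight -d gives (-1)^k d!/(d-k)!. The product of the two is a sum over
all pairs (σ, α), and equals (-d)^k k! times a coefficient of p. Sorting the pairs by the group
orbit of one point (`permSum_mul_permSum_succ`) gives a recursion that coincides with Newton's
identities, so the transitive pairs produce the power sums of the roots
(`pairSum_finiteFreeCumulant`).

The powers of 1/d are read off from the genus inequality |σ|+|α|+|σ⁻¹α| ≤ n+2
(`cyc_add_cyc_add_cyc_le`). Exponent 0 forces α to be a long cycle and σ to be planar, that is, a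
non-crossing partition. By parity, exponent 1 forces α to have two cycles, which gives S_NC(t,s);
counting such α against (n-1)! produces the weight n/(2ts). All other pairs are O(1/d²). Hence
first-order expansions of the cumulants yield those of the moments (`firstOrder_moment`); conversely
the formula is triangular in the cumulants, so their fluctuations exist
(`exists_firstOrder_cumulant`).

For the convolution, the a_k convolve binomially, their exponential generating functions multiply,
and the κ_n, which come from the logarithm, add up. Real-rootedness follows from Grace's theorem on
apolar polynomials (`apolarPairing_ne_zero`). The measure μ ⊞ ν is a weak limit point of the root
distributions of the convolved polynomials (`exists_moment_eq_of_tendsto`). -/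

namespace FiniteFree

open Equiv Equiv.Perm

set_option linter.unusedSectionVars false

/-! ## Cycle counts of permutations -/

section Cycles

variable {X : Type*} [Fintype X] [DecidableEq X]

/-- The number of cycles of a permutation, fixed points included. -/
noncomputable def cyc (σ : Perm X) : ℕ := Multiset.card σ.partition.parts

/-- The product of `u |c|` over all cycles `c` of a permutation. -/
noncomputable def wprod (u : ℕ → ℝ) (σ : Perm X) : ℝ := (σ.partition.parts.map u).prod

open Classical in
/-- The partition of the ground set into the cycles of a permutation. -/
noncomputable def orbitPart (σ : Perm X) : Finpartition (Finset.univ : Finset X) :=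
  Finpartition.ofSetoid (SameCycle.setoid σ)

theorem mem_orbitPart {σ : Perm X} {V : Finset X} :
    V ∈ (orbitPart σ).parts ↔ ∃ a, V = Finset.univ.filter (fun b => SameCycle σ a b) := by
  unfold orbitPart Finpartition.ofSetoid
  rw [Finpartition.ofSetSetoid_parts]
  simp only [Finset.mem_image, Finset.mem_univ, true_and]
  constructor
  · rintro ⟨a, rfl⟩
    exact ⟨a, by ext b; simp only [Finset.mem_filter, Finset.mem_univ, true_and]; rfl⟩
  · rintro ⟨a, rfl⟩
    exact ⟨a, by ext b; simp only [Finset.mem_filter, Finset.mem_univ, true_and]; rfl⟩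

theorem orbitPart_parts (σ : Perm X) :
    (orbitPart σ).parts = σ.cycleFactorsFinset.image Perm.support ∪
      (σ.support)ᶜ.image (fun a => {a}) := by
  ext V
  rw [mem_orbitPart]
  simp only [Finset.mem_union, Finset.mem_image, Finset.mem_compl]
  constructor
  · rintro ⟨a, rfl⟩
    by_cases ha : a ∈ σ.support
    · left
      refine ⟨σ.cycleOf a, cycleOf_mem_cycleFactorsFinset_iff.mpr ha, ?_⟩
      ext b
      rw [mem_support_cycleOf_iff]
      simp [ha]
    · right
      refine ⟨a, ha, ?_⟩
      ext b
      simp only [Finset.mem_singleton, Finset.mem_filter, Finset.mem_univ, true_and]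
      constructor
      · rintro rfl; exact SameCycle.refl _ _
      · intro h
        exact (h.eq_of_left (by simpa [Function.IsFixedPt] using ha)).symm
  · rintro (⟨c, hc, rfl⟩ | ⟨a, ha, rfl⟩)
    · obtain ⟨a, ha⟩ := (mem_cycleFactorsFinset_iff.mp hc).1.nonempty_support
      refine ⟨a, ?_⟩
      have hca := (cycle_is_cycleOf ha hc)
      have has : a ∈ σ.support := mem_cycleFactorsFinset_support_le hc ha
      ext b
      rw [hca, mem_support_cycleOf_iff]
      simp [has]
    · refine ⟨a, ?_⟩
      ext b
      simp only [Finset.mem_singleton, Finset.mem_filter, Finset.mem_univ, true_and]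
      constructor
      · rintro rfl; exact SameCycle.refl _ _
      · intro h
        exact (h.eq_of_left (by simpa [Function.IsFixedPt] using ha)).symm

/-- The cycle lengths of a permutation are the block sizes of its cycle partition. -/
theorem partition_parts_eq (σ : Perm X) :
    σ.partition.parts = (orbitPart σ).parts.val.map Finset.card := by
  have hinj : Set.InjOn Perm.support (σ.cycleFactorsFinset : Set (Perm X)) := by
    intro c hc c' hc' h
    obtain ⟨a, ha⟩ := (mem_cycleFactorsFinset_iff.mp hc).1.nonempty_support
    rw [cycle_is_cycleOf ha hc, cycle_is_cycleOf (h ▸ ha) hc']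
  have hdisj : Disjoint (σ.cycleFactorsFinset.image Perm.support)
      ((σ.support)ᶜ.image (fun a => ({a} : Finset X))) := by
    rw [Finset.disjoint_left]
    intro V hV hV'
    obtain ⟨c, hc, rfl⟩ := Finset.mem_image.mp hV
    obtain ⟨a, ha, h⟩ := Finset.mem_image.mp hV'
    have := (mem_cycleFactorsFinset_iff.mp hc).1.two_le_card_support
    rw [← h] at this
    simp at this
  rw [orbitPart_parts, ← Finset.disjUnion_eq_union _ _ hdisj, Finset.disjUnion_val,
    Multiset.map_add, Finset.image_val_of_injOn hinj,
    Finset.image_val_of_injOn (Finset.singleton_injective.injOn), Multiset.map_map,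
    Multiset.map_map, parts_partition, cycleType_def]
  congr 1
  simp only [Function.comp_def, Finset.card_singleton]
  rw [Multiset.map_const', Finset.card_val, Finset.card_compl]

theorem cyc_eq_card_parts (σ : Perm X) : cyc σ = (orbitPart σ).parts.card := by
  rw [cyc, partition_parts_eq, Multiset.card_map, Finset.card_val]

/-- The number of classes of an equivalence relation. -/
noncomputable def nq (r : Setoid X) : ℕ := Nat.card (Quotient r)

theorem nq_anti {r s : Setoid X} (h : r ≤ s) : nq s ≤ nq r := by
  refine Nat.card_le_card_of_surjective (Quotient.map' id (fun a b hab => h hab)) ?_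
  intro q
  induction q using Quotient.inductionOn with
  | _ a => exact ⟨Quotient.mk _ a, rfl⟩

theorem card_ofSetoid_parts (r : Setoid X) [DecidableRel r.r] :
    (Finpartition.ofSetoid r).parts.card = nq r := by
  classical
  have h : (Finpartition.ofSetoid r).parts = Finset.univ.image
      (fun q : Quotient r => Finset.univ.filter (fun b => Quotient.mk r b = q)) := by
    unfold Finpartition.ofSetoid
    rw [Finpartition.ofSetSetoid_parts]
    ext V
    simp only [Finset.mem_image, Finset.mem_univ, true_and]
    constructor
    · rintro ⟨a, rfl⟩
      refine ⟨Quotient.mk r a, ?_⟩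
      ext b
      simp only [Finset.mem_filter, Finset.mem_univ, true_and]
      exact ⟨fun h => r.symm' (Quotient.exact h), fun h => Quotient.sound (r.symm' h)⟩
    · rintro ⟨q, rfl⟩
      induction q using Quotient.inductionOn with
      | _ a =>
        refine ⟨a, ?_⟩
        ext b
        simp only [Finset.mem_filter, Finset.mem_univ, true_and]
        exact ⟨fun h => Quotient.sound (r.symm' h), fun h => r.symm' (Quotient.exact h)⟩
  rw [h, Finset.card_image_of_injective, nq, Nat.card_eq_fintype_card, Finset.card_univ]
  intro q q' hqq
  induction q using Quotient.inductionOn with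
  | _ a =>
    have := congrArg (a ∈ ·) hqq
    simpa using this

/-- Turns cycle counts into class counts, so that inequalities between them follow from comparing
equivalence relations. -/
theorem cyc_eq_nq (σ : Perm X) : cyc σ = nq (SameCycle.setoid σ) := by
  rw [cyc_eq_card_parts, orbitPart, card_ofSetoid_parts]

theorem setoid_sameCycle_le_iff {σ : Perm X} {r : Setoid X} :
    SameCycle.setoid σ ≤ r ↔ ∀ x, r x (σ x) := by
  constructor
  · intro h x
    exact h (show SameCycle σ x (σ x) from (SameCycle.refl σ x).apply_right)
  · intro h x y hxy
    obtain ⟨n, rfl⟩ := SameCycle.exists_nat_pow_eq hxy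
    induction n with
    | zero => exact r.refl' _
    | succ n ih =>
      rw [pow_succ', Perm.mul_apply]
      exact r.trans' (ih ⟨n, by simp⟩) (h _)

/-- The equivalence relation obtained from `r` by merging the classes of `a` and `b`. -/
theorem exists_merge (r : Setoid X) (a b : X) :
    ∃ s : Setoid X, r ≤ s ∧ s a b ∧ nq r ≤ nq s + 1 := by
  classical
  let f : X → Quotient r := fun x => if r x b then Quotient.mk r a else Quotient.mk r x
  refine ⟨Setoid.ker f, ?_, ?_, ?_⟩
  · intro x y hxy
    show f x = f y
    simp only [f]
    have h1 : r x b ↔ r y b := ⟨fun h => r.trans' (r.symm' hxy) h, fun h => r.trans' hxy h⟩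
    by_cases h : r x b
    · rw [if_pos h, if_pos (h1.mp h)]
    · rw [if_neg h, if_neg (fun h' => h (h1.mpr h'))]
      exact Quotient.sound hxy
  · show f a = f b
    simp only [f]
    rw [if_pos (r.refl' b)]
    split_ifs <;> rfl
  · unfold nq
    -- Sending the class of b to `none` makes the map injective: all other classes stay distinct
    -- after the merger, so at most one class is lost.
    let g : Quotient r → Option (Quotient (Setoid.ker f)) := fun q =>
      if q = Quotient.mk r b then none else some (Quotient.mk _ q.out)
    have hg : Function.Injective g := by
      intro q q' h
      simp only [g] at h
      split_ifs at h with h1 h2 h2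
      · rw [h1, h2]
      · have h3 : f q.out = f q'.out := Quotient.exact (Option.some.inj h)
        have hq : ¬ r q.out b := fun hh => h1 (by rw [← q.out_eq]; exact Quotient.sound hh)
        have hq' : ¬ r q'.out b := fun hh => h2 (by rw [← q'.out_eq]; exact Quotient.sound hh)
        simp only [f] at h3
        rw [if_neg hq, if_neg hq', q.out_eq, q'.out_eq] at h3
        exact h3
    have := Nat.card_le_card_of_injective g hg
    rwa [Finite.card_option] at this

theorem setoid_swap_mul_le {σ : Perm X} {a b : X} {r : Setoid X}
    (h : SameCycle.setoid σ ≤ r) (hab : r a b) : SameCycle.setoid (swap a b * σ) ≤ r := by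
  rw [setoid_sameCycle_le_iff] at h ⊢
  intro x
  rw [Perm.mul_apply]
  refine r.trans' (h x) ?_
  by_cases h1 : σ x = a
  · rw [h1, swap_apply_left]; exact hab
  · by_cases h2 : σ x = b
    · rw [h2, swap_apply_right]; exact r.symm' hab
    · rw [swap_apply_of_ne_of_ne h1 h2]

theorem cyc_le_cyc_swap_mul (σ : Perm X) (a b : X) : cyc σ ≤ cyc (swap a b * σ) + 1 := by
  obtain ⟨s, h1, h2, h3⟩ := exists_merge (SameCycle.setoid σ) a b
  rw [cyc_eq_nq, cyc_eq_nq]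
  have := nq_anti (setoid_swap_mul_le h1 h2)
  omega

theorem sign_eq_neg_one_pow_cyc (σ : Perm X) :
    (sign σ : ℤ) = (-1) ^ (Fintype.card X + cyc σ) := by
  have h1 : σ.support.card ≤ Fintype.card X := Finset.card_le_univ _
  have h2 : Fintype.card X + cyc σ =
      (σ.cycleType.sum + Multiset.card σ.cycleType) + 2 * (Fintype.card X - σ.support.card) := by
    rw [cyc, parts_partition, Multiset.card_add, Multiset.card_replicate, sum_cycleType]
    omega
  rw [h2, pow_add, pow_mul, sign_of_cycleType]
  simp

theorem cyc_swap_mul_parity (σ : Perm X) {a b : X} (hab : a ≠ b) :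
    (cyc (swap a b * σ) + cyc σ) % 2 = 1 := by
  have h1 := sign_eq_neg_one_pow_cyc (swap a b * σ)
  rw [Perm.sign_mul, sign_swap hab] at h1
  push_cast at h1
  rw [sign_eq_neg_one_pow_cyc σ, pow_add, pow_add] at h1
  have h2 : ((-1 : ℤ)) ^ (cyc (swap a b * σ) + cyc σ) = -1 := by
    have h3 : ((-1 : ℤ)) ^ Fintype.card X * (-1) ^ Fintype.card X = 1 := by
      rw [← pow_add]; exact Even.neg_one_pow ⟨_, rfl⟩
    have h4 : ((-1 : ℤ)) ^ cyc σ * (-1) ^ cyc σ = 1 := by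
      rw [← pow_add]; exact Even.neg_one_pow ⟨_, rfl⟩
    rw [pow_add]
    linear_combination (-(-1 : ℤ) ^ Fintype.card X * (-1) ^ cyc σ) * h1 +
      (-(1 : ℤ) + (-1) ^ cyc (swap a b * σ) * (-1) ^ cyc σ * (-1)) * h3 -
        (-1) ^ Fintype.card X * (-1) ^ Fintype.card X * h4
  by_contra h
  have : Even (cyc (swap a b * σ) + cyc σ) := by
    rw [Nat.even_iff]; omega
  rw [this.neg_one_pow] at h2
  norm_num at h2

/-- The new cycles refine the old ones, so the count does not drop; it changes by at most one, and
the sign excludes equality. -/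
theorem cyc_swap_mul_of_sameCycle {σ : Perm X} {a b : X} (hab : a ≠ b) (h : SameCycle σ a b) :
    cyc (swap a b * σ) = cyc σ + 1 := by
  have h1 : cyc σ ≤ cyc (swap a b * σ) := by
    rw [cyc_eq_nq, cyc_eq_nq]
    exact nq_anti (setoid_swap_mul_le le_rfl h)
  have h2 := cyc_le_cyc_swap_mul (swap a b * σ) a b
  rw [swap_mul_self_mul] at h2
  have h3 := cyc_swap_mul_parity σ hab
  omega

/-- Follow b under σ until its first return k. Before that the orbit meets neither a nor b, so the
transposition does nothing; at time k it redirects b to a. -/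
theorem sameCycle_swap_mul_of_not {σ : Perm X} {a b : X} (h : ¬ SameCycle σ a b) :
    SameCycle (swap a b * σ) a b := by
  classical
  have hex : ∃ k, 0 < k ∧ (σ ^ k) b = b :=
    ⟨orderOf σ, orderOf_pos σ, by rw [pow_orderOf_eq_one]; rfl⟩
  obtain ⟨hk0, hk⟩ := Nat.find_spec hex
  set k := Nat.find hex with hkdef
  have hstep : ∀ i, i < k → ((swap a b * σ) ^ i) b = (σ ^ i) b := by
    intro i
    induction i with
    | zero => intro _; rfl
    | succ i ih =>
      intro hi
      rw [pow_succ', Perm.mul_apply, ih (by omega), Perm.mul_apply, pow_succ', Perm.mul_apply]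
      refine swap_apply_of_ne_of_ne ?_ ?_
      · intro heq
        apply h
        rw [← heq, ← Perm.mul_apply, ← pow_succ', sameCycle_comm]
        exact ⟨(i + 1 : ℕ), by rw [zpow_natCast]⟩
      · intro heq
        rw [← Perm.mul_apply, ← pow_succ'] at heq
        exact Nat.find_min hex hi ⟨by omega, heq⟩
  have hlast : ((swap a b * σ) ^ k) b = a := by
    obtain ⟨j, hj⟩ : ∃ j, k = j + 1 := ⟨k - 1, by omega⟩
    rw [hj, pow_succ', Perm.mul_apply, hstep j (by omega), Perm.mul_apply, ← Perm.mul_apply σ,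
      ← pow_succ', ← hj, hk, swap_apply_right]
  exact SameCycle.symm ⟨(k : ℕ), by rw [zpow_natCast]; exact hlast⟩

theorem cyc_swap_mul_of_not {σ : Perm X} {a b : X} (h : ¬ SameCycle σ a b) :
    cyc (swap a b * σ) + 1 = cyc σ := by
  have hab : a ≠ b := fun he => h (he ▸ SameCycle.refl _ _)
  have h1 := cyc_swap_mul_of_sameCycle hab (sameCycle_swap_mul_of_not h)
  rw [swap_mul_self_mul] at h1
  exact h1.symm

theorem cyc_of_isConj {σ τ : Perm X} (h : IsConj σ τ) : cyc σ = cyc τ := by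
  rw [cyc, cyc, partition_eq_of_isConj.mp h]

theorem cyc_mul_comm (σ τ : Perm X) : cyc (σ * τ) = cyc (τ * σ) := by
  apply cyc_of_isConj
  rw [isConj_iff]
  exact ⟨τ, by group⟩

theorem nq_le_card (r : Setoid X) : nq r ≤ Fintype.card X := by
  rw [nq, ← Nat.card_eq_fintype_card]
  exact Nat.card_le_card_of_surjective (Quotient.mk _) Quotient.mk_surjective

theorem cyc_le_card (σ : Perm X) : cyc σ ≤ Fintype.card X := by
  rw [cyc_eq_nq]
  exact nq_le_card _

theorem cyc_one : cyc (1 : Perm X) = Fintype.card X := by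
  simp [cyc, parts_partition]

theorem cyc_eq_card_iff {σ : Perm X} : cyc σ = Fintype.card X ↔ σ = 1 := by
  refine ⟨fun h => ?_, fun h => h ▸ cyc_one⟩
  by_contra hne
  obtain ⟨a, ha⟩ : ∃ a, σ a ≠ a := by
    by_contra hall
    push Not at hall
    exact hne (Perm.ext hall)
  have h1 := cyc_swap_mul_of_sameCycle ha.symm
    (show SameCycle σ a (σ a) from (SameCycle.refl σ a).apply_right)
  have := cyc_le_card (swap a (σ a) * σ)
  omega

/-- The orbit equivalence relation of the group generated by two permutations. -/
def joinSetoid (σ α : Perm X) : Setoid X := SameCycle.setoid σ ⊔ SameCycle.setoid α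

/-- Nonnegativity of the genus, for a possibly intransitive pair of permutations. -/
theorem cyc_add_cyc_add_cyc_le (σ α : Perm X) :
    cyc σ + cyc α + cyc (σ⁻¹ * α) ≤ Fintype.card X + 2 * nq (joinSetoid σ α) := by
  induction hk : Fintype.card X - cyc σ generalizing σ with
  | zero =>
    have h1 : σ = 1 := cyc_eq_card_iff.mp (by have := cyc_le_card σ; omega)
    subst h1
    have h2 : joinSetoid 1 α = SameCycle.setoid α := by
      apply sup_eq_right.mpr
      rw [setoid_sameCycle_le_iff]
      intro x; exact (SameCycle.setoid α).refl' x
    rw [h2, ← cyc_eq_nq, cyc_one, inv_one, one_mul]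
    omega
  | succ k ih =>
    have hne : σ ≠ 1 := by
      rintro rfl
      rw [cyc_one] at hk; omega
    obtain ⟨a, ha⟩ : ∃ a, σ a ≠ a := by
      by_contra hall
      push Not at hall
      exact hne (Perm.ext hall)
    set b := σ a with hb
    set ρ := swap a b * σ with hρ
    have hσ : σ = swap a b * ρ := by rw [hρ, swap_mul_self_mul]
    have hsame : SameCycle σ a b := (SameCycle.refl σ a).apply_right
    have h1 : cyc ρ = cyc σ + 1 := cyc_swap_mul_of_sameCycle ha.symm hsame
    have hI := ih ρ (by omega)
    have h2 : cyc (σ⁻¹ * α) = cyc (swap a b * (α * ρ⁻¹)) := by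
      rw [hσ, mul_inv_rev, swap_inv, mul_assoc, cyc_mul_comm, mul_assoc]
    have h3 : cyc (ρ⁻¹ * α) = cyc (α * ρ⁻¹) := cyc_mul_comm _ _
    -- Passing from ρ back to σ loses one cycle. If a and b already lie in one orbit of the group of
    -- ρ and α, the orbits do not get coarser and the third count rises by at most one. Otherwise
    -- the third count drops by one as well, against the loss of at most one orbit, which counts
    -- twice.
    have hJ : joinSetoid σ α ≤ (joinSetoid ρ α) ∨ ¬ (joinSetoid ρ α) a b := by
      by_cases h : (joinSetoid ρ α) a b
      · left
        refine sup_le ?_ le_sup_right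
        rw [hσ]
        exact setoid_swap_mul_le le_sup_left h
      · right; exact h
    rcases hJ with hJ | hJ
    · have h4 := nq_anti hJ
      have h5 := cyc_le_cyc_swap_mul (swap a b * (α * ρ⁻¹)) a b
      rw [swap_mul_self_mul] at h5
      omega
    · have h4 : ¬ SameCycle (α * ρ⁻¹) a b := by
        intro h
        apply hJ
        have : SameCycle.setoid (α * ρ⁻¹) ≤ joinSetoid ρ α := by
          rw [setoid_sameCycle_le_iff]
          intro x
          rw [Perm.mul_apply]
          refine (joinSetoid ρ α).trans' (show _ from ?_ : joinSetoid ρ α x (ρ⁻¹ x)) ?_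
          · refine (le_sup_left : _ ≤ joinSetoid ρ α) ?_
            show SameCycle ρ x (ρ⁻¹ x)
            exact sameCycle_inv.mp ((SameCycle.refl ρ⁻¹ x).apply_right)
          · refine (le_sup_right : _ ≤ joinSetoid ρ α) ?_
            exact (SameCycle.refl α _).apply_right
        exact this h
      have h5 := cyc_swap_mul_of_not h4
      obtain ⟨s, hs1, hs2, hs3⟩ := exists_merge (joinSetoid ρ α) a b
      have h6 : joinSetoid σ α ≤ s := by
        refine sup_le ?_ (le_sup_right.trans hs1)
        rw [hσ]
        exact setoid_swap_mul_le (le_sup_left.trans hs1) hs2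
      have h7 := nq_anti h6
      omega

end Cycles

/-! ## Non-crossing partitions as permutations of genus zero -/

section Biane

theorem eq_of_le_of_nq_le {X : Type*} [Fintype X] [DecidableEq X] {r s : Setoid X} (h : r ≤ s)
    (hn : nq r ≤ nq s) : r = s := by
  refine le_antisymm h ?_
  let f : Quotient r → Quotient s := Quotient.map' id (fun a b hab => h hab)
  have hf : Function.Surjective f := by
    intro q
    induction q using Quotient.inductionOn with
    | _ a => exact ⟨Quotient.mk _ a, rfl⟩
  have hb : Function.Injective f := by
    have : Nat.card (Quotient r) = Nat.card (Quotient s) := le_antisymm hn (nq_anti h)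
    exact ((Nat.bijective_iff_surjective_and_card f).mpr ⟨hf, this⟩).1
  intro x y hxy
  exact Quotient.exact (hb (Quotient.sound hxy : f (Quotient.mk r x) = f (Quotient.mk r y)))

variable {n : ℕ}

theorem val_finRotate (x : Fin n) :
    (finRotate n x : ℕ) = if (x : ℕ) + 1 = n then 0 else (x : ℕ) + 1 := by
  cases n with
  | zero => exact x.elim0
  | succ n =>
    split_ifs with h
    · have : x = Fin.last n := by ext; simp; omega
      rw [this, finRotate_last]; rfl
    · rw [coe_finRotate_of_ne_last]
      intro h2; apply h; rw [h2]; simp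

theorem sameCycle_finRotate (x y : Fin n) : SameCycle (finRotate n) x y := by
  have h0 : ∀ k : ℕ, ∀ z : Fin n, (z : ℕ) = k → ∀ hn : 0 < n,
      SameCycle (finRotate n) ⟨0, hn⟩ z := by
    intro k
    induction k with
    | zero =>
      intro z hz hn
      have : z = ⟨0, hn⟩ := Fin.ext hz
      rw [this]
    | succ k ih =>
      intro z hz hn
      have hlt := z.isLt
      have hz' : z = finRotate n ⟨k, by omega⟩ := by
        ext
        rw [val_finRotate, if_neg (by simp; omega), hz]
      rw [hz', sameCycle_apply_right]
      exact ih _ rfl hn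
  have hn : 0 < n := x.pos
  exact (h0 _ x rfl hn).symm.trans (h0 _ y rfl hn)

theorem cyc_eq_one_of_sameCycle {X : Type*} [Fintype X] [DecidableEq X] [Nonempty X] {σ : Perm X}
    (h : ∀ x y, SameCycle σ x y) : cyc σ = 1 := by
  rw [cyc_eq_nq, nq, Nat.card_eq_one_iff_unique]
  refine ⟨⟨fun a b => ?_⟩, ⟨Quotient.mk _ (Classical.arbitrary X)⟩⟩
  induction a, b using Quotient.inductionOn₂ with
  | _ a b => exact Quotient.sound (h a b)

theorem cyc_finRotate (hn : 1 ≤ n) : cyc (finRotate n) = 1 := by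
  have : Nonempty (Fin n) := ⟨⟨0, hn⟩⟩
  exact cyc_eq_one_of_sameCycle sameCycle_finRotate

/-- The equivalence relation with classes `[a, b)` and its complement. -/
def arcSetoid (a b : Fin n) : Setoid (Fin n) := Setoid.ker (fun x => a ≤ x ∧ x < b)

theorem arcSetoid_iff {a b x y : Fin n} :
    arcSetoid a b x y ↔ ((a ≤ x ∧ x < b) ↔ (a ≤ y ∧ y < b)) := by
  show ((a ≤ x ∧ x < b) = (a ≤ y ∧ y < b)) ↔ _
  rw [eq_iff_iff]

/-- The transposition cuts the long cycle into two arcs: the point before a now jumps to b, and the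
point before b returns to a. -/
theorem sameCycle_swap_mul_finRotate_le {a b : Fin n} (hab : a < b) :
    SameCycle.setoid (swap a b * finRotate n) ≤ arcSetoid a b := by
  rw [setoid_sameCycle_le_iff]
  intro x
  rw [arcSetoid_iff, Perm.mul_apply]
  have hx := val_finRotate x
  have hxn := x.isLt
  have hbn := b.isLt
  rw [Fin.lt_def] at hab
  by_cases h1 : finRotate n x = a
  · rw [h1, swap_apply_left]
    rw [h1] at hx
    simp only [Fin.le_def, Fin.lt_def]
    split_ifs at hx <;> omega
  · by_cases h2 : finRotate n x = b
    · rw [h2, swap_apply_right]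
      rw [h2] at hx
      simp only [Fin.le_def, Fin.lt_def]
      split_ifs at hx <;> omega
    · rw [swap_apply_of_ne_of_ne h1 h2]
      rw [Fin.ext_iff] at h1 h2
      simp only [Fin.le_def, Fin.lt_def]
      split_ifs at hx <;> omega

/-- The permutations of genus zero relative to the long cycle. -/
def IsGenusZero (σ : Perm (Fin n)) : Prop := cyc σ + cyc (σ⁻¹ * finRotate n) = n + 1

/-- Multiplying both σ and the long cycle by the transposition leaves σ⁻¹γ unchanged and raises both
cycle counts by one. The genus inequality then demands at least two joint orbits, while the cut long
cycle has only two cycles. So these are the joint orbits, and the new σ respects the two arcs. -/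
theorem IsGenusZero.swap_mul_le {σ : Perm (Fin n)} (hσ : IsGenusZero σ) {a b : Fin n} (hab : a < b)
    (h : SameCycle σ a b) : SameCycle.setoid (swap a b * σ) ≤ arcSetoid a b := by
  have hn : 1 ≤ n := a.pos
  have h1 := cyc_swap_mul_of_sameCycle hab.ne h
  have h2 := cyc_swap_mul_of_sameCycle hab.ne (sameCycle_finRotate a b)
  rw [cyc_finRotate hn] at h2
  have h3 := cyc_add_cyc_add_cyc_le (swap a b * σ) (swap a b * finRotate n)
  have h4 : (swap a b * σ)⁻¹ * (swap a b * finRotate n) = σ⁻¹ * finRotate n := by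
    rw [mul_inv_rev, swap_inv, mul_assoc, swap_mul_self_mul]
  unfold IsGenusZero at hσ
  rw [h4, Fintype.card_fin] at h3
  have h5 : SameCycle.setoid (swap a b * finRotate n) =
      joinSetoid (swap a b * σ) (swap a b * finRotate n) := by
    refine eq_of_le_of_nq_le le_sup_right ?_
    rw [← cyc_eq_nq]
    omega
  calc _ ≤ joinSetoid (swap a b * σ) (swap a b * finRotate n) := le_sup_left
    _ ≤ _ := h5 ▸ sameCycle_swap_mul_finRotate_le hab

theorem IsGenusZero.arc_iff {σ : Perm (Fin n)} (hσ : IsGenusZero σ) {a b : Fin n} (hab : a < b)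
    (h : SameCycle σ a b) (x : Fin n) :
    (a ≤ x ∧ x < b) ↔ (a ≤ swap a b (σ x) ∧ swap a b (σ x) < b) :=
  arcSetoid_iff.mp (setoid_sameCycle_le_iff.mp (hσ.swap_mul_le hab h) x)

/-- A cycle through b that avoids a and c is untouched by their transposition, hence trapped in the
arc [a, c) and unable to reach d. -/
theorem IsGenusZero.nonCrossing {σ : Perm (Fin n)} (hσ : IsGenusZero σ) {a b c d : Fin n}
    (hab : a < b) (hbc : b < c) (hcd : c < d) (hac : SameCycle σ a c) (hbd : SameCycle σ b d) :
    SameCycle σ a b := by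
  by_contra hnot
  have key : ∀ k : ℕ, a ≤ (σ ^ k) b ∧ (σ ^ k) b < c := by
    intro k
    induction k with
    | zero => exact ⟨hab.le, hbc⟩
    | succ k ih =>
      have h1 := (hσ.arc_iff (hab.trans hbc) hac _).mp ih
      rw [pow_succ', Perm.mul_apply]
      have hb : SameCycle σ b (σ ((σ ^ k) b)) := by
        rw [sameCycle_apply_right, sameCycle_pow_right]
      have h2 : σ ((σ ^ k) b) ≠ c := by
        intro h; rw [h] at hb; exact hnot (hac.trans hb.symm)
      have h3 : σ ((σ ^ k) b) ≠ a := by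
        intro h; rw [h] at hb; exact hnot hb.symm
      rwa [swap_apply_of_ne_of_ne h3 h2] at h1
  obtain ⟨k, hk⟩ := hbd.exists_nat_pow_eq
  have := (key k).2
  rw [hk] at this
  exact absurd (hcd.trans this) (lt_irrefl _)

/-- If, say, σ a < τ a in a common cycle, look at the arc [σ a, τ a). The arc property of σ puts a
outside it, that of τ puts a inside. -/
theorem IsGenusZero.ext {σ τ : Perm (Fin n)} (hσ : IsGenusZero σ) (hτ : IsGenusZero τ)
    (h : ∀ x y, SameCycle σ x y ↔ SameCycle τ x y) : σ = τ := by
  ext1 a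
  by_contra hne
  have hs1 : SameCycle σ a (σ a) := (SameCycle.refl σ a).apply_right
  have ht1 : SameCycle τ a (τ a) := (SameCycle.refl τ a).apply_right
  have hs2 : SameCycle σ a (τ a) := (h _ _).mpr ht1
  have ht2 : SameCycle τ a (σ a) := (h _ _).mp hs1
  have ha1 : σ a ≠ a := by
    intro he
    exact hne (by rw [he]; exact hs2.eq_of_left he)
  have ha2 : τ a ≠ a := by
    intro he
    exact hne (by rw [he]; exact (ht2.eq_of_left he).symm)
  have main : ∀ ρ ρ' : Perm (Fin n), IsGenusZero ρ → IsGenusZero ρ' →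
      SameCycle ρ (ρ a) (ρ' a) → SameCycle ρ' (ρ a) (ρ' a) →
      ρ a ≠ a → ρ' a ≠ a → ρ a < ρ' a → False := by
    intro ρ ρ' hρ hρ' h1 h2 h3 h4 hlt
    have e1 := hρ.arc_iff hlt h1 a
    have e2 := hρ'.arc_iff hlt h2 a
    rw [swap_apply_left] at e1
    rw [swap_apply_right] at e2
    have e3 : ¬ (ρ a ≤ a ∧ a < ρ' a) := fun h => absurd (e1.mp h).2 (lt_irrefl _)
    have e4 := e2.mpr ⟨le_rfl, hlt⟩
    exact e3 e4
  rcases lt_or_gt_of_ne hne with hlt | hlt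
  · exact main σ τ hσ hτ (hs1.symm.trans hs2) (ht2.symm.trans ht1) ha1 ha2 hlt
  · exact main τ σ hτ hσ (ht1.symm.trans ht2) (hs2.symm.trans hs1) ha2 ha1 hlt

/-- Induction on the number of mergers. Take a and its next larger block mate b, make a a singleton,
realise the finer relation by ρ, and insert a just before b by multiplying with the transposition.
-/
theorem exists_isGenusZero (hn : 1 ≤ n) (r : Setoid (Fin n))
    (hr : ∀ a b c d, a < b → b < c → c < d → r a c → r b d → r a b) :
    ∃ σ : Perm (Fin n), IsGenusZero σ ∧ SameCycle.setoid σ = r := by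
  induction hk : n - nq r using Nat.strong_induction_on generalizing r with
  | _ k ih =>
    by_cases hbot : r = ⊥
    · refine ⟨1, ?_, ?_⟩
      · unfold IsGenusZero
        rw [cyc_one, inv_one, one_mul, cyc_finRotate hn, Fintype.card_fin]
      · rw [hbot, eq_bot_iff, setoid_sameCycle_le_iff]
        intro x; exact (⊥ : Setoid _).refl' x
    obtain ⟨a, b0, hab0, hrab0⟩ : ∃ a b, a < b ∧ r a b := by
      by_contra hcon
      push Not at hcon
      apply hbot
      rw [eq_bot_iff]
      intro x y hxy
      show x = y
      by_contra hne
      rcases lt_or_gt_of_ne hne with h | h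
      · exact hcon x y h hxy
      · exact hcon y x h (r.symm' hxy)
    classical
    obtain ⟨b, ⟨hab, hrab⟩, hbmin⟩ : ∃ b, (a < b ∧ r a b) ∧ ∀ c, a < c → r a c → b ≤ c := by
      have hne : (Finset.univ.filter (fun b => a < b ∧ r a b)).Nonempty :=
        ⟨b0, by simp [hab0, hrab0]⟩
      refine ⟨_, (Finset.mem_filter.mp (Finset.min'_mem _ hne)).2, fun c h1 h2 => ?_⟩
      exact Finset.min'_le _ _ (by simp [h1, h2])
    let r' : Setoid (Fin n) :=
      { r := fun x y => x = y ∨ (r x y ∧ x ≠ a ∧ y ≠ a)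
        iseqv := by
          refine ⟨fun x => Or.inl rfl, ?_, ?_⟩
          · rintro x y (rfl | ⟨h1, h2, h3⟩)
            · exact Or.inl rfl
            · exact Or.inr ⟨r.symm' h1, h3, h2⟩
          · rintro x y z (rfl | ⟨h1, h2, h3⟩) (rfl | ⟨h4, h5, h6⟩)
            · exact Or.inl rfl
            · exact Or.inr ⟨h4, h5, h6⟩
            · exact Or.inr ⟨h1, h2, h3⟩
            · exact Or.inr ⟨r.trans' h1 h4, h2, h6⟩ }
    have hr'r : r' ≤ r := by
      rintro x y (rfl | ⟨h1, -, -⟩)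
      · exact r.refl' _
      · exact h1
    have hr'ab : ¬ r' a b := by
      rintro (h | ⟨-, h, -⟩)
      · exact hab.ne h
      · exact h rfl
    have hlt : nq r < nq r' := by
      by_contra hge
      have := eq_of_le_of_nq_le hr'r (not_lt.mp hge)
      rw [this] at hr'ab
      exact hr'ab hrab
    have hle : nq r' ≤ n := by
      simpa using nq_le_card r'
    obtain ⟨ρ, hρ, hρr⟩ := ih (n - nq r') (by omega) r' (by
      rintro x y z w h1 h2 h3 (h4 | ⟨h4, h5, h6⟩) (h7 | ⟨h7, h8, h9⟩)
      · exact absurd h4 (h1.trans h2).ne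
      · exact absurd h4 (h1.trans h2).ne
      · exact absurd h7 (h2.trans h3).ne
      · exact Or.inr ⟨hr x y z w h1 h2 h3 h4 h7, h5, h8⟩) rfl
    have hρab : ¬ SameCycle ρ a b := by
      intro h
      have : SameCycle.setoid ρ a b := h
      rw [hρr] at this
      exact hr'ab this
    have hc := cyc_swap_mul_of_not hρab
    refine ⟨swap a b * ρ, ?_, ?_⟩
    -- By minimality of b and non-crossing, no block of the finer relation straddles the arc [a, b).
    · have hρarc : SameCycle.setoid ρ ≤ arcSetoid a b := by
        rw [hρr]
        have side : ∀ x y, r x y → a ≤ x → x < b → x ≠ a → y ≠ a → (a ≤ y ∧ y < b) := by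
          intro x y hxy h1 h2 hxa hya
          have hax : a < x := lt_of_le_of_ne h1 (Ne.symm hxa)
          by_contra hcon
          rcases lt_or_ge y a with h | h
          · have := hr y a x b h hax h2 (r.symm' hxy) hrab
            exact absurd (hbmin x hax (r.trans' (r.symm' this) (r.symm' hxy))) (not_le.mpr h2)
          · have hby : b ≤ y := by
              by_contra h'; exact hcon ⟨h, not_le.mp h'⟩
            rcases hby.eq_or_lt with h' | h'
            · rw [← h'] at hxy
              exact absurd (hbmin x hax (r.trans' hrab (r.symm' hxy))) (not_le.mpr h2)
            · have := hr a x b y hax h2 h' hrab hxy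
              exact absurd (hbmin x hax this) (not_le.mpr h2)
        rintro x y (rfl | ⟨h1, h2, h3⟩)
        · exact (arcSetoid a b).refl' x
        · rw [arcSetoid_iff]
          exact ⟨fun h => side x y h1 h.1 h.2 h2 h3,
            fun h => side y x (r.symm' h1) h.1 h.2 h3 h2⟩
      have hγarc := sameCycle_swap_mul_finRotate_le hab
      set γ' := swap a b * finRotate n with hγ'
      -- Both factors respect the arc, which contains a but not b. So the transposition merges
      -- cycles here too, and the cycle lost by ρ is regained by the complementary permutation.
      have h4 : ¬ SameCycle (γ' * ρ⁻¹) a b := by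
        intro h
        have h6 : SameCycle.setoid (γ' * ρ⁻¹) ≤ arcSetoid a b := by
          rw [setoid_sameCycle_le_iff]
          intro x
          rw [Perm.mul_apply]
          refine (arcSetoid a b).trans' (hρarc (show SameCycle ρ x (ρ⁻¹ x) from ?_)) (hγarc ?_)
          · exact sameCycle_inv.mp ((SameCycle.refl ρ⁻¹ x).apply_right)
          · exact (SameCycle.refl γ' _).apply_right
        have h7 := arcSetoid_iff.mp (h6 h)
        exact absurd (h7.mp ⟨le_rfl, hab⟩).2 (lt_irrefl _)
      have h5 := cyc_swap_mul_of_not h4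
      have h6 : (swap a b * ρ)⁻¹ * finRotate n = ρ⁻¹ * γ' := by
        rw [hγ', mul_inv_rev, swap_inv, mul_assoc]
      have h7 : cyc (swap a b * (γ' * ρ⁻¹)) = cyc (ρ⁻¹ * finRotate n) := by
        rw [hγ', mul_assoc, swap_mul_self_mul, cyc_mul_comm]
      unfold IsGenusZero at hρ ⊢
      rw [h6, cyc_mul_comm ρ⁻¹]
      omega
    · have h1 : SameCycle.setoid (swap a b * ρ) ≤ r :=
        setoid_swap_mul_le (hρr ▸ hr'r) hrab
      refine eq_of_le_of_nq_le h1 ?_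
      obtain ⟨s, hs1, hs2, hs3⟩ := exists_merge r' a b
      have hrs : r ≤ s := by
        intro x y hxy
        by_cases hx : x = a
        · by_cases hy : y = a
          · rw [hx, hy]
          · rw [hx] at hxy ⊢
            refine s.trans' hs2 (hs1 (Or.inr ⟨r.trans' (r.symm' hrab) hxy, hab.ne', hy⟩))
        · by_cases hy : y = a
          · rw [hy] at hxy ⊢
            exact s.symm' (s.trans' hs2
              (hs1 (Or.inr ⟨r.trans' (r.symm' hrab) (r.symm' hxy), hab.ne', hx⟩)))
          · exact hs1 (Or.inr ⟨hxy, hx, hy⟩)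
      have h2 := nq_anti hrs
      have h3 := cyc_eq_nq (swap a b * ρ)
      have h4 := cyc_eq_nq ρ
      rw [hρr] at h4
      omega

theorem mem_orbitPart_iff_sameCycle {X : Type*} [Fintype X] [DecidableEq X] {σ : Perm X}
    {V : Finset X} (hV : V ∈ (orbitPart σ).parts) {x y : X} (hx : x ∈ V) :
    y ∈ V ↔ SameCycle σ x y := by
  obtain ⟨a, rfl⟩ := mem_orbitPart.mp hV
  simp only [Finset.mem_filter, Finset.mem_univ, true_and] at hx ⊢
  exact ⟨fun h => hx.symm.trans h, fun h => hx.trans h⟩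

open Classical in
/-- Summing a function of the block sizes over `NC(n)` is summing over permutations of genus
zero. -/
theorem sum_NC_eq_sum_isGenusZero (hn : 1 ≤ n) (F : Multiset ℕ → ℝ) :
    ∑ π ∈ NC n, F (π.parts.val.map Finset.card) =
      ∑ σ : Perm (Fin n) with IsGenusZero σ, F σ.partition.parts := by
  symm
  refine Finset.sum_bij (fun σ _ => orbitPart σ) ?_ ?_ ?_ ?_
  · intro σ hσ
    simp only [Finset.mem_filter, Finset.mem_univ, true_and] at hσ
    simp only [NC, Finset.mem_filter, Finset.mem_univ, true_and]
    intro a b c d hab hbc hcd V hV W hW haV hcV hbW hdW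
    have h1 := (mem_orbitPart_iff_sameCycle hV haV).mp hcV
    have h2 := (mem_orbitPart_iff_sameCycle hW hbW).mp hdW
    have h3 := hσ.nonCrossing hab hbc hcd h1 h2
    exact (orbitPart σ).eq_of_mem_parts hV hW ((mem_orbitPart_iff_sameCycle hV haV).mpr h3) hbW
  · intro σ hσ τ hτ h
    simp only [Finset.mem_filter, Finset.mem_univ, true_and] at hσ hτ
    refine hσ.ext hτ (fun x y => ?_)
    obtain ⟨V, hV, hx⟩ := (orbitPart σ).exists_mem (Finset.mem_univ x)
    rw [← mem_orbitPart_iff_sameCycle hV hx]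
    have hV' : V ∈ (orbitPart τ).parts := by
      have h' : orbitPart σ = orbitPart τ := h
      exact h' ▸ hV
    rw [← mem_orbitPart_iff_sameCycle hV' hx]
  · intro π hπ
    simp only [NC, Finset.mem_filter, Finset.mem_univ, true_and] at hπ
    let r : Setoid (Fin n) := Setoid.ker (fun x => π.part x)
    have hr : ∀ x y, r x y ↔ y ∈ π.part x := by
      intro x y
      show π.part x = π.part y ↔ _
      constructor
      · intro h; rw [h]; exact π.mem_part (Finset.mem_univ y)
      · intro h
        exact (π.part_eq_of_mem (π.part_mem.mpr (Finset.mem_univ x)) h).symm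
    obtain ⟨σ, hσ, hσr⟩ := exists_isGenusZero hn r (by
      intro a b c d hab hbc hcd hac hbd
      have hA := π.part_mem.mpr (Finset.mem_univ a)
      have hB := π.part_mem.mpr (Finset.mem_univ b)
      exact hπ a b c d hab hbc hcd _ hA _ hB (π.mem_part (Finset.mem_univ a))
        ((hr _ _).mp hac) (π.mem_part (Finset.mem_univ b)) ((hr _ _).mp hbd))
    refine ⟨σ, by simpa using hσ, ?_⟩
    apply Finpartition.ext
    ext V
    rw [mem_orbitPart]
    have hs : ∀ a, Finset.univ.filter (fun b => SameCycle σ a b) = π.part a := by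
      intro a
      ext b
      rw [← hr, ← hσr]
      simp only [Finset.mem_filter, Finset.mem_univ, true_and]
      rfl
    constructor
    · rintro ⟨a, rfl⟩
      rw [hs a]
      exact π.part_mem.mpr (Finset.mem_univ a)
    · intro hV
      obtain ⟨a, ha⟩ := π.nonempty_of_mem_parts hV
      refine ⟨a, ?_⟩
      rw [← π.part_eq_of_mem hV ha, ← hs a]
  · intro σ _
    rw [partition_parts_eq]

end Biane

/-! ## Splitting a pair of permutations along an orbit -/

section Split

variable {X : Type*} [Fintype X] [DecidableEq X] {Y : Type*} [Fintype Y] [DecidableEq Y]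

theorem parts_permCongr (e : X ≃ Y) (σ : Perm X) :
    (e.permCongr σ).partition.parts = σ.partition.parts := by
  -- `extendDomain` expects a subtype as target, so Y is viewed as the subtype of a trivially true
  -- predicate.
  let e' : X ≃ {y : Y // True} := e.trans (Equiv.Set.univ Y).symm
  have h1 : e.permCongr σ = σ.extendDomain e' := by
    ext y
    obtain ⟨x, rfl⟩ := e.surjective y
    have h2 := σ.extendDomain_apply_image e' x
    have h3 : ∀ z, ((e' z : {y : Y // True}) : Y) = e z := fun z => rfl
    rw [h3, h3] at h2
    rw [h2]
    simp
  have h2 : (e.permCongr σ).cycleType = σ.cycleType := by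
    rw [h1, cycleType_extendDomain]
  rw [parts_partition, parts_partition, ← sum_cycleType, ← sum_cycleType, h2, Fintype.card_congr e]

theorem cyc_permCongr (e : X ≃ Y) (σ : Perm X) : cyc (e.permCongr σ) = cyc σ := by
  rw [cyc, cyc, parts_permCongr]

theorem wprod_permCongr (u : ℕ → ℝ) (e : X ≃ Y) (σ : Perm X) :
    wprod u (e.permCongr σ) = wprod u σ := by
  rw [wprod, wprod, parts_permCongr]

theorem permCongr_mul' (e : X ≃ Y) (σ τ : Perm X) :
    e.permCongr (σ * τ) = e.permCongr σ * e.permCongr τ := by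
  ext x; simp

theorem permCongr_inv' (e : X ≃ Y) (σ : Perm X) :
    e.permCongr σ⁻¹ = (e.permCongr σ)⁻¹ := by
  rw [eq_inv_iff_mul_eq_one, ← permCongr_mul', inv_mul_cancel]
  ext x; simp

theorem joinSetoid_le_iff {σ α : Perm X} {r : Setoid X} :
    joinSetoid σ α ≤ r ↔ (∀ x, r x (σ x)) ∧ ∀ x, r x (α x) := by
  rw [joinSetoid, sup_le_iff, setoid_sameCycle_le_iff, setoid_sameCycle_le_iff]

theorem joinSetoid_left (σ α : Perm X) (x : X) : joinSetoid σ α x (σ x) :=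
  (joinSetoid_le_iff.mp le_rfl).1 x

theorem joinSetoid_right (σ α : Perm X) (x : X) : joinSetoid σ α x (α x) :=
  (joinSetoid_le_iff.mp le_rfl).2 x

theorem joinSetoid_permCongr_of_eq_top (e : X ≃ Y) {σ α : Perm X} (h : joinSetoid σ α = ⊤) :
    joinSetoid (e.permCongr σ) (e.permCongr α) = ⊤ := by
  set J := joinSetoid (e.permCongr σ) (e.permCongr α) with hJ
  have h1 : joinSetoid σ α ≤ Setoid.comap e J := by
    rw [joinSetoid_le_iff]
    constructor
    · intro x
      have := joinSetoid_left (e.permCongr σ) (e.permCongr α) (e x)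
      simpa [Setoid.comap_rel, hJ] using this
    · intro x
      have := joinSetoid_right (e.permCongr σ) (e.permCongr α) (e x)
      simpa [Setoid.comap_rel, hJ] using this
  rw [h] at h1
  rw [eq_top_iff]
  intro x y _
  have h2 : (Setoid.comap e J) (e.symm x) (e.symm y) := h1 trivial
  simpa [Setoid.comap_rel] using h2

theorem joinSetoid_permCongr_eq_top_iff (e : X ≃ Y) {σ α : Perm X} :
    joinSetoid (e.permCongr σ) (e.permCongr α) = ⊤ ↔ joinSetoid σ α = ⊤ := by
  refine ⟨fun h => ?_, joinSetoid_permCongr_of_eq_top e⟩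
  have := joinSetoid_permCongr_of_eq_top e.symm h
  have h1 : ∀ τ : Perm X, e.symm.permCongr (e.permCongr τ) = τ := fun τ => by ext x; simp
  rwa [h1, h1] at this

section Glue

variable (A : Finset X)

/-- The permutation with prescribed restrictions to `A` and to its complement. -/
def glue (σ : Perm {x // x ∈ A}) (τ : Perm {x // ¬ x ∈ A}) : Perm X := Perm.subtypeCongr σ τ

variable {A}

theorem glue_left (σ : Perm {x // x ∈ A}) (τ : Perm {x // ¬ x ∈ A}) {x : X} (hx : x ∈ A) :
    glue A σ τ x = σ ⟨x, hx⟩ := Perm.subtypeCongr.left_apply σ τ hx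

theorem glue_right (σ : Perm {x // x ∈ A}) (τ : Perm {x // ¬ x ∈ A}) {x : X} (hx : ¬ x ∈ A) :
    glue A σ τ x = τ ⟨x, hx⟩ := Perm.subtypeCongr.right_apply σ τ hx

theorem glue_eq (σ : Perm {x // x ∈ A}) (τ : Perm {x // ¬ x ∈ A}) :
    glue A σ τ = ofSubtype σ * ofSubtype τ := by
  ext x
  rw [Perm.mul_apply]
  by_cases hx : x ∈ A
  · rw [ofSubtype_apply_of_not_mem (p := fun x => ¬ x ∈ A) τ (by simpa using hx),
      ofSubtype_apply_of_mem σ hx, glue_left σ τ hx]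
  · rw [ofSubtype_apply_of_mem (p := fun x => ¬ x ∈ A) τ hx, glue_right σ τ hx,
      ofSubtype_apply_of_not_mem σ (τ ⟨x, hx⟩).2]

theorem parts_glue (σ : Perm {x // x ∈ A}) (τ : Perm {x // ¬ x ∈ A}) :
    (glue A σ τ).partition.parts = σ.partition.parts + τ.partition.parts := by
  have hd : Perm.Disjoint (ofSubtype σ) (ofSubtype τ) := by
    intro x
    by_cases hx : x ∈ A
    · right; exact ofSubtype_apply_of_not_mem (p := fun x => ¬ x ∈ A) τ (by simpa using hx)
    · left; exact ofSubtype_apply_of_not_mem σ hx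
  have h1 : (glue A σ τ).cycleType = σ.cycleType + τ.cycleType := by
    rw [glue_eq, hd.cycleType_mul, cycleType_ofSubtype, cycleType_ofSubtype]
  have h2 : Fintype.card {x // x ∈ A} + Fintype.card {x // ¬ x ∈ A} = Fintype.card X :=
    by
      rw [Fintype.card_subtype_compl]
      have := Fintype.card_subtype_le (fun x => x ∈ A)
      omega
  have h3 : σ.support.card ≤ Fintype.card {x // x ∈ A} := Finset.card_le_univ _
  have h4 : τ.support.card ≤ Fintype.card {x // ¬ x ∈ A} := Finset.card_le_univ _
  rw [parts_partition, parts_partition, parts_partition, ← sum_cycleType, h1, Multiset.sum_add,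
    sum_cycleType, sum_cycleType]
  have h5 : Fintype.card X - (σ.support.card + τ.support.card) =
      (Fintype.card {x // x ∈ A} - σ.support.card) +
        (Fintype.card {x // ¬ x ∈ A} - τ.support.card) := by omega
  rw [h5, Multiset.replicate_add]
  abel

theorem cyc_glue (σ : Perm {x // x ∈ A}) (τ : Perm {x // ¬ x ∈ A}) :
    cyc (glue A σ τ) = cyc σ + cyc τ := by
  rw [cyc, parts_glue, Multiset.card_add]; rfl

theorem wprod_glue (u : ℕ → ℝ) (σ : Perm {x // x ∈ A}) (τ : Perm {x // ¬ x ∈ A}) :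
    wprod u (glue A σ τ) = wprod u σ * wprod u τ := by
  rw [wprod, parts_glue, Multiset.map_add, Multiset.prod_add]; rfl

theorem glue_mul (σ σ' : Perm {x // x ∈ A}) (τ τ' : Perm {x // ¬ x ∈ A}) :
    glue A (σ * σ') (τ * τ') = glue A σ τ * glue A σ' τ' := by
  ext x
  rw [Perm.mul_apply]
  by_cases hx : x ∈ A
  · rw [glue_left _ _ hx, glue_left _ _ hx,
      glue_left _ _ (σ' ⟨x, hx⟩).2]; rfl
  · rw [glue_right _ _ hx, glue_right _ _ hx,
      glue_right _ _ (τ' ⟨x, hx⟩).2]; rfl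

theorem glue_inv (σ : Perm {x // x ∈ A}) (τ : Perm {x // ¬ x ∈ A}) :
    glue A σ⁻¹ τ⁻¹ = (glue A σ τ)⁻¹ := by
  rw [eq_inv_iff_mul_eq_one, ← glue_mul, inv_mul_cancel, inv_mul_cancel]
  exact Perm.subtypeCongr.refl

theorem glue_injective {σ σ' : Perm {x // x ∈ A}} {τ τ' : Perm {x // ¬ x ∈ A}}
    (h : glue A σ τ = glue A σ' τ') : σ = σ' ∧ τ = τ' := by
  constructor
  · ext ⟨x, hx⟩
    have := congrArg (fun ρ : Perm X => ρ x) h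
    simp only [glue_left _ _ hx] at this
    exact this
  · ext ⟨x, hx⟩
    have := congrArg (fun ρ : Perm X => ρ x) h
    simp only [glue_right _ _ hx] at this
    exact this

theorem exists_glue {σ : Perm X} (h : ∀ x, x ∈ A ↔ σ x ∈ A) : ∃ σ₁ σ₂, glue A σ₁ σ₂ = σ := by
  refine ⟨σ.subtypePerm (fun x => (h x).symm), σ.subtypePerm (fun x => not_congr (h x).symm), ?_⟩
  ext x
  by_cases hx : x ∈ A
  · rw [glue_left _ _ hx]; rfl
  · rw [glue_right _ _ hx]; rfl

theorem glue_mem_iff (σ : Perm {x // x ∈ A}) (τ : Perm {x // ¬ x ∈ A}) (x : X) :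
    x ∈ A ↔ glue A σ τ x ∈ A := by
  by_cases hx : x ∈ A
  · rw [glue_left _ _ hx]; simp [hx]
  · rw [glue_right _ _ hx]
    simp only [hx, false_iff]; exact (τ ⟨x, hx⟩).2

open Classical in
/-- The orbit of `x₀` under the group generated by two permutations. -/
noncomputable def orbitOf (x₀ : X) (σ α : Perm X) : Finset X :=
  Finset.univ.filter (fun x => joinSetoid σ α x₀ x)

theorem mem_orbitOf {x₀ x : X} {σ α : Perm X} : x ∈ orbitOf x₀ σ α ↔ joinSetoid σ α x₀ x := by
  simp [orbitOf]

/-- Both glued permutations preserve A, so the orbit of a point of A is computed inside A. -/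
theorem orbitOf_glue_eq_iff {x₀ : X} (hx₀ : x₀ ∈ A) (σ α : Perm {x // x ∈ A})
    (τ β : Perm {x // ¬ x ∈ A}) :
    orbitOf x₀ (glue A σ τ) (glue A α β) = A ↔ joinSetoid σ α = ⊤ := by
  set J := joinSetoid (glue A σ τ) (glue A α β) with hJ
  constructor
  · intro h
    -- An invariant of the glued pair: the orbit inside A, and one extra value for everything
    -- outside.
    let f : X → Option (Quotient (joinSetoid σ α)) := fun x =>
      if hx : x ∈ A then some (Quotient.mk _ ⟨x, hx⟩) else none
    have key : ∀ (σ : Perm {x // x ∈ A}) (τ : Perm {x // ¬ x ∈ A}) (r : Setoid {x // x ∈ A}),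
        (∀ x, r x (σ x)) → ∀ x, (if hx : x ∈ A then some (Quotient.mk r ⟨x, hx⟩) else none) =
          (if hx : glue A σ τ x ∈ A then some (Quotient.mk r ⟨glue A σ τ x, hx⟩) else none) := by
      intro σ τ r hr x
      by_cases hx : x ∈ A
      · have hx' := (glue_mem_iff σ τ x).mp hx
        rw [dif_pos hx, dif_pos hx']
        congr 1
        apply Quotient.sound
        have h2 : (⟨glue A σ τ x, hx'⟩ : {x // x ∈ A}) = σ ⟨x, hx⟩ :=
          Subtype.ext (glue_left _ _ hx)
        rw [h2]
        exact hr _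
      · rw [dif_neg hx, dif_neg (fun h' => hx ((glue_mem_iff σ τ x).mpr h'))]
    have h1 : J ≤ Setoid.ker f := by
      rw [hJ, joinSetoid_le_iff]
      exact ⟨fun x => key σ τ _ (joinSetoid_left σ α) x, fun x => key α β _ (joinSetoid_right σ α) x⟩
    have h2 : ∀ x : {x // x ∈ A}, joinSetoid σ α ⟨x₀, hx₀⟩ x := by
      rintro ⟨x, hx⟩
      have h3 : J x₀ x := mem_orbitOf.mp (by rw [h]; exact hx)
      have h4 : f x₀ = f x := h1 h3
      simp only [f] at h4
      rw [dif_pos hx₀, dif_pos hx] at h4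
      exact Quotient.exact (Option.some.inj h4)
    rw [eq_top_iff]
    intro x y _
    exact Setoid.trans' _ (Setoid.symm' _ (h2 x)) (h2 y)
  · intro h
    have h1 : joinSetoid σ α ≤ Setoid.comap Subtype.val J := by
      rw [joinSetoid_le_iff]
      constructor
      · intro x
        have := joinSetoid_left (glue A σ τ) (glue A α β) x
        rwa [glue_left _ _ x.2] at this
      · intro x
        have := joinSetoid_right (glue A σ τ) (glue A α β) x
        rwa [glue_left _ _ x.2] at this
    have h2 : J ≤ Setoid.ker (· ∈ A) := by
      rw [hJ, joinSetoid_le_iff]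
      exact ⟨fun x => propext (glue_mem_iff σ τ x), fun x => propext (glue_mem_iff α β x)⟩
    ext x
    rw [mem_orbitOf]
    constructor
    · intro hx
      have : (x₀ ∈ A) = (x ∈ A) := h2 hx
      exact this ▸ hx₀
    · intro hx
      have : (Setoid.comap Subtype.val J) ⟨x₀, hx₀⟩ ⟨x, hx⟩ := h1 (h ▸ trivial)
      exact this

open Classical in
/-- Decomposition of a sum over pairs of permutations according to the orbit of a point. -/
theorem sum_pairs_eq_sum_orbit (x₀ : X) (F : Perm X → Perm X → ℝ) :
    ∑ p : Perm X × Perm X, F p.1 p.2 =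
      ∑ A : Finset X with x₀ ∈ A,
        ∑ p : Perm {x // x ∈ A} × Perm {x // x ∈ A} with joinSetoid p.1 p.2 = ⊤,
          ∑ q : Perm {x // ¬ x ∈ A} × Perm {x // ¬ x ∈ A},
            F (glue A p.1 q.1) (glue A p.2 q.2) := by
  rw [← Finset.sum_fiberwise_of_maps_to (s := Finset.univ)
    (t := Finset.univ.filter (fun A : Finset X => x₀ ∈ A))
    (g := fun p : Perm X × Perm X => orbitOf x₀ p.1 p.2)]
  · refine Finset.sum_congr rfl fun A hA => ?_
    have hx₀ : x₀ ∈ A := by simpa using hA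
    rw [← Finset.sum_product']
    symm
    refine Finset.sum_bij (fun P _ => (glue A P.1.1 P.2.1, glue A P.1.2 P.2.2)) ?_ ?_ ?_ ?_
    · intro P hP
      simp only [Finset.mem_product, Finset.mem_filter, Finset.mem_univ, true_and, and_true] at hP ⊢
      exact (orbitOf_glue_eq_iff hx₀ _ _ _ _).mpr hP
    · rintro ⟨⟨a, b⟩, ⟨c, d⟩⟩ _ ⟨⟨a', b'⟩, ⟨c', d'⟩⟩ _ h
      obtain ⟨h1, h2⟩ := glue_injective (congrArg Prod.fst h)
      obtain ⟨h3, h4⟩ := glue_injective (congrArg Prod.snd h)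
      dsimp only at h1 h2 h3 h4
      rw [h1, h2, h3, h4]
    · rintro ⟨σ, α⟩ hp
      simp only [Finset.mem_filter, Finset.mem_univ, true_and] at hp
      obtain ⟨σ₁, σ₂, rfl⟩ := exists_glue (A := A) (σ := σ) (by
        intro x
        rw [← hp, mem_orbitOf, mem_orbitOf]
        exact ⟨fun h => Setoid.trans' _ h (joinSetoid_left σ α x),
          fun h => Setoid.trans' _ h (Setoid.symm' _ (joinSetoid_left σ α x))⟩)
      obtain ⟨α₁, α₂, rfl⟩ := exists_glue (A := A) (σ := α) (by
        intro x
        rw [← hp, mem_orbitOf, mem_orbitOf]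
        exact ⟨fun h => Setoid.trans' _ h (joinSetoid_right _ α x),
          fun h => Setoid.trans' _ h (Setoid.symm' _ (joinSetoid_right _ α x))⟩)
      refine ⟨((σ₁, α₁), (σ₂, α₂)), ?_, rfl⟩
      simp only [Finset.mem_product, Finset.mem_filter, Finset.mem_univ, true_and, and_true]
      exact (orbitOf_glue_eq_iff hx₀ _ _ _ _).mp hp
    · intro P _; rfl
  · intro p _
    simp only [Finset.mem_filter, Finset.mem_univ, true_and]
    exact mem_orbitOf.mpr (Setoid.refl' _ _)

end Glue

/-- Here j counts the points other than x₀; this shift is the source of all the indices j + 1 below.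
-/
theorem sum_finset_mem_card {n : ℕ} (hX : Fintype.card X = n + 1) (x₀ : X) (φ : ℕ → ℝ) :
    ∑ A : Finset X with x₀ ∈ A, φ A.card =
      ∑ j ∈ Finset.range (n + 1), (n.choose j : ℝ) * φ (j + 1) := by
  have h1 : (Finset.univ.erase x₀).card = n := by
    rw [Finset.card_erase_of_mem (Finset.mem_univ _), Finset.card_univ, hX]; rfl
  have h2 := Finset.sum_powerset_apply_card (fun j => φ (j + 1)) (x := Finset.univ.erase x₀)
  rw [h1] at h2
  simp only [nsmul_eq_mul] at h2
  rw [← h2]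
  refine Finset.sum_bij' (fun A _ => A.erase x₀) (fun B _ => insert x₀ B) ?_ ?_ ?_ ?_ ?_
  · intro A _
    rw [Finset.mem_powerset]
    exact Finset.erase_subset_erase _ (Finset.subset_univ _)
  · intro B _; simp
  · intro A hA
    exact Finset.insert_erase (by simpa using hA)
  · intro B hB
    apply Finset.erase_insert
    intro h
    have := Finset.mem_powerset.mp hB h
    simp at this
  · intro A hA
    rw [Finset.card_erase_add_one (by simpa using hA)]

/-- The sum over all permutations of `n` points of a multiplicative function of the cycles. -/
noncomputable def permSum (f : ℕ → ℝ) (n : ℕ) : ℝ := ∑ σ : Perm (Fin n), wprod f σ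

theorem sum_wprod_eq_permSum (f : ℕ → ℝ) : ∑ σ : Perm X, wprod f σ = permSum f (Fintype.card X) := by
  unfold permSum
  rw [← Equiv.sum_comp (Fintype.equivFin X).permCongr]
  simp only [wprod_permCongr]

open Classical in
/-- The sum over transitive pairs of permutations of `n` points of a multiplicative weight. -/
noncomputable def pairSum (f g : ℕ → ℝ) (n : ℕ) : ℝ :=
  ∑ p : Perm (Fin n) × Perm (Fin n) with joinSetoid p.1 p.2 = ⊤,
    wprod f p.1 * wprod g (p.1⁻¹ * p.2)

open Classical in
theorem sum_transitive_eq_pairSum (f g : ℕ → ℝ) :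
    ∑ p : Perm X × Perm X with joinSetoid p.1 p.2 = ⊤, wprod f p.1 * wprod g (p.1⁻¹ * p.2) =
      pairSum f g (Fintype.card X) := by
  unfold pairSum
  rw [Finset.sum_filter, Finset.sum_filter,
    ← Equiv.sum_comp ((Fintype.equivFin X).permCongr.prodCongr (Fintype.equivFin X).permCongr)]
  refine Finset.sum_congr rfl fun p _ => ?_
  simp only [Equiv.prodCongr_apply, Prod.map_fst, Prod.map_snd, joinSetoid_permCongr_eq_top_iff,
    wprod_permCongr, ← permCongr_inv', ← permCongr_mul']

/-- For fixed σ, the permutation σ⁻¹α runs freely over all permutations, so the double sum factors.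
-/
theorem sum_pairs_wprod (f g : ℕ → ℝ) :
    ∑ p : Perm X × Perm X, wprod f p.1 * wprod g (p.1⁻¹ * p.2) =
      permSum f (Fintype.card X) * permSum g (Fintype.card X) := by
  rw [Fintype.sum_prod_type, ← sum_wprod_eq_permSum (X := X), ← sum_wprod_eq_permSum (X := X),
    Finset.sum_mul_sum]
  refine Finset.sum_congr rfl fun σ _ => ?_
  exact Equiv.sum_comp (Equiv.mulLeft σ⁻¹) (fun τ => wprod f σ * wprod g τ)

/-- Condition on the orbit of the point 0: the pair is transitive on it and arbitrary on the
complement, and the weight is multiplicative. This is the recursion later compared with Newton's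
identities. -/
theorem permSum_mul_permSum_succ (f g : ℕ → ℝ) (n : ℕ) :
    permSum f (n + 1) * permSum g (n + 1) = ∑ j ∈ Finset.range (n + 1),
      (n.choose j : ℝ) * (pairSum f g (j + 1) * (permSum f (n - j) * permSum g (n - j))) := by
  classical
  have h0 := sum_pairs_wprod (X := Fin (n + 1)) f g
  rw [Fintype.card_fin] at h0
  rw [← h0, sum_pairs_eq_sum_orbit 0 (fun σ α => wprod f σ * wprod g (σ⁻¹ * α))]
  have hj := sum_finset_mem_card (Fintype.card_fin (n + 1)) 0 (fun k => pairSum f g k *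
    (permSum f (n + 1 - k) * permSum g (n + 1 - k)))
  simp only [Nat.add_sub_add_right] at hj
  rw [← hj]
  refine Finset.sum_congr rfl fun A _ => ?_
  have h1 : Fintype.card {x // x ∈ A} = A.card := Fintype.card_coe A
  have h2 : Fintype.card {x // ¬ x ∈ A} = n + 1 - A.card := by
    rw [Fintype.card_subtype_compl, h1, Fintype.card_fin]
  have h3 := sum_transitive_eq_pairSum (X := {x // x ∈ A}) f g
  have h4 := sum_pairs_wprod (X := {x // ¬ x ∈ A}) f g
  rw [h1] at h3
  rw [h2] at h4
  rw [← h3, ← h4, Finset.sum_mul_sum]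
  refine Finset.sum_congr rfl fun p _ => Finset.sum_congr rfl fun q _ => ?_
  rw [← glue_inv, ← glue_mul, wprod_glue, wprod_glue]
  ring

end Split

/-! ## Counting with one and two long cycles -/

section Counting

variable {X : Type*} [Fintype X] [DecidableEq X] {Y : Type*} [Fintype Y] [DecidableEq Y]

theorem parts_of_cyc_eq_one {σ : Perm X} (h : cyc σ = 1) :
    σ.partition.parts = {Fintype.card X} := by
  obtain ⟨a, ha⟩ := Multiset.card_eq_one.mp h
  have := σ.partition.parts_sum
  rw [ha, Multiset.sum_singleton] at this
  rw [ha, this]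

theorem cyc_pos [Nonempty X] (σ : Perm X) : 1 ≤ cyc σ := by
  rw [cyc_eq_nq, nq]
  have : Nonempty (Quotient (SameCycle.setoid σ)) := ⟨Quotient.mk _ (Classical.arbitrary X)⟩
  exact Nat.card_pos

theorem sameCycle_of_cyc_eq_one {σ : Perm X} (h : cyc σ = 1) (x y : X) : SameCycle σ x y := by
  rw [cyc_eq_nq, nq] at h
  have := (Nat.card_eq_one_iff_unique.mp h).1
  exact Quotient.exact (Subsingleton.elim (Quotient.mk (SameCycle.setoid σ) x) (Quotient.mk _ y))

theorem card_filter_cyc_eq_one :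
    (Finset.univ.filter (fun σ : Perm X => cyc σ = 1)).card =
      if Fintype.card X = 0 then 0 else (Fintype.card X - 1).factorial := by
  split_ifs with h0
  · rw [Finset.card_eq_zero, Finset.filter_eq_empty_iff]
    intro σ _ h
    have := cyc_le_card σ
    omega
  · have : Nonempty X := Fintype.card_pos_iff.mp (Nat.pos_of_ne_zero h0)
    -- A one-point set is separate: its only cycle is a fixed point, invisible to `cycleType`.
    rcases Nat.lt_or_ge (Fintype.card X) 2 with h1 | h1
    · have h2 : Fintype.card X = 1 := by omega
      rw [Finset.filter_true_of_mem, Finset.card_univ, Fintype.card_perm, h2]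
      · rfl
      intro σ _
      have := cyc_le_card σ
      have := cyc_pos σ
      omega
    · have h2 := card_of_cycleType_singleton (α := X) h1 le_rfl
      rw [Nat.choose_self, mul_one] at h2
      rw [← h2]
      congr 1
      ext σ
      simp only [Finset.mem_filter, Finset.mem_univ, true_and]
      constructor
      · intro h
        rw [← filter_parts_partition_eq_cycleType, parts_of_cyc_eq_one h,
          Multiset.filter_singleton, if_pos h1]
      · intro h
        rw [cyc, parts_partition, ← sum_cycleType, h]
        simp

theorem exists_permCongr_finRotate {m : ℕ} (hm : Fintype.card X = m) {σ : Perm X}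
    (h : cyc σ = 1) : ∃ e : Fin m ≃ X, e.permCongr (finRotate m) = σ := by
  have e₀ : Fin m ≃ X := (Fintype.equivFinOfCardEq hm).symm
  have hm1 : 1 ≤ m := by have := cyc_le_card σ; omega
  have hc : IsConj (e₀.permCongr (finRotate m)) σ := by
    rw [partition_eq_of_isConj, Nat.Partition.ext_iff, parts_permCongr,
      parts_of_cyc_eq_one (cyc_finRotate hm1), parts_of_cyc_eq_one h, Fintype.card_fin, hm]
  obtain ⟨c, hc⟩ := isConj_iff.mp hc
  refine ⟨e₀.trans c, ?_⟩
  rw [← hc]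
  ext x
  simp [Perm.mul_apply]

theorem exists_permCongr_gammaPerm {A : Finset X} {t s : ℕ} (ht : Fintype.card {x // x ∈ A} = t)
    (hs : Fintype.card {x // ¬ x ∈ A} = s) {σ : Perm {x // x ∈ A}} {τ : Perm {x // ¬ x ∈ A}}
    (hσ : cyc σ = 1) (hτ : cyc τ = 1) :
    ∃ e : Fin t ⊕ Fin s ≃ X, e.permCongr (gammaPerm t s) = glue A σ τ := by
  obtain ⟨e₁, h₁⟩ := exists_permCongr_finRotate ht hσ
  obtain ⟨e₂, h₂⟩ := exists_permCongr_finRotate hs hτ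
  refine ⟨(Equiv.sumCongr e₁ e₂).trans (Equiv.sumCompl (· ∈ A)), ?_⟩
  ext x
  by_cases hx : x ∈ A
  · rw [glue_left _ _ hx, ← h₁]
    simp [gammaPerm, Equiv.sumCompl_symm_apply_of_pos hx]
  · rw [glue_right _ _ hx, ← h₂]
    simp [gammaPerm, Equiv.sumCompl_symm_apply_of_neg hx]

theorem joinSetoid_self_eq_top_iff [Nonempty X] {σ : Perm X} :
    joinSetoid σ σ = ⊤ ↔ cyc σ = 1 := by
  rw [joinSetoid, sup_idem]
  constructor
  · intro h
    apply cyc_eq_one_of_sameCycle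
    intro x y
    have : SameCycle.setoid σ x y := h ▸ trivial
    exact this
  · intro h
    rw [eq_top_iff]
    intro x y _
    exact sameCycle_of_cyc_eq_one h x y

open Classical in
/-- The sum of `F` over the permutations `σ` forming a transitive pair with `α` such that
`σ` and `σ⁻¹ α` have `k` cycles together. -/
noncomputable def transSum (F : Multiset ℕ → ℝ) (k : ℕ) (α : Perm X) : ℝ :=
  ∑ σ : Perm X with joinSetoid σ α = ⊤ ∧ cyc σ + cyc (σ⁻¹ * α) = k, F σ.partition.parts

theorem transSum_permCongr (F : Multiset ℕ → ℝ) (k : ℕ) (e : X ≃ Y) (α : Perm X) :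
    transSum F k (e.permCongr α) = transSum F k α := by
  unfold transSum
  rw [Finset.sum_filter, Finset.sum_filter, ← Equiv.sum_comp e.permCongr]
  refine Finset.sum_congr rfl fun σ _ => ?_
  rw [parts_permCongr]
  congr 1
  rw [joinSetoid_permCongr_eq_top_iff, ← permCongr_inv', ← permCongr_mul', cyc_permCongr,
    cyc_permCongr]

/-- Translates the transitivity required of annular permutations into the joint orbit relation used
by the genus estimates. -/
theorem isPretransitive_closure_iff {σ α : Perm X} :
    MulAction.IsPretransitive (Subgroup.closure ({σ, α} : Set (Perm X))) X ↔
      joinSetoid σ α = ⊤ := by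
  constructor
  · intro h
    rw [eq_top_iff]
    have key : ∀ g ∈ Subgroup.closure ({σ, α} : Set (Perm X)), ∀ x, joinSetoid σ α x (g x) := ?_
    · intro x y _
      obtain ⟨⟨g, hg⟩, rfl⟩ := h.exists_smul_eq x y
      exact key g hg x
    clear h
    intro g hg
    induction hg using Subgroup.closure_induction with
    | mem g hg =>
      intro x
      rcases hg with rfl | rfl
      · exact joinSetoid_left _ _ x
      · exact joinSetoid_right _ _ x
    | one => exact fun x => Setoid.refl' _ x
    | mul g h _ _ ihg ihh => exact fun x => Setoid.trans' _ (ihh x) (ihg (h x))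
    | inv g _ ih =>
      intro x
      have := ih (g⁻¹ x)
      rw [← Perm.mul_apply, mul_inv_cancel, Perm.one_apply] at this
      exact Setoid.symm' _ this
  · intro h
    refine ⟨fun x y => ?_⟩
    have h1 : joinSetoid σ α ≤
        MulAction.orbitRel (Subgroup.closure ({σ, α} : Set (Perm X))) X := by
      rw [joinSetoid_le_iff]
      constructor
      · intro x
        exact Setoid.symm' _ ⟨⟨σ, Subgroup.subset_closure (by simp)⟩, rfl⟩
      · intro x
        exact Setoid.symm' _ ⟨⟨α, Subgroup.subset_closure (by simp)⟩, rfl⟩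
    rw [h] at h1
    have h2 : MulAction.orbitRel (Subgroup.closure ({σ, α} : Set (Perm X))) X y x := h1 trivial
    exact h2

theorem sum_SNC_eq_transSum (u : ℕ → ℝ) (t s : ℕ) :
    ∑ σ ∈ SNC t s, permProd u σ =
      transSum (fun m => (m.map u).prod) (t + s) (gammaPerm t s) := by
  unfold SNC transSum
  refine Finset.sum_congr ?_ fun σ _ => rfl
  ext σ
  simp only [Finset.mem_filter, Finset.mem_univ, true_and, IsAnnularNonCrossing,
    isPretransitive_closure_iff]
  rfl

/-- A class function summed over the long cycles. -/
theorem sum_cyc_eq_one {n : ℕ} (hn : 1 ≤ n) (H : Perm (Fin n) → ℝ)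
    (hH : ∀ (e : Perm (Fin n)) (α : Perm (Fin n)), H (e.permCongr α) = H α) :
    ∑ α : Perm (Fin n) with cyc α = 1, H α = ((n - 1).factorial : ℝ) * H (finRotate n) := by
  have h1 : ∀ α ∈ Finset.univ.filter (fun α : Perm (Fin n) => cyc α = 1), H α = H (finRotate n) := by
    intro α hα
    obtain ⟨e, he⟩ := exists_permCongr_finRotate (Fintype.card_fin n) (by simpa using hα)
    rw [← he, hH]
  rw [Finset.sum_congr rfl h1, Finset.sum_const, card_filter_cyc_eq_one, Fintype.card_fin,
    if_neg (by omega), nsmul_eq_mul]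

/-- A class function summed over the permutations with two cycles. -/
theorem sum_cyc_eq_two {n : ℕ} (H : Perm (Fin (n + 1)) → ℝ) (K : ℕ → ℕ → ℝ)
    (hK : ∀ t s (e : Fin t ⊕ Fin s ≃ Fin (n + 1)), H (e.permCongr (gammaPerm t s)) = K t s) :
    ∑ α : Perm (Fin (n + 1)) with cyc α = 2, H α =
      (n.factorial : ℝ) * ∑ ts ∈ Finset.HasAntidiagonal.antidiagonal (n + 1) with 1 ≤ ts.1 ∧ 1 ≤ ts.2,
        K ts.1 ts.2 / ts.2 := by
  classical
  -- The orbit decomposition is applied to diagonal pairs σ = α, for which the orbit of 0 is simply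
  -- its cycle.
  have h1 := sum_pairs_eq_sum_orbit (0 : Fin (n + 1))
    (fun σ α => if σ = α ∧ cyc α = 2 then H α else 0)
  have h2 : ∑ p : Perm (Fin (n + 1)) × Perm (Fin (n + 1)),
      (if p.1 = p.2 ∧ cyc p.2 = 2 then H p.2 else 0) =
        ∑ α : Perm (Fin (n + 1)) with cyc α = 2, H α := by
    rw [Fintype.sum_prod_type_right, Finset.sum_filter]
    refine Finset.sum_congr rfl fun α _ => ?_
    rw [Finset.sum_eq_single α]
    · simp
    · intro σ _ hne; simp [hne]
    · simp
  rw [h2] at h1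
  -- The number of one-cycle permutations of m points; the value 0 at m = 0 removes the case of an
  -- empty complement.
  let c : ℕ → ℝ := fun m => if m = 0 then 0 else ((m - 1).factorial : ℝ)
  have h3 : ∀ A ∈ Finset.univ.filter (fun A : Finset (Fin (n + 1)) => 0 ∈ A),
      (∑ p : Perm {x // x ∈ A} × Perm {x // x ∈ A} with joinSetoid p.1 p.2 = ⊤,
          ∑ q : Perm {x // ¬ x ∈ A} × Perm {x // ¬ x ∈ A},
            if glue A p.1 q.1 = glue A p.2 q.2 ∧ cyc (glue A p.2 q.2) = 2
              then H (glue A p.2 q.2) else 0) =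
        c A.card * c (n + 1 - A.card) * K A.card (n + 1 - A.card) := by
    intro A hA
    have h0A : (0 : Fin (n + 1)) ∈ A := by simpa using hA
    have : Nonempty {x // x ∈ A} := ⟨⟨0, h0A⟩⟩
    have c1 : Fintype.card {x // x ∈ A} = A.card := Fintype.card_coe A
    have c2 : Fintype.card {x // ¬ x ∈ A} = n + 1 - A.card := by
      rw [Fintype.card_subtype_compl, c1, Fintype.card_fin]
    have hin : ∀ p : Perm {x // x ∈ A} × Perm {x // x ∈ A},
        (∑ q : Perm {x // ¬ x ∈ A} × Perm {x // ¬ x ∈ A},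
            if glue A p.1 q.1 = glue A p.2 q.2 ∧ cyc (glue A p.2 q.2) = 2
              then H (glue A p.2 q.2) else 0) =
        if p.1 = p.2 then ∑ τ : Perm {x // ¬ x ∈ A},
          (if cyc (glue A p.2 τ) = 2 then H (glue A p.2 τ) else 0) else 0 := by
      intro p
      rw [Fintype.sum_prod_type_right]
      split_ifs with hp
      · refine Finset.sum_congr rfl fun τ _ => ?_
        rw [Finset.sum_eq_single τ]
        · simp [hp]
        · intro τ' _ hne
          rw [if_neg]
          rintro ⟨h, -⟩
          exact hne (glue_injective h).2
        · simp
      · refine Finset.sum_eq_zero fun τ _ => Finset.sum_eq_zero fun τ' _ => ?_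
        rw [if_neg]
        rintro ⟨h, -⟩
        exact hp (glue_injective h).1
    simp only [hin]
    rw [Finset.sum_filter, Fintype.sum_prod_type_right]
    have hin2 : ∀ α : Perm {x // x ∈ A}, (∑ σ : Perm {x // x ∈ A},
        if joinSetoid σ α = ⊤ then (if σ = α then ∑ τ : Perm {x // ¬ x ∈ A},
          (if cyc (glue A α τ) = 2 then H (glue A α τ) else 0) else 0) else 0) =
        if cyc α = 1 then c (n + 1 - A.card) * K A.card (n + 1 - A.card) else 0 := by
      intro α
      rw [Finset.sum_eq_single α]
      · rw [if_pos rfl]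
        simp only [joinSetoid_self_eq_top_iff]
        split_ifs with hα
        · have hcyc : ∀ τ : Perm {x // ¬ x ∈ A}, cyc (glue A α τ) = 2 ↔ cyc τ = 1 := by
            intro τ; rw [cyc_glue, hα]; omega
          simp only [hcyc]
          rw [← Finset.sum_filter, Finset.sum_congr rfl (g := fun _ => K A.card (n + 1 - A.card))]
          · rw [Finset.sum_const, card_filter_cyc_eq_one, c2, nsmul_eq_mul]
            simp only [c]
            split_ifs <;> simp
          · intro τ hτ
            obtain ⟨e, he⟩ := exists_permCongr_gammaPerm c1 c2 hα (by simpa using hτ)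
            rw [← he, hK]
        · rfl
      · intro σ _ hne; simp [hne]
      · simp
    simp only [hin2]
    rw [← Finset.sum_filter, Finset.sum_const, card_filter_cyc_eq_one, c1, nsmul_eq_mul, mul_assoc]
    congr 1
    simp only [c]
    split_ifs <;> simp
  rw [h1, Finset.sum_congr rfl h3]
  rw [sum_finset_mem_card (Fintype.card_fin (n + 1)) 0
    (fun k => c k * c (n + 1 - k) * K k (n + 1 - k))]
  rw [Finset.sum_filter, Finset.Nat.sum_antidiagonal_succ]
  simp only [Nat.add_sub_add_right]
  rw [if_neg (by simp), zero_add,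
    Finset.Nat.sum_antidiagonal_eq_sum_range_succ_mk, Finset.mul_sum]
  refine Finset.sum_congr rfl fun j hj => ?_
  have hj' : j ≤ n := by simpa [Nat.lt_succ_iff] using hj
  simp only [c]
  by_cases hjn : n - j = 0
  · simp [hjn]
  · rw [if_neg (by omega), if_neg hjn, if_pos ⟨by omega, by omega⟩]
    -- With t = j + 1 and s = n - j, there are C(n,j)·j!·(s-1)! = n!/s such α, which explains the
    -- single denominator s.
    have hfac : (n.choose j : ℝ) * j.factorial * (n - j).factorial = n.factorial := by
      exact_mod_cast Nat.choose_mul_factorial_mul_factorial hj'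
    have hfac2 : ((n - j).factorial : ℝ) = ((n - j : ℕ) : ℝ) * ((n - j - 1).factorial : ℝ) := by
      exact_mod_cast (Nat.mul_factorial_pred hjn).symm
    have hne : ((n - j : ℕ) : ℝ) ≠ 0 := by exact_mod_cast hjn
    rw [← hfac, hfac2]
    field_simp
    simp only [Nat.add_sub_cancel]
    ring

/-- Average with the swapped sum: (1/s + 1/t)/2 = n/(2ts). This is where the factor n/2 comes from.
-/
theorem sum_filter_antidiagonal_symm (n : ℕ) (K : ℕ → ℕ → ℝ) (hK : ∀ t s, K t s = K s t) :
    ∑ ts ∈ Finset.HasAntidiagonal.antidiagonal n with 1 ≤ ts.1 ∧ 1 ≤ ts.2, K ts.1 ts.2 / ts.2 =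
      (n : ℝ) / 2 * ∑ ts ∈ Finset.HasAntidiagonal.antidiagonal n with 1 ≤ ts.1 ∧ 1 ≤ ts.2,
        K ts.1 ts.2 / ((ts.1 : ℝ) * ts.2) := by
  have h1 : ∑ ts ∈ Finset.HasAntidiagonal.antidiagonal n with 1 ≤ ts.1 ∧ 1 ≤ ts.2, K ts.1 ts.2 / ts.2 =
      ∑ ts ∈ Finset.HasAntidiagonal.antidiagonal n with 1 ≤ ts.1 ∧ 1 ≤ ts.2, K ts.1 ts.2 / ts.1 := by
    rw [Finset.sum_filter, Finset.sum_filter, ← Finset.Nat.sum_antidiagonal_swap]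
    refine Finset.sum_congr rfl fun ts _ => ?_
    simp only [Prod.fst_swap, Prod.snd_swap, hK ts.2 ts.1, and_comm]
  have h2 : ∑ ts ∈ Finset.HasAntidiagonal.antidiagonal n with 1 ≤ ts.1 ∧ 1 ≤ ts.2, K ts.1 ts.2 / ts.2 +
      ∑ ts ∈ Finset.HasAntidiagonal.antidiagonal n with 1 ≤ ts.1 ∧ 1 ≤ ts.2, K ts.1 ts.2 / ts.1 =
      n * ∑ ts ∈ Finset.HasAntidiagonal.antidiagonal n with 1 ≤ ts.1 ∧ 1 ≤ ts.2,
        K ts.1 ts.2 / ((ts.1 : ℝ) * ts.2) := by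
    rw [← Finset.sum_add_distrib, Finset.mul_sum]
    refine Finset.sum_congr rfl fun ts hts => ?_
    rw [Finset.mem_filter, Finset.HasAntidiagonal.mem_antidiagonal] at hts
    obtain ⟨h, ht, hs⟩ := hts
    have ht' : (ts.1 : ℝ) ≠ 0 := by positivity
    have hs' : (ts.2 : ℝ) ≠ 0 := by positivity
    have hn : (n : ℝ) = ts.1 + ts.2 := by exact_mod_cast h.symm
    rw [hn]
    field_simp
  linarith

/-- Multiplicativity of the sign. It ensures that a pair with exponent 1 cannot have a one-cycle α.
-/
theorem card_mod_two_of_cyc (σ α : Perm X) :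
    (Fintype.card X + cyc σ + cyc α + cyc (σ⁻¹ * α)) % 2 = 0 := by
  have h1 : (sign σ : ℤ) * (sign (σ⁻¹ * α) : ℤ) = (sign α : ℤ) := by
    rw [← Units.val_mul, ← Perm.sign_mul, mul_inv_cancel_left]
  rw [sign_eq_neg_one_pow_cyc, sign_eq_neg_one_pow_cyc, sign_eq_neg_one_pow_cyc, ← pow_add] at h1
  have h2 : ((-1 : ℤ)) ^ (Fintype.card X + cyc σ + (Fintype.card X + cyc (σ⁻¹ * α)) +
      (Fintype.card X + cyc α)) = 1 := by
    rw [pow_add, h1, ← pow_add]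
    exact Even.neg_one_pow ⟨_, rfl⟩
  by_contra hodd
  have : Odd (Fintype.card X + cyc σ + (Fintype.card X + cyc (σ⁻¹ * α)) +
      (Fintype.card X + cyc α)) := by
    rw [Nat.odd_iff]; omega
  rw [this.neg_one_pow] at h2
  norm_num at h2

theorem cyc_add_cyc_add_cyc_le_of_transitive {σ α : Perm X} (h : joinSetoid σ α = ⊤) :
    cyc σ + cyc α + cyc (σ⁻¹ * α) ≤ Fintype.card X + 2 := by
  have h1 := cyc_add_cyc_add_cyc_le σ α
  have h2 : nq (joinSetoid σ α) ≤ 1 := by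
    rw [h, nq, Finite.card_le_one_iff_subsingleton]
    refine ⟨fun a b => ?_⟩
    induction a, b using Quotient.inductionOn₂ with
    | _ a b => exact Quotient.sound trivial
  omega

open Classical in
/-- Transitive pairs of maximal cycle count are enumerated by non-crossing partitions. -/
theorem sum_planar_pairs {n : ℕ} (hn : 1 ≤ n) (F : Multiset ℕ → ℝ) :
    ∑ p : Perm (Fin n) × Perm (Fin n) with
        joinSetoid p.1 p.2 = ⊤ ∧ cyc p.1 + cyc (p.1⁻¹ * p.2) = n + 1, F p.1.partition.parts =
      ((n - 1).factorial : ℝ) * ∑ π ∈ NC n, F (π.parts.val.map Finset.card) := by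
  have : Nonempty (Fin n) := ⟨⟨0, hn⟩⟩
  rw [Finset.sum_filter, Fintype.sum_prod_type_right]
  have h1 : ∀ α : Perm (Fin n), (∑ σ : Perm (Fin n),
      if joinSetoid σ α = ⊤ ∧ cyc σ + cyc (σ⁻¹ * α) = n + 1 then F σ.partition.parts else 0) =
        if cyc α = 1 then transSum F (n + 1) α else 0 := by
    intro α
    split_ifs with hα
    · rw [transSum, Finset.sum_filter]
    -- The genus inequality leaves room for only one cycle of α.
    · refine Finset.sum_eq_zero fun σ _ => if_neg ?_
      rintro ⟨h2, h3⟩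
      have h4 := cyc_add_cyc_add_cyc_le_of_transitive h2
      have h5 := cyc_pos α
      rw [Fintype.card_fin] at h4
      omega
  simp only [h1]
  rw [← Finset.sum_filter, sum_cyc_eq_one hn _ (fun e α => transSum_permCongr _ _ e α),
    sum_NC_eq_sum_isGenusZero hn, transSum]
  congr 2
  ext σ
  simp only [Finset.mem_filter, Finset.mem_univ, true_and]
  refine ⟨fun h => h.2, fun h => ⟨?_, h⟩⟩
  rw [eq_top_iff]
  intro x y _
  exact (le_sup_right : _ ≤ joinSetoid σ (finRotate n)) (sameCycle_finRotate x y)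

open Classical in
/-- Transitive pairs of next-to-maximal cycle count are enumerated by annular non-crossing
permutations. -/
theorem sum_annular_pairs {n : ℕ} (hn : 1 ≤ n) (u : ℕ → ℝ) :
    ∑ p : Perm (Fin n) × Perm (Fin n) with
        joinSetoid p.1 p.2 = ⊤ ∧ cyc p.1 + cyc (p.1⁻¹ * p.2) = n, wprod u p.1 =
      ((n - 1).factorial : ℝ) * annularSum u n := by
  obtain ⟨n, rfl⟩ : ∃ m, n = m + 1 := ⟨n - 1, by omega⟩
  rw [Finset.sum_filter, Fintype.sum_prod_type_right]
  have h1 : ∀ α : Perm (Fin (n + 1)), (∑ σ : Perm (Fin (n + 1)),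
      if joinSetoid σ α = ⊤ ∧ cyc σ + cyc (σ⁻¹ * α) = n + 1 then wprod u σ else 0) =
        if cyc α = 2 then transSum (fun m => (m.map u).prod) (n + 1) α else 0 := by
    intro α
    split_ifs with hα
    · rw [transSum, Finset.sum_filter]; rfl
    -- The genus inequality allows at most two cycles of α, and parity excludes one.
    · refine Finset.sum_eq_zero fun σ _ => if_neg ?_
      rintro ⟨h2, h3⟩
      have h4 := cyc_add_cyc_add_cyc_le_of_transitive h2
      have h5 := cyc_pos α
      have h6 := card_mod_two_of_cyc σ α
      rw [Fintype.card_fin] at h4 h6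
      omega
  simp only [h1]
  have hcard : ∀ t s, Fin t ⊕ Fin s ≃ Fin (n + 1) → t + s = n + 1 := by
    intro t s e
    simpa using Fintype.card_congr e
  rw [← Finset.sum_filter, sum_cyc_eq_two _
    (fun t s => ∑ σ ∈ SNC t s, permProd u σ),
    sum_filter_antidiagonal_symm (n + 1) (fun t s => ∑ σ ∈ SNC t s, permProd u σ)]
  · rw [Nat.add_sub_cancel, annularSum]
    simp only [Finset.sum_div]
  · intro t s
    rw [sum_SNC_eq_transSum, sum_SNC_eq_transSum,
      ← transSum_permCongr _ _ (Equiv.sumComm (Fin s) (Fin t)), add_comm s t]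
    congr 1
    ext x
    rcases x with x | x <;> simp [gammaPerm]
  · intro t s e
    rw [transSum_permCongr, sum_SNC_eq_transSum, hcard t s e]

end Counting

/-! ## Exponential generating functions of sums over set partitions -/

section Partitions

variable {T : Type*} [DecidableEq T]

/-- Pairs (partition of `s`, distinguished block `B`) correspond to pairs
(nonempty `B ⊆ s`, partition of `s \ B`). -/
theorem sum_finpartition_block (s : Finset T) (Φ : Finset T → Finset (Finset T) → ℝ) :
    ∑ π : Finpartition s, ∑ B ∈ π.parts, Φ B (π.parts.erase B) =
      ∑ B ∈ s.powerset.erase ∅, ∑ π : Finpartition (s \ B), Φ B π.parts := by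
  rw [Finset.sum_sigma', Finset.sum_sigma']
  symm
  have hB : ∀ {B : Finset T}, B ∈ s.powerset.erase ∅ → B ≠ ∅ ∧ B ⊆ s := by
    intro B h; simpa using h
  have hnot : ∀ {B : Finset T} (π : Finpartition (s \ B)), B ≠ ∅ → B ∉ π.parts := by
    intro B π hne h
    obtain ⟨x, hx⟩ := Finset.nonempty_iff_ne_empty.mpr hne
    have := π.le h hx
    simp [hx] at this
  refine Finset.sum_bij (fun P hP =>
    ⟨P.2.extend (b := P.1) (c := s) (hB (Finset.mem_sigma.mp hP).1).1 Finset.sdiff_disjoint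
      (Finset.sdiff_union_of_subset (hB (Finset.mem_sigma.mp hP).1).2), P.1⟩) ?_ ?_ ?_ ?_
  · rintro ⟨B, π⟩ h
    simp
  · rintro ⟨B, π⟩ h ⟨B', π'⟩ h' heq
    have h1 : B = B' := congrArg Sigma.snd heq
    subst h1
    have h2 := congrArg (fun P : (Σ _ : Finpartition s, Finset T) => P.1.parts.erase B) heq
    simp only [Finpartition.extend_parts] at h2
    have hb := (hB (Finset.mem_sigma.mp h).1).1
    rw [Finset.erase_insert (hnot π hb), Finset.erase_insert (hnot π' hb)] at h2
    rw [Finpartition.ext h2]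
  · rintro ⟨π, B⟩ h
    have hBπ : B ∈ π.parts := (Finset.mem_sigma.mp h).2
    have hne : B ≠ ∅ := π.ne_bot hBπ
    have hsup : (π.parts.erase B).sup id = s \ B := by
      ext x
      simp only [Finset.mem_sup, Finset.mem_erase, id, Finset.mem_sdiff]
      constructor
      · rintro ⟨V, ⟨hV, hVπ⟩, hx⟩
        refine ⟨π.le hVπ hx, fun hxB => hV (π.eq_of_mem_parts hVπ hBπ hx hxB)⟩
      · rintro ⟨hx, hxB⟩
        obtain ⟨V, hV, hxV⟩ := π.exists_mem hx
        exact ⟨V, ⟨fun h => hxB (h ▸ hxV), hV⟩, hxV⟩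
    refine ⟨⟨B, π.ofSubset (Finset.erase_subset _ _) hsup⟩, ?_, ?_⟩
    · simp only [Finset.mem_sigma, Finset.mem_univ, and_true, Finset.mem_erase,
        Finset.mem_powerset]
      exact ⟨hne, π.le hBπ⟩
    · have : ∀ (π₁ π₂ : Finpartition s), π₁ = π₂ →
        (⟨π₁, B⟩ : Σ _ : Finpartition s, Finset T) = ⟨π₂, B⟩ := fun _ _ h => by rw [h]
      apply this
      apply Finpartition.ext
      simp only [Finpartition.extend_parts, Finpartition.ofSubset_parts]
      exact Finset.insert_erase hBπ
  · rintro ⟨B, π⟩ h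
    simp only [Finpartition.extend_parts]
    rw [Finset.erase_insert (hnot π (hB (Finset.mem_sigma.mp h).1).1)]

/-- `∑_π (-1)^{|π|} |π|! a_π`, the coefficients of the reciprocal of the exponential generating
function of `a`. -/
noncomputable def recipSum (a : ℕ → ℝ) (s : Finset T) : ℝ :=
  ∑ π : Finpartition s, (-1) ^ π.parts.card * (π.parts.card.factorial : ℝ) *
    ∏ V ∈ π.parts, a V.card

theorem recipSum_empty (a : ℕ → ℝ) : recipSum a (∅ : Finset T) = 1 := by
  unfold recipSum
  have huniq : ∀ π : Finpartition (∅ : Finset T), π.parts = ∅ := fun π =>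
    π.parts_eq_empty_iff.mpr rfl
  rw [Finset.sum_congr rfl (g := fun _ => (1 : ℝ)) (fun π _ => by rw [huniq π]; simp)]
  have : Fintype.card (Finpartition (∅ : Finset T)) = 1 :=
    Fintype.card_eq_one_iff.mpr ⟨⊤, fun π => Finpartition.ext (by rw [huniq, huniq])⟩
  rw [Finset.sum_const, Finset.card_univ, this, one_smul]

/-- Distinguishing a block counts each partition |π| times, which completes (|π|-1)! to |π|!, while
removing the block flips the sign. So the terms with B nonempty cancel the term B = ∅. -/
theorem sum_powerset_recipSum {a : ℕ → ℝ} (ha : a 0 = 1) {s : Finset T} (hs : s.Nonempty) :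
    ∑ B ∈ s.powerset, a B.card * recipSum a (s \ B) = 0 := by
  have h1 : recipSum a s = - ∑ B ∈ s.powerset.erase ∅, a B.card * recipSum a (s \ B) := by
    have h2 := sum_finpartition_block s (fun B P => a B.card * ((-1) ^ P.card *
      (P.card.factorial : ℝ) * ∏ V ∈ P, a V.card))
    have h3 : ∑ B ∈ s.powerset.erase ∅, a B.card * recipSum a (s \ B) =
        ∑ B ∈ s.powerset.erase ∅, ∑ π : Finpartition (s \ B), a B.card * ((-1) ^ π.parts.card *
          (π.parts.card.factorial : ℝ) * ∏ V ∈ π.parts, a V.card) := by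
      refine Finset.sum_congr rfl fun B _ => ?_
      rw [recipSum, Finset.mul_sum]
    rw [h3, ← h2, ← Finset.sum_neg_distrib, recipSum]
    refine Finset.sum_congr rfl fun π _ => ?_
    have hne : π.parts.Nonempty := π.parts_nonempty (Finset.nonempty_iff_ne_empty.mp hs)
    obtain ⟨k, hk⟩ : ∃ k, π.parts.card = k + 1 :=
      ⟨π.parts.card - 1, by have := hne.card_pos; omega⟩
    have h4 : ∀ B ∈ π.parts, a B.card * ((-1) ^ (π.parts.erase B).card *
        ((π.parts.erase B).card.factorial : ℝ) * ∏ V ∈ π.parts.erase B, a V.card) =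
        (-1) ^ k * (k.factorial : ℝ) * ∏ V ∈ π.parts, a V.card := by
      intro B hB
      rw [← Finset.mul_prod_erase _ _ hB, Finset.card_erase_of_mem hB, hk, Nat.add_sub_cancel]
      ring
    rw [Finset.sum_congr rfl h4, Finset.sum_const, hk, nsmul_eq_mul, Nat.factorial_succ]
    push_cast
    ring
  rw [← Finset.add_sum_erase _ _ (Finset.empty_mem_powerset s), Finset.card_empty, ha, one_mul,
    Finset.sdiff_empty, h1]
  ring

/-- The coefficients of the reciprocal of an exponential generating function. -/
noncomputable def recipCoef (a : ℕ → ℝ) : ℕ → ℝ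
  | 0 => 1
  | n + 1 => -∑ m : Fin (n + 1), ((n + 1).choose (m + 1) : ℝ) * (a (m + 1) * recipCoef a (n - m))

theorem recipSum_eq_recipCoef {a : ℕ → ℝ} (ha : a 0 = 1) (s : Finset T) :
    recipSum a s = recipCoef a s.card := by
  induction hn : s.card using Nat.strong_induction_on generalizing s with
  | _ n ih =>
    cases n with
    | zero => rw [Finset.card_eq_zero.mp hn, recipSum_empty, recipCoef]
    | succ n =>
      have hne : s.Nonempty := Finset.card_pos.mp (by omega)
      have h1 := sum_powerset_recipSum ha hne
      have h2 : ∀ B ∈ s.powerset.erase ∅, a B.card * recipSum a (s \ B) =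
          a B.card * recipCoef a (n + 1 - B.card) := by
        intro B hB
        have hB' : B ≠ ∅ ∧ B ⊆ s := by simpa using hB
        have := Finset.card_pos.mpr (Finset.nonempty_iff_ne_empty.mpr hB'.1)
        rw [ih (n + 1 - B.card) (by omega) _ (by rw [Finset.card_sdiff_of_subset hB'.2, hn])]
      have h3 := Finset.sum_powerset_apply_card (fun k => a k * recipCoef a (n + 1 - k)) (x := s)
      rw [← Finset.add_sum_erase _ _ (Finset.empty_mem_powerset s), Finset.card_empty, hn,
        Finset.sum_range_succ', Nat.sub_zero] at h3
      rw [← Finset.add_sum_erase _ _ (Finset.empty_mem_powerset s), Finset.sum_congr rfl h2,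
        Finset.card_empty, ha, one_mul, Finset.sdiff_empty] at h1
      simp only [Nat.choose_zero_right, one_smul, nsmul_eq_mul, Nat.add_sub_add_right] at h3
      rw [recipCoef, Fin.sum_univ_eq_sum_range
        (fun m => ((n + 1).choose (m + 1) : ℝ) * (a (m + 1) * recipCoef a (n - m)))]
      linarith

end Partitions

/-- The cumulants of a sequence with respect to the lattice of all set partitions. -/
noncomputable def partitionCumulant (a : ℕ → ℝ) (n : ℕ) : ℝ :=
  ∑ π : SetPartition n,
    (-1) ^ (π.parts.card - 1) * ((π.parts.card - 1).factorial : ℝ) * partProd a π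

/-- The exponential generating function of a sequence. -/
noncomputable def egf (a : ℕ → ℝ) : PowerSeries ℝ := PowerSeries.mk fun n => a n / n.factorial

theorem egf_injective : Function.Injective egf := by
  intro a b h
  ext n
  have := congrArg (PowerSeries.coeff n) h
  simp only [egf, PowerSeries.coeff_mk] at this
  have hn : (n.factorial : ℝ) ≠ 0 := by positivity
  field_simp at this
  exact this

theorem egf_mul (a b : ℕ → ℝ) :
    egf a * egf b = egf fun n => ∑ j ∈ Finset.range (n + 1), (n.choose j : ℝ) * a j * b (n - j) := by
  ext n
  rw [PowerSeries.coeff_mul, Finset.Nat.sum_antidiagonal_eq_sum_range_succ_mk]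
  simp only [egf, PowerSeries.coeff_mk]
  rw [Finset.sum_div]
  refine Finset.sum_congr rfl fun j hj => ?_
  have hj' : j ≤ n := by simpa [Nat.lt_succ_iff] using hj
  have hfac : (n.choose j : ℝ) * j.factorial * (n - j).factorial = n.factorial := by
    exact_mod_cast Nat.choose_mul_factorial_mul_factorial hj'
  have h1 : (n.choose j : ℝ) ≠ 0 := by
    exact_mod_cast (Nat.choose_pos hj').ne'
  rw [← hfac]
  field_simp

theorem derivative_egf (a : ℕ → ℝ) :
    PowerSeries.derivative ℝ (egf a) = egf fun n => a (n + 1) := by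
  ext n
  rw [PowerSeries.coeff_derivative]
  simp only [egf, PowerSeries.coeff_mk, Nat.factorial_succ]
  push_cast
  field_simp

/-- Singling out the block of 0 leaves a partition of the rest with the weight (-1)^k k! of the
reciprocal series; at the level of series this is A'·(1/A). -/
theorem partitionCumulant_succ {a : ℕ → ℝ} (ha : a 0 = 1) (n : ℕ) :
    partitionCumulant a (n + 1) = ∑ j ∈ Finset.range (n + 1), (n.choose j : ℝ) * a (j + 1) *
      recipCoef a (n - j) := by
  have h1 := sum_finpartition_block (Finset.univ : Finset (Fin (n + 1)))
    (fun B P => if 0 ∈ B then a B.card * ((-1) ^ P.card * (P.card.factorial : ℝ) *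
      ∏ V ∈ P, a V.card) else 0)
  have h2 : partitionCumulant a (n + 1) = ∑ π : SetPartition (n + 1), ∑ B ∈ π.parts,
      (if 0 ∈ B then a B.card * ((-1) ^ (π.parts.erase B).card *
        ((π.parts.erase B).card.factorial : ℝ) * ∏ V ∈ π.parts.erase B, a V.card) else 0) := by
    unfold partitionCumulant
    refine Finset.sum_congr rfl fun π _ => ?_
    obtain ⟨B, hB, h0⟩ := π.exists_mem (Finset.mem_univ (0 : Fin (n + 1)))
    rw [Finset.sum_eq_single B]
    · rw [if_pos h0, Finset.card_erase_of_mem hB, partProd, ← Finset.mul_prod_erase _ _ hB]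
      ring
    · intro V hV hne
      rw [if_neg]
      intro h
      exact hne (π.eq_of_mem_parts hV hB h h0)
    · intro h; exact absurd hB h
  rw [h2, h1]
  have h3 := sum_finset_mem_card (Fintype.card_fin (n + 1)) 0
    (fun k => a k * recipCoef a (n + 1 - k))
  simp only [Nat.add_sub_add_right, ← mul_assoc] at h3
  rw [← h3]
  have h4 : ∀ B : Finset (Fin (n + 1)), (∑ π : Finpartition (Finset.univ \ B),
      if 0 ∈ B then a B.card * ((-1) ^ π.parts.card * (π.parts.card.factorial : ℝ) *
        ∏ V ∈ π.parts, a V.card) else 0) =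
      if 0 ∈ B then a B.card * recipCoef a (n + 1 - B.card) else 0 := by
    intro B
    split_ifs
    · rw [← Finset.mul_sum]
      congr 1
      have h5 := recipSum_eq_recipCoef ha (Finset.univ \ B)
      rw [Finset.card_sdiff_of_subset (Finset.subset_univ _), Finset.card_univ,
        Fintype.card_fin] at h5
      rw [← h5]
      rfl
    · simp
  rw [Finset.sum_congr rfl (fun B _ => h4 B), ← Finset.sum_filter]
  refine Finset.sum_congr ?_ fun _ _ => rfl
  ext B
  simp only [Finset.powerset_univ, Finset.mem_filter, Finset.mem_erase, Finset.mem_univ, and_true,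
    true_and, and_iff_right_iff_imp]
  rintro h rfl
  simp at h

theorem egf_mul_egf_recipCoef {a : ℕ → ℝ} (ha : a 0 = 1) :
    egf a * egf (recipCoef a) = 1 := by
  rw [egf_mul]
  ext n
  simp only [egf, PowerSeries.coeff_mk, PowerSeries.coeff_one]
  cases n with
  | zero => simp [ha, recipCoef]
  | succ n =>
    rw [if_neg n.succ_ne_zero, div_eq_zero_iff]
    left
    rw [Finset.sum_range_succ', Nat.sub_zero, recipCoef, Fin.sum_univ_eq_sum_range
      (fun m => ((n + 1).choose (m + 1) : ℝ) * (a (m + 1) * recipCoef a (n - m)))]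
    simp [ha, mul_assoc]

/-- The logarithmic derivative of the generating function gives the cumulants. -/
theorem derivative_egf_eq {a : ℕ → ℝ} (ha : a 0 = 1) :
    PowerSeries.derivative ℝ (egf a) = egf (fun n => partitionCumulant a (n + 1)) * egf a := by
  have h1 : egf (fun n => partitionCumulant a (n + 1)) = PowerSeries.derivative ℝ (egf a) *
      egf (recipCoef a) := by
    rw [derivative_egf, egf_mul]
    congr 1
    ext n
    exact partitionCumulant_succ ha n
  rw [h1, mul_assoc, mul_comm (egf (recipCoef a)) (egf a), egf_mul_egf_recipCoef ha, mul_one]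

theorem succ_eq_sum_partitionCumulant {a : ℕ → ℝ} (ha : a 0 = 1) (n : ℕ) :
    a (n + 1) = ∑ j ∈ Finset.range (n + 1),
      (n.choose j : ℝ) * partitionCumulant a (j + 1) * a (n - j) := by
  have h := derivative_egf_eq ha
  rw [derivative_egf, egf_mul] at h
  exact congrFun (egf_injective h) n

/-- Cumulants are additive under binomial convolution. -/
theorem partitionCumulant_conv {a b : ℕ → ℝ} (ha : a 0 = 1) (hb : b 0 = 1) (n : ℕ) :
    partitionCumulant (fun n => ∑ j ∈ Finset.range (n + 1), (n.choose j : ℝ) * a j * b (n - j))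
      (n + 1) = partitionCumulant a (n + 1) + partitionCumulant b (n + 1) := by
  set c : ℕ → ℝ := fun n => ∑ j ∈ Finset.range (n + 1), (n.choose j : ℝ) * a j * b (n - j) with hc
  have hc0 : c 0 = 1 := by simp [hc, ha, hb]
  have h1 : egf c = egf a * egf b := (egf_mul a b).symm
  have h2 := derivative_egf_eq hc0
  have hne : egf c ≠ 0 := by
    intro h
    have := congrArg (PowerSeries.coeff 0) h
    simp [egf, hc0] at this
  have h3 : PowerSeries.derivative ℝ (egf c) = (egf (fun n => partitionCumulant a (n + 1)) +
      egf (fun n => partitionCumulant b (n + 1))) * egf c := by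
    rw [h1, Derivation.leibniz, derivative_egf_eq ha, derivative_egf_eq hb, smul_eq_mul,
      smul_eq_mul]
    ring
  have h4 := mul_right_cancel₀ hne (h2.symm.trans h3)
  have h5 := congrArg (PowerSeries.coeff n) h4
  simp only [egf, PowerSeries.coeff_mk, map_add] at h5
  have hn : (n.factorial : ℝ) ≠ 0 := by positivity
  field_simp at h5
  exact h5

/-- Needed because the coefficients of a degree-d convolution form a binomial convolution only up to
index d. -/
theorem partitionCumulant_congr {a b : ℕ → ℝ} {n : ℕ} (h : ∀ k ≤ n, a k = b k) :
    partitionCumulant a n = partitionCumulant b n := by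
  unfold partitionCumulant partProd
  refine Finset.sum_congr rfl fun π _ => ?_
  congr 1
  refine Finset.prod_congr rfl fun V _ => h _ ?_
  simpa using Finset.card_le_univ V

/-! ## Moments of a real-rooted polynomial in terms of its finite free cumulants -/

section Singletons

variable {X : Type*} [Fintype X] [DecidableEq X]

theorem wprod_indicator_one (σ : Perm X) :
    wprod (fun k => if k = 1 then 1 else 0) σ = if σ = 1 then 1 else 0 := by
  split_ifs with h
  · subst h
    simp [wprod, parts_partition]
  · have hne : σ.cycleType ≠ 0 := fun h' => h (cycleType_eq_zero.mp h')
    obtain ⟨k, hk⟩ := Multiset.exists_mem_of_ne_zero hne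
    have h2 := two_le_of_mem_cycleType hk
    apply Multiset.prod_eq_zero
    refine Multiset.mem_map.mpr ⟨k, ?_, if_neg (by omega)⟩
    rw [parts_partition]
    exact Multiset.mem_add.mpr (Or.inl hk)

theorem permSum_indicator_one (n : ℕ) : permSum (fun k => if k = 1 then 1 else 0) n = 1 := by
  unfold permSum
  simp only [wprod_indicator_one]
  simp

theorem wprod_of_cyc_eq_one (f : ℕ → ℝ) {σ : Perm X} (h : cyc σ = 1) :
    wprod f σ = f (Fintype.card X) := by
  simp [wprod, parts_of_cyc_eq_one h]

/-- This second weight forces σ⁻¹α = 1, and a pair (σ, σ) is transitive only if σ is a single cycle.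
-/
theorem pairSum_indicator_one (f : ℕ → ℝ) (n : ℕ) :
    pairSum f (fun k => if k = 1 then 1 else 0) (n + 1) = n.factorial * f (n + 1) := by
  classical
  unfold pairSum
  rw [Finset.sum_filter, Fintype.sum_prod_type]
  have h1 : ∀ σ : Perm (Fin (n + 1)), (∑ α : Perm (Fin (n + 1)), if joinSetoid σ α = ⊤ then
      wprod f σ * wprod (fun k => if k = 1 then 1 else 0) (σ⁻¹ * α) else 0) =
      if cyc σ = 1 then f (n + 1) else 0 := by
    intro σ
    rw [Finset.sum_eq_single σ]
    · simp only [joinSetoid_self_eq_top_iff]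
      split_ifs with h
      · rw [inv_mul_cancel, wprod_indicator_one, if_pos rfl, mul_one, wprod_of_cyc_eq_one f h,
          Fintype.card_fin]
      · rfl
    · intro α _ hne
      rw [wprod_indicator_one, if_neg (fun h => hne (inv_mul_eq_one.mp h).symm)]
      simp
    · simp
  simp only [h1]
  rw [← Finset.sum_filter, Finset.sum_const, card_filter_cyc_eq_one, Fintype.card_fin,
    if_neg n.succ_ne_zero, nsmul_eq_mul, Nat.add_sub_cancel]

theorem permSum_zero (f : ℕ → ℝ) : permSum f 0 = 1 := by
  unfold permSum
  rw [Fintype.sum_unique]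
  simp [wprod, parts_partition]

theorem permSum_succ (f : ℕ → ℝ) (n : ℕ) :
    permSum f (n + 1) = ∑ j ∈ Finset.range (n + 1),
      (n.choose j : ℝ) * (j.factorial * f (j + 1) * permSum f (n - j)) := by
  have h := permSum_mul_permSum_succ f (fun k => if k = 1 then 1 else 0) n
  simp only [permSum_indicator_one, mul_one, pairSum_indicator_one] at h
  exact h

/-- Makes the generating function of cycle counts a rising factorial, which at x = -d becomes a
signed falling factorial. In the recursion by the cycle of one point, all terms but j = 0 reassemble
to n times the previous value. -/
theorem permSum_const_succ (x : ℝ) (n : ℕ) :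
    permSum (fun _ => x) (n + 1) = (x + n) * permSum (fun _ => x) n := by
  have key : ∀ n : ℕ, permSum (fun _ => x) (n + 1) = ∑ j ∈ Finset.range (n + 1),
      x * ((n.descFactorial j : ℝ) * permSum (fun _ => x) (n - j)) := by
    intro n
    rw [permSum_succ]
    refine Finset.sum_congr rfl fun j _ => ?_
    rw [Nat.descFactorial_eq_factorial_mul_choose]
    push_cast
    ring
  rw [key, Finset.sum_range_succ']
  cases n with
  | zero => simp
  | succ n =>
    have h : ∀ j ∈ Finset.range (n + 1), x * (((n + 1).descFactorial (j + 1) : ℝ) *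
        permSum (fun _ => x) (n + 1 - (j + 1))) =
        (n + 1 : ℝ) * (x * ((n.descFactorial j : ℝ) * permSum (fun _ => x) (n - j))) := by
      intro j _
      rw [Nat.succ_descFactorial_succ, Nat.add_sub_add_right]
      push_cast
      ring
    rw [Finset.sum_congr rfl h, ← Finset.mul_sum, ← key]
    simp
    ring

theorem permSum_neg_const (d k : ℕ) :
    permSum (fun _ => -(d : ℝ)) k = (-1) ^ k * (d.descFactorial k : ℝ) := by
  induction k with
  | zero => simp [permSum_zero]
  | succ k ih =>
    rw [permSum_const_succ, ih, Nat.descFactorial_succ, pow_succ]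
    rcases le_or_gt k d with h | h
    · push_cast [h]
      ring
    · simp [Nat.descFactorial_of_lt h]

/-- The 1/(n-1)! cancels the number of cyclic orders of a block, so the sum over permutations
reduces to the moment-cumulant recursion for set partitions. With x = -d the bracket is κ_n. -/
theorem permSum_cumulant {a : ℕ → ℝ} (ha : a 0 = 1) (x : ℝ) (k : ℕ) :
    permSum (fun n => x * (x ^ (n - 1) / ((n - 1).factorial : ℝ) * partitionCumulant a n)) k =
      x ^ k * a k := by
  induction k using Nat.strong_induction_on with
  | _ k ih =>
    cases k with
    | zero => simp [permSum_zero, ha]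
    | succ n =>
      rw [permSum_succ, succ_eq_sum_partitionCumulant ha, Finset.mul_sum]
      refine Finset.sum_congr rfl fun j hj => ?_
      have hj' : j ≤ n := by simpa [Nat.lt_succ_iff] using hj
      rw [ih (n - j) (by omega), Nat.add_sub_cancel]
      have h1 : x ^ (n + 1) = x * x ^ j * x ^ (n - j) := by
        rw [mul_assoc, ← pow_add, Nat.add_sub_cancel' hj', pow_succ']
      have h2 : (j.factorial : ℝ) ≠ 0 := by positivity
      rw [h1]
      field_simp

end Singletons

theorem coefA_zero {d : ℕ} {p : ℝ[X]} (hp : p ∈ realRooted d) : coefA d 0 p = 1 := by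
  obtain ⟨h1, h2, -⟩ := hp
  rw [coefA, Nat.sub_zero, ← h2, Polynomial.Monic.coeff_natDegree h1]
  simp

theorem coefA_mul {d k : ℕ} (hk : k ≤ d) (p : ℝ[X]) :
    (-1) ^ k * (d.choose k : ℝ) * coefA d k p = p.coeff (d - k) := by
  have h1 : (d.choose k : ℝ) ≠ 0 := by exact_mod_cast (Nat.choose_pos hk).ne'
  have h2 : ((-1 : ℝ)) ^ k * (-1) ^ k = 1 := by rw [← mul_pow]; simp
  rw [coefA]
  field_simp
  linear_combination p.coeff (d - k) * h2

theorem finiteFreeCumulant_eq (d n : ℕ) (p : ℝ[X]) :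
    finiteFreeCumulant d n p = (-(d : ℝ)) ^ (n - 1) / ((n - 1).factorial : ℝ) *
      partitionCumulant (fun k => coefA d k p) n := rfl

theorem newton_multiset (M : Multiset ℝ) (n : ℕ) :
    ((n : ℝ) + 1) * ((-1) ^ (n + 1) * M.esymm (n + 1)) = -∑ j ∈ Finset.range (n + 1),
      (M.map (fun x => x ^ (j + 1))).sum * ((-1) ^ (n - j) * M.esymm (n - j)) := by
  obtain ⟨l, rfl⟩ := Quot.exists_rep M
  let f : Fin l.length → ℝ := fun i => l.get i
  have hM : (Finset.univ.val.map f) = (l : Multiset ℝ) := by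
    rw [Fin.univ_val_map, List.ofFn_get]
  have h := congrArg (MvPolynomial.aeval f) (MvPolynomial.mul_esymm_eq_sum (Fin l.length) ℝ (n + 1))
  simp only [map_mul, map_sum, map_pow, map_neg, map_one, map_natCast,
    MvPolynomial.aeval_esymm_eq_multiset_esymm, hM] at h
  have hp : ∀ k, MvPolynomial.aeval f (MvPolynomial.psum (Fin l.length) ℝ k) =
      ((l : Multiset ℝ).map (fun x => x ^ k)).sum := by
    intro k
    rw [← hM, Multiset.map_map, MvPolynomial.psum]
    simp only [map_sum, map_pow, MvPolynomial.aeval_X]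
    rfl
  simp only [hp] at h
  rw [Finset.sum_filter, Finset.Nat.sum_antidiagonal_eq_sum_range_succ_mk,
    Finset.sum_range_succ, if_neg (by simp), add_zero, ← Finset.sum_range_reflect] at h
  have h2 : ((-1 : ℝ)) ^ (n + 1 + 1) * (-1) ^ (n + 1) = -1 := by
    rw [← pow_add]; exact Odd.neg_one_pow ⟨n + 1, by ring⟩
  have h3 := congrArg (fun t => (-1 : ℝ) ^ (n + 1) * t) h
  simp only [← mul_assoc] at h3
  rw [mul_comm ((-1 : ℝ) ^ (n + 1)) ((-1) ^ (n + 1 + 1)), h2] at h3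
  show ((n : ℝ) + 1) * ((-1) ^ (n + 1) * (l : Multiset ℝ).esymm (n + 1)) =
    -∑ j ∈ Finset.range (n + 1), ((l : Multiset ℝ).map (fun x => x ^ (j + 1))).sum *
      ((-1) ^ (n - j) * (l : Multiset ℝ).esymm (n - j))
  push_cast at h3
  rw [← mul_assoc, mul_comm ((n : ℝ) + 1), h3, neg_one_mul]
  congr 1
  refine Finset.sum_congr rfl fun j hj => ?_
  have hj' : j ≤ n := by simpa [Nat.lt_succ_iff] using hj
  have e2 : n + 1 - (n - j) = j + 1 := by omega
  rw [if_pos (by omega), e2]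
  ring

theorem newton_coeff {d n : ℕ} {p : ℝ[X]} (hp : p ∈ realRooted d) (hn : n + 1 ≤ d) :
    ((n : ℝ) + 1) * p.coeff (d - (n + 1)) = -∑ j ∈ Finset.range (n + 1),
      (d * rootMoment d p (j + 1)) * p.coeff (d - (n - j)) := by
  obtain ⟨h1, h2, h3⟩ := hp
  have hc : ∀ k, k ≤ d → p.coeff (d - k) = (-1) ^ k * p.roots.esymm k := by
    intro k hk
    rw [Polynomial.coeff_eq_esymm_roots_of_splits h3 (by omega), h1.leadingCoeff, one_mul, h2]
    congr 2 <;> omega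
  have hd : (d : ℝ) ≠ 0 := by
    have : 0 < d := by omega
    positivity
  rw [hc _ hn, newton_multiset]
  congr 1
  refine Finset.sum_congr rfl fun j _ => ?_
  rw [hc _ (by omega), rootMoment]
  field_simp

/-- Both sides solve the same triangular recursion, the left by the orbit decomposition of pairs and
the right by Newton's identities. -/
theorem pairSum_finiteFreeCumulant {d n : ℕ} {p : ℝ[X]} (hp : p ∈ realRooted d) (hn : n + 1 ≤ d) :
    pairSum (fun k => -(d : ℝ) * finiteFreeCumulant d k p) (fun _ => -(d : ℝ)) (n + 1) =
      (-(d : ℝ)) ^ (n + 2) * n.factorial * rootMoment d p (n + 1) := by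
  set x : ℝ := -(d : ℝ) with hx
  have hx0 : x ≠ 0 := by
    have : 0 < d := by omega
    have : (d : ℝ) ≠ 0 := by positivity
    simpa [hx] using this
  have hS : ∀ k, k ≤ d → permSum (fun k => x * finiteFreeCumulant d k p) k *
      permSum (fun _ => x) k = x ^ k * k.factorial * p.coeff (d - k) := by
    intro k hk
    have h1 := permSum_cumulant (a := fun k => coefA d k p) (coefA_zero hp) x k
    simp only [finiteFreeCumulant_eq, ← hx]
    rw [h1, hx, permSum_neg_const, ← coefA_mul hk, Nat.descFactorial_eq_factorial_mul_choose]
    push_cast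
    ring
  induction n using Nat.strong_induction_on with
  | _ n ih =>
    have h1 := permSum_mul_permSum_succ (fun k => x * finiteFreeCumulant d k p) (fun _ => x) n
    rw [hS (n + 1) hn] at h1
    have h2 : x ^ (n + 1) * (n + 1).factorial * p.coeff (d - (n + 1)) =
        ∑ j ∈ Finset.range (n + 1), (n.choose j : ℝ) * ((x ^ (j + 2) * j.factorial *
          rootMoment d p (j + 1)) * (x ^ (n - j) * (n - j).factorial * p.coeff (d - (n - j)))) := by
      rw [Nat.factorial_succ]
      push_cast
      have h3 := newton_coeff hp hn
      calc _ = x ^ (n + 1) * n.factorial * (((n : ℝ) + 1) * p.coeff (d - (n + 1))) := by ring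
        _ = _ := by
          rw [h3, ← Finset.sum_neg_distrib, Finset.mul_sum]
          refine Finset.sum_congr rfl fun j hj => ?_
          have hj' : j ≤ n := by simpa [Nat.lt_succ_iff] using hj
          have hfac : (n.choose j : ℝ) * j.factorial * (n - j).factorial = n.factorial := by
            exact_mod_cast Nat.choose_mul_factorial_mul_factorial hj'
          have h4 : x ^ (n + 1) = x ^ (j + 1) * x ^ (n - j) := by
            rw [← pow_add]; congr 1; omega
          have h5 : (d : ℝ) = -x := by simp [hx]
          rw [h4, ← hfac, h5]
          ring
    -- The term j = n carries the unknown with coefficient 1, since the complement of the orbit is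
    -- empty; all earlier terms agree by induction.
    rw [h1, Finset.sum_range_succ, Finset.sum_range_succ] at h2
    have h3 : ∀ j ∈ Finset.range n, (n.choose j : ℝ) * (pairSum
        (fun k => x * finiteFreeCumulant d k p) (fun _ => x) (j + 1) *
          (permSum (fun k => x * finiteFreeCumulant d k p) (n - j) * permSum (fun _ => x) (n - j))) =
        (n.choose j : ℝ) * ((x ^ (j + 2) * j.factorial *
          rootMoment d p (j + 1)) * (x ^ (n - j) * (n - j).factorial * p.coeff (d - (n - j)))) := by
      intro j hj
      have hj' : j < n := by simpa using hj
      rw [ih j hj' (by omega), hS _ (by omega)]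
    rw [Finset.sum_congr rfl h3] at h2
    have h4 := add_left_cancel h2
    have h5 := coefA_mul (Nat.zero_le d) p
    rw [coefA_zero hp] at h5
    simp only [Nat.choose_self, Nat.cast_one, one_mul, Nat.sub_self, permSum_zero, mul_one,
      pow_zero, Nat.factorial_zero, ← h5, Nat.choose_zero_right] at h4
    exact h4

theorem wprod_const_mul {X : Type*} [Fintype X] [DecidableEq X] (x : ℝ) (u : ℕ → ℝ) (σ : Perm X) :
    wprod (fun k => x * u k) σ = x ^ cyc σ * wprod u σ := by
  rw [wprod, Multiset.prod_map_mul, Multiset.map_const', Multiset.prod_replicate]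
  rfl

theorem wprod_const {X : Type*} [Fintype X] [DecidableEq X] (x : ℝ) (σ : Perm X) :
    wprod (fun _ => x) σ = x ^ cyc σ := by
  rw [wprod, Multiset.map_const', Multiset.prod_replicate]
  rfl

open Classical in
/-- The exact expansion of the moments in terms of finite free cumulants. -/
theorem rootMoment_eq_sum {d n : ℕ} {p : ℝ[X]} (hp : p ∈ realRooted d) (hn1 : 1 ≤ n)
    (hn : n ≤ d) :
    rootMoment d p n = 1 / ((n - 1).factorial : ℝ) *
      ∑ q : Perm (Fin n) × Perm (Fin n) with joinSetoid q.1 q.2 = ⊤,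
        (-1 / (d : ℝ)) ^ (n + 1 - (cyc q.1 + cyc (q.1⁻¹ * q.2))) *
          wprod (fun k => finiteFreeCumulant d k p) q.1 := by
  obtain ⟨n, rfl⟩ : ∃ m, n = m + 1 := ⟨n - 1, by omega⟩
  have h1 := pairSum_finiteFreeCumulant hp hn
  have hd : (d : ℝ) ≠ 0 := by
    have : 0 < d := by omega
    positivity
  have hx : (-(d : ℝ)) ≠ 0 := by simpa using hd
  have hf : (n.factorial : ℝ) ≠ 0 := by positivity
  have h2 : rootMoment d p (n + 1) = 1 / (n.factorial : ℝ) * (((-(d : ℝ)) ^ (n + 2))⁻¹ *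
      pairSum (fun k => -(d : ℝ) * finiteFreeCumulant d k p) (fun _ => -(d : ℝ)) (n + 1)) := by
    rw [h1]
    field_simp
  rw [h2, Nat.add_sub_cancel, pairSum, Finset.mul_sum]
  congr 1
  refine Finset.sum_congr rfl fun q hq => ?_
  -- Together with |α| ≥ 1 this shows that the truncated subtraction in the exponent is a genuine
  -- one.
  have h3 := cyc_add_cyc_add_cyc_le_of_transitive (by simpa using hq : joinSetoid q.1 q.2 = ⊤)
  have h4 := cyc_pos q.2
  rw [Fintype.card_fin] at h3
  rw [wprod_const_mul, wprod_const]
  have h5 : (-(d : ℝ)) ^ (n + 2) = (-(d : ℝ)) ^ (n + 1 + 1 - (cyc q.1 + cyc (q.1⁻¹ * q.2))) *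
      (-(d : ℝ)) ^ cyc q.1 * (-(d : ℝ)) ^ cyc (q.1⁻¹ * q.2) := by
    rw [← pow_add, ← pow_add]; congr 1; omega
  have h6 : (-1 / (d : ℝ)) = (-(d : ℝ))⁻¹ := by field_simp
  rw [h5, h6, inv_pow]
  field_simp

end FiniteFree

namespace FiniteFree

/-! ## Real-rootedness of the finite free convolution -/

section Grace

open scoped Complex

/-- Inversion carries the half-plane Im v ≥ h into the disc with centre -i/(2h) and radius 1/(2h);
discs are convex, which suits averaging. -/
theorem norm_inv_add_le {h : ℝ} (hh : 0 < h) {v : ℂ} (hv : v ≠ 0) :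
    ‖v⁻¹ + Complex.I / (2 * h)‖ ≤ 1 / (2 * h) ↔ h ≤ v.im := by
  have hh' : (h : ℂ) ≠ 0 := by exact_mod_cast hh.ne'
  have h1 : v⁻¹ + Complex.I / (2 * h) = (2 * h + Complex.I * v) / (2 * h * v) := by
    field_simp
  have h2 : ‖(2 * h * v : ℂ)‖ = 2 * h * ‖v‖ := by
    rw [norm_mul, norm_mul, Complex.norm_real, Real.norm_of_nonneg hh.le]
    simp
  have hv' : 0 < ‖v‖ := norm_pos_iff.mpr hv
  rw [h1, norm_div, h2, div_le_div_iff₀ (by positivity) (by positivity), one_mul,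
    mul_comm, mul_le_mul_iff_right₀ (by positivity : 0 < 2 * h),
    ← sq_le_sq₀ (norm_nonneg _) (norm_nonneg _), Complex.sq_norm, Complex.sq_norm,
    Complex.normSq_apply, Complex.normSq_apply]
  simp only [Complex.add_re, Complex.mul_re, Complex.re_ofNat, Complex.ofReal_re, Complex.im_ofNat,
    Complex.ofReal_im, mul_zero, sub_zero, Complex.I_re, zero_mul, Complex.I_im, one_mul, zero_sub,
    Complex.add_im, Complex.mul_im, add_zero, zero_add]
  constructor
  · intro h3
    nlinarith
  · intro h3
    nlinarith

/-- Polynomials of degree `d` with all roots in the closed lower half-plane. -/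
def LowerRooted (d : ℕ) (P : ℂ[X]) : Prop :=
  P ≠ 0 ∧ P.natDegree = d ∧ ∀ w, P.eval w = 0 → w.im ≤ 0

/-- The polar derivative of a polynomial of degree `d`. -/
noncomputable def polarDeriv (d : ℕ) (x : ℂ) (P : ℂ[X]) : ℂ[X] :=
  C (d : ℂ) * P - derivative P * (X - C x)

theorem iterate_derivative_mul_X_sub_C (P : ℂ[X]) (x : ℂ) (k : ℕ) :
    derivative^[k] (P * (X - C x)) =
      derivative^[k] P * (X - C x) + k • derivative^[k - 1] P := by
  rw [mul_sub, iterate_derivative_sub, iterate_derivative_mul_X, mul_comm P (C x),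
    iterate_derivative_C_mul]
  ring

theorem eval_iterate_derivative_polarDeriv (d : ℕ) (x : ℂ) (P : ℂ[X]) (k : ℕ) :
    (derivative^[k] (polarDeriv d x P)).eval x = ((d : ℂ) - k) * (derivative^[k] P).eval x := by
  rw [polarDeriv, iterate_derivative_sub, iterate_derivative_C_mul, iterate_derivative_mul_X_sub_C]
  cases k with
  | zero => simp
  | succ k =>
    rw [Nat.add_sub_cancel, ← Function.iterate_succ_apply derivative k P]
    simp
    ring

/-- Laguerre's theorem on polar derivatives. -/
theorem LowerRooted.polarDeriv {d : ℕ} {P : ℂ[X]} (hP : LowerRooted (d + 1) P) {x : ℂ}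
    (hx : 0 < x.im) : LowerRooted d (polarDeriv (d + 1) x P) := by
  obtain ⟨h0, hdeg, hroots⟩ := hP
  have hs : P.Splits := IsAlgClosed.splits P
  have hcard : Multiset.card P.roots = d + 1 := by
    rw [← hdeg]; exact splits_iff_card_roots.mp hs
  have hcoeff : ∀ m, (FiniteFree.polarDeriv (d + 1) x P).coeff m =
      ((d : ℂ) + 1 - m) * P.coeff m + x * ((m : ℂ) + 1) * P.coeff (m + 1) := by
    intro m
    rw [FiniteFree.polarDeriv, mul_sub, mul_comm _ (C x), coeff_sub, coeff_sub, coeff_C_mul,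
      coeff_C_mul, coeff_derivative]
    cases m with
    | zero => simp
    | succ m =>
      rw [coeff_mul_X, coeff_derivative]
      push_cast
      ring
  -- Up to the leading coefficient of P this is (d+1)x minus the sum of the roots, whose imaginary
  -- part is positive.
  have hlead : (FiniteFree.polarDeriv (d + 1) x P).coeff d ≠ 0 := by
    have h1 := hs.nextCoeff_eq_neg_sum_roots_mul_leadingCoeff
    rw [nextCoeff_of_natDegree_pos (by omega), hdeg, Nat.add_sub_cancel] at h1
    have h2 : P.coeff (d + 1) = P.leadingCoeff := by rw [leadingCoeff, hdeg]
    rw [hcoeff, h1, h2]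
    have h3 : ((d : ℂ) + 1 - d) * (-P.leadingCoeff * P.roots.sum) + x * ((d : ℂ) + 1) *
        P.leadingCoeff = P.leadingCoeff * (((d : ℂ) + 1) * x - P.roots.sum) := by ring
    rw [h3]
    refine mul_ne_zero (leadingCoeff_ne_zero.mpr h0) ?_
    intro h4
    have h5 : P.roots.sum.im ≤ 0 := by
      have : P.roots.sum.im = (P.roots.map Complex.im).sum := by
        exact map_multiset_sum Complex.imAddGroupHom P.roots
      rw [this]
      refine (Multiset.sum_le_card_nsmul _ 0 fun r hr => ?_).trans_eq (smul_zero _)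
      obtain ⟨w, hw, rfl⟩ := Multiset.mem_map.mp hr
      exact hroots w (isRoot_of_mem_roots hw)
    have h6 := congrArg Complex.im h4
    simp at h6
    have h7 : 0 < ((d : ℝ) + 1) * x.im := by positivity
    linarith
  refine ⟨fun h => hlead (by rw [h]; simp), ?_, ?_⟩
  · refine natDegree_eq_of_le_of_coeff_ne_zero ?_ hlead
    rw [natDegree_le_iff_coeff_eq_zero]
    intro m hm
    rw [hcoeff, coeff_eq_zero_of_natDegree_lt (by omega : P.natDegree < m + 1)]
    rcases Nat.lt_or_ge (d + 1) m with h | h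
    · rw [coeff_eq_zero_of_natDegree_lt (by omega)]; simp
    · have : m = d + 1 := by omega
      rw [this]; push_cast; ring
  · intro w hw
    by_contra hwim
    have hwpos : 0 < w.im := not_le.mp hwim
    have hPw : P.eval w ≠ 0 := fun h => hwim (hroots w h)
    rw [FiniteFree.polarDeriv, eval_sub, eval_mul, eval_mul, eval_C, eval_sub, eval_X, eval_C,
      hs.eval_derivative_eq_eval_mul_sum hPw] at hw
    set S := (P.roots.map fun z ↦ 1 / (w - z)).sum with hS
    have h1 : ((d + 1 : ℕ) : ℂ) = S * (w - x) := by
      have : P.eval w * (((d + 1 : ℕ) : ℂ) - S * (w - x)) = 0 := by linear_combination hw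
      exact sub_eq_zero.mp ((mul_eq_zero.mp this).resolve_left hPw)
    have hd1 : ((d + 1 : ℕ) : ℂ) ≠ 0 := by exact_mod_cast d.succ_ne_zero
    have hwx : w - x ≠ 0 := by
      intro h; rw [h, mul_zero] at h1; exact hd1 h1
    -- Each 1/(w - z), with z a root, lies in the disc for h = Im w, hence so does their mean. But a
    -- zero w of the polar derivative makes this mean 1/(w - x), which forces Im (w - x) ≥ Im w,
    -- contrary to Im x > 0.
    have h2 : ‖S + ((d + 1 : ℕ) : ℂ) * (Complex.I / (2 * w.im))‖ ≤
        ((d + 1 : ℕ) : ℝ) * (1 / (2 * w.im)) := by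
      have h3 : S + ((d + 1 : ℕ) : ℂ) * (Complex.I / (2 * w.im)) =
          (P.roots.map fun z ↦ 1 / (w - z) + Complex.I / (2 * w.im)).sum := by
        rw [Multiset.sum_map_add, Multiset.map_const', Multiset.sum_replicate, hcard, nsmul_eq_mul]
      rw [h3]
      refine (norm_multiset_sum_le _).trans ?_
      rw [Multiset.map_map]
      have h4 := Multiset.sum_le_card_nsmul (P.roots.map
        (norm ∘ fun z ↦ 1 / (w - z) + Complex.I / (2 * (w.im : ℂ)))) (1 / (2 * w.im)) (by
          intro r hr
          obtain ⟨z, hz, rfl⟩ := Multiset.mem_map.mp hr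
          have hz0 := hroots z (isRoot_of_mem_roots hz)
          simp only [Function.comp_apply, one_div]
          rw [← one_div (2 * w.im)]
          rw [norm_inv_add_le hwpos]
          · rw [Complex.sub_im]; linarith
          · intro h
            rw [sub_eq_zero.mp h] at hwpos
            linarith)
      rwa [Multiset.card_map, hcard, nsmul_eq_mul] at h4
    have h3 : S + ((d + 1 : ℕ) : ℂ) * (Complex.I / (2 * w.im)) =
        ((d + 1 : ℕ) : ℂ) * ((w - x)⁻¹ + Complex.I / (2 * w.im)) := by
      rw [mul_add]
      congr 1
      rw [h1, mul_inv_cancel_right₀ hwx]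
    rw [h3, norm_mul, Complex.norm_natCast,
      mul_le_mul_iff_right₀ (by positivity : (0 : ℝ) < ((d + 1 : ℕ) : ℝ)),
      norm_inv_add_le hwpos hwx, Complex.sub_im] at h2
    linarith

/-- The symmetric apolar pairing of two polynomials of degree `d`. -/
noncomputable def apolarPairing (d : ℕ) (P Q : ℂ[X]) (x y : ℂ) : ℂ :=
  ∑ k ∈ Finset.range (d + 1), (derivative^[k] P).eval x * (derivative^[d - k] Q).eval y

/-- The derivative in t telescopes, and the two boundary terms contain derivatives of order d + 1,
which vanish. -/
theorem apolarPairing_shift {d : ℕ} {P Q : ℂ[X]} (hP : P.natDegree ≤ d) (hQ : Q.natDegree ≤ d)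
    (x y t : ℂ) : apolarPairing d P Q (x + t) (y - t) = apolarPairing d P Q x y := by
  let R : ℂ[X] := ∑ k ∈ Finset.range (d + 1), (derivative^[k] P).comp (C x + X) *
    (derivative^[d - k] Q).comp (C y - X)
  have hR : ∀ t, R.eval t = apolarPairing d P Q (x + t) (y - t) := by
    intro t
    simp [R, apolarPairing, eval_finsetSum]
  have hD : derivative R = 0 := by
    let g : ℕ → ℂ[X] := fun k => (derivative^[k] P).comp (C x + X) *
      (derivative^[d + 1 - k] Q).comp (C y - X)
    have h1 : derivative R = ∑ k ∈ Finset.range (d + 1), (g (k + 1) - g k) := by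
      simp only [R]
      rw [derivative_sum]
      refine Finset.sum_congr rfl fun k hk => ?_
      have hk' : k ≤ d := by simpa [Nat.lt_succ_iff] using hk
      have e1 : d + 1 - (k + 1) = d - k := by omega
      have e2 : d + 1 - k = d - k + 1 := by omega
      simp only [g]
      rw [derivative_mul, derivative_comp, derivative_comp, e1, e2, Function.iterate_succ_apply',
        Function.iterate_succ_apply']
      simp
      ring
    rw [h1, Finset.sum_range_sub]
    simp only [g, Nat.sub_self, Nat.sub_zero]
    rw [iterate_derivative_eq_zero (by omega : P.natDegree < d + 1),
      iterate_derivative_eq_zero (by omega : Q.natDegree < d + 1)]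
    simp
  have h2 := eq_C_of_derivative_eq_zero hD
  have h3 : R.eval t = R.eval 0 := by rw [h2]; simp
  rw [hR, hR] at h3
  simpa using h3

/-- Grace's theorem for the lower half-plane. -/
theorem apolarPairing_ne_zero {d : ℕ} {P Q : ℂ[X]} (hP : LowerRooted d P) (hQ : LowerRooted d Q)
    {x y : ℂ} (hxy : 0 < (x + y).im) : apolarPairing d P Q x y ≠ 0 := by
  induction d generalizing P Q x y with
  | zero =>
    obtain ⟨hP0, hPd, -⟩ := hP
    obtain ⟨hQ0, hQd, -⟩ := hQ
    rw [natDegree_eq_zero] at hPd hQd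
    obtain ⟨a, rfl⟩ := hPd
    obtain ⟨b, rfl⟩ := hQd
    simp only [apolarPairing, zero_add, Finset.range_one, Finset.sum_singleton, Nat.sub_zero,
      Function.iterate_zero, id, eval_C]
    exact mul_ne_zero (by simpa using hP0) (by simpa using hQ0)
  | succ d ih =>
    obtain ⟨hQ0, hQd, hQr⟩ := id hQ
    obtain ⟨l, hl⟩ : ∃ l, Q.eval l = 0 := by
      have := IsAlgClosed.exists_root Q (by
        rw [degree_eq_natDegree hQ0, hQd]; exact_mod_cast d.succ_ne_zero)
      exact this
    have hlim := hQr l hl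
    obtain ⟨Q₁, rfl⟩ : ∃ Q₁, Q = Q₁ * (X - C l) := by
      obtain ⟨Q₁, h⟩ := dvd_iff_isRoot.mpr hl
      exact ⟨Q₁, by rw [h, mul_comm]⟩
    have hQ₁0 : Q₁ ≠ 0 := left_ne_zero_of_mul hQ0
    have hQ₁ : LowerRooted d Q₁ := by
      refine ⟨hQ₁0, ?_, fun w hw => hQr w (by simp [hw])⟩
      rw [natDegree_mul hQ₁0 (X_sub_C_ne_zero l), natDegree_X_sub_C] at hQd
      omega
    -- Move the second argument to a root l of Q. Then the last term drops out and the rest pairs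
    -- the polar derivative of P at z with Q/(X - l). As Im l ≤ 0, the pole z stays in the upper
    -- half-plane, so Laguerre's theorem applies.
    rw [← apolarPairing_shift hP.2.1.le hQd.le x y (y - l)]
    have e1 : y - (y - l) = l := by ring
    rw [e1]
    set z := x + (y - l) with hz
    have hzim : 0 < z.im := by
      have : z = (x + y) - l := by rw [hz]; ring
      rw [this, Complex.sub_im]
      linarith
    have h2 : apolarPairing (d + 1) P (Q₁ * (X - C l)) z l =
        apolarPairing d (polarDeriv (d + 1) z P) Q₁ z l := by
      unfold apolarPairing
      rw [Finset.sum_range_succ]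
      have h3 : (derivative^[d + 1 - (d + 1)] (Q₁ * (X - C l))).eval l = 0 := by simp
      rw [h3, mul_zero, add_zero]
      refine Finset.sum_congr rfl fun k hk => ?_
      have hk' : k ≤ d := by simpa [Nat.lt_succ_iff] using hk
      rw [eval_iterate_derivative_polarDeriv, iterate_derivative_mul_X_sub_C]
      have e2 : d + 1 - k - 1 = d - k := by omega
      rw [e2]
      simp only [eval_add, eval_mul, eval_sub, eval_X, eval_C, sub_self, mul_zero, zero_add,
        nsmul_eq_mul, eval_natCast]
      push_cast [show k ≤ d + 1 by omega]
      ring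
    rw [h2]
    exact ih (hP.polarDeriv hzim) hQ₁ (by rw [Complex.add_im, hz]; simp at hxy ⊢; linarith)

theorem lowerRooted_map {d : ℕ} {p : ℝ[X]} (hp : p ∈ realRooted d) :
    LowerRooted d (p.map (algebraMap ℝ ℂ)) := by
  obtain ⟨h1, h2, h3⟩ := hp
  refine ⟨(h1.map _).ne_zero, by rw [h1.natDegree_map, h2], fun w hw => ?_⟩
  obtain ⟨r, rfl⟩ := h3.mem_range_of_isRoot h1.ne_zero (i := algebraMap ℝ ℂ) hw
  simp

theorem coeff_finiteFreeAdd {d n : ℕ} (hn : n ≤ d) (p q : ℝ[X]) :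
    (finiteFreeAdd d p q).coeff (d - n) = (-1) ^ n * (d.choose n : ℝ) *
      ∑ i ∈ Finset.range (n + 1), (n.choose i : ℝ) * coefA d i p * coefA d (n - i) q := by
  rw [finiteFreeAdd, finsetSum_coeff, Finset.sum_eq_single n]
  · rw [coeff_C_mul, coeff_X_pow, if_pos rfl, mul_one]
  · intro k hk hne
    have hk' : k ≤ d := by simpa [Nat.lt_succ_iff] using hk
    rw [coeff_C_mul, coeff_X_pow, if_neg (by omega), mul_zero]
  · intro h; simp at h; omega

theorem natDegree_finiteFreeAdd_le (d : ℕ) (p q : ℝ[X]) :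
    (finiteFreeAdd d p q).natDegree ≤ d := by
  refine natDegree_sum_le_of_forall_le _ _ fun k _ => ?_
  exact (natDegree_C_mul_X_pow_le _ _).trans (Nat.sub_le _ _)

/-- The differential form of the convolution exhibits it as an apolar pairing with second argument
0, so Grace's theorem controls its zeros. -/
theorem factorial_smul_finiteFreeAdd {d : ℕ} {p q : ℝ[X]} (hp : p.natDegree ≤ d) :
    C (d.factorial : ℝ) * finiteFreeAdd d p q =
      ∑ k ∈ Finset.range (d + 1), C ((derivative^[d - k] q).eval 0) * derivative^[k] p := by
  ext m
  rw [coeff_C_mul, finsetSum_coeff]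
  simp only [coeff_C_mul, coeff_iterate_derivative, ← coeff_zero_eq_eval_zero, zero_add]
  rcases Nat.lt_or_ge d m with hm | hm
  · rw [coeff_eq_zero_of_natDegree_lt ((natDegree_finiteFreeAdd_le d p q).trans_lt hm), mul_zero]
    symm
    refine Finset.sum_eq_zero fun k _ => ?_
    rw [coeff_eq_zero_of_natDegree_lt (by omega : p.natDegree < m + k)]
    simp
  · obtain ⟨n, rfl⟩ : ∃ n, m = d - n := ⟨d - m, by omega⟩
    wlog hn : n ≤ d generalizing n
    · have := this (n := d) (by omega) le_rfl
      have e : d - n = d - d := by omega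
      rwa [e]
    rw [coeff_finiteFreeAdd hn, ← Finset.sum_range_reflect, Nat.add_sub_cancel]
    have hsub : Finset.range (n + 1) ⊆ Finset.range (d + 1) := by
      intro k; simp; omega
    rw [← Finset.sum_subset hsub]
    · rw [Finset.mul_sum, Finset.mul_sum]
      refine Finset.sum_congr rfl fun k hk => ?_
      have hk' : k ≤ n := by simpa [Nat.lt_succ_iff] using hk
      have e1 : n - (n - k) = k := by omega
      have e2 : d - n + k = d - (n - k) := by omega
      rw [e1, e2, ← coefA_mul (by omega : k ≤ d), ← coefA_mul (by omega : n - k ≤ d), nsmul_eq_mul,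
        nsmul_eq_mul, Nat.descFactorial_self]
      have hs : ((-1 : ℝ)) ^ n = (-1) ^ k * (-1) ^ (n - k) := by
        rw [← pow_add]; congr 1; omega
      have hnum : (d.factorial : ℝ) * (d.choose n : ℝ) * (n.choose (n - k) : ℝ) =
          ((d - k).factorial : ℝ) * (d.choose k : ℝ) * ((d - (n - k)).descFactorial k : ℝ) *
            (d.choose (n - k) : ℝ) := by
        have f1 : ((d - n).factorial : ℝ) * ((d - (n - k)).descFactorial k : ℝ) =
            ((d - (n - k)).factorial : ℝ) := by
          have := Nat.factorial_mul_descFactorial (by omega : k ≤ d - (n - k))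
          have e3 : d - (n - k) - k = d - n := by omega
          rw [e3] at this
          exact_mod_cast this
        have f2 : (d.choose n : ℝ) * n.factorial * (d - n).factorial = d.factorial := by
          exact_mod_cast Nat.choose_mul_factorial_mul_factorial hn
        have f3 : (n.choose (n - k) : ℝ) * (n - k).factorial * k.factorial = n.factorial := by
          have := Nat.choose_mul_factorial_mul_factorial (by omega : n - k ≤ n)
          rw [e1] at this
          exact_mod_cast this
        have f4 : (d.choose k : ℝ) * k.factorial * (d - k).factorial = d.factorial := by
          exact_mod_cast Nat.choose_mul_factorial_mul_factorial (by omega : k ≤ d)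
        have f5 : (d.choose (n - k) : ℝ) * (n - k).factorial * (d - (n - k)).factorial =
            d.factorial := by
          exact_mod_cast Nat.choose_mul_factorial_mul_factorial (by omega : n - k ≤ d)
        have g1 : ((d - n).factorial : ℝ) ≠ 0 := by positivity
        have g2 : ((n - k).factorial : ℝ) ≠ 0 := by positivity
        have g3 : (k.factorial : ℝ) ≠ 0 := by positivity
        have g4 : ((d - n).factorial : ℝ) * (n - k).factorial * k.factorial ≠ 0 :=
          mul_ne_zero (mul_ne_zero g1 g2) g3
        apply mul_right_cancel₀ g4
        calc _ = (d.factorial : ℝ) * ((d.choose n : ℝ) * ((n.choose (n - k) : ℝ) *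
              (n - k).factorial * k.factorial) * (d - n).factorial) := by ring
          _ = (d.factorial : ℝ) * d.factorial := by rw [f3, f2]
          _ = ((d.choose k : ℝ) * k.factorial * (d - k).factorial) * ((d.choose (n - k) : ℝ) *
              (n - k).factorial * (((d - n).factorial : ℝ) *
                ((d - (n - k)).descFactorial k : ℝ))) := by rw [f1, f4, f5]
          _ = _ := by ring
      rw [hs]
      linear_combination ((-1 : ℝ)) ^ k * (-1) ^ (n - k) * coefA d (n - k) p * coefA d k q * hnum
    · intro k _ hk
      have hk' : n < k := by simpa [Nat.lt_succ_iff] using hk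
      rw [coeff_eq_zero_of_natDegree_lt (by omega : p.natDegree < d - n + k)]
      simp

theorem eval_finiteFreeAdd_map {d : ℕ} {p q : ℝ[X]} (hp : p.natDegree ≤ d) (z : ℂ) :
    (d.factorial : ℂ) * ((finiteFreeAdd d p q).map (algebraMap ℝ ℂ)).eval z =
      apolarPairing d (p.map (algebraMap ℝ ℂ)) (q.map (algebraMap ℝ ℂ)) z 0 := by
  have h := congrArg (fun r : ℝ[X] => (r.map (algebraMap ℝ ℂ)).eval z)
    (factorial_smul_finiteFreeAdd (q := q) hp)
  simp only [Polynomial.map_mul, map_C, eval_mul, eval_C, Polynomial.map_sum, eval_finsetSum] at h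
  have h1 : (algebraMap ℝ ℂ) (d.factorial : ℝ) = (d.factorial : ℂ) := by simp
  rw [h1] at h
  rw [h, apolarPairing]
  refine Finset.sum_congr rfl fun k _ => ?_
  rw [mul_comm]
  congr 1
  · rw [iterate_derivative_map]
  · rw [iterate_derivative_map, ← coeff_zero_eq_eval_zero, ← coeff_zero_eq_eval_zero, coeff_map]

/-- The finite free convolution of real-rooted polynomials is real-rooted. -/
theorem finiteFreeAdd_mem_realRooted {d : ℕ} {p q : ℝ[X]} (hp : p ∈ realRooted d)
    (hq : q ∈ realRooted d) : finiteFreeAdd d p q ∈ realRooted d := by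
  set r := finiteFreeAdd d p q with hr
  have hlead : r.coeff d = 1 := by
    have := coeff_finiteFreeAdd (Nat.zero_le d) p q
    rw [Nat.sub_zero] at this
    rw [hr, this]
    simp [coefA_zero hp, coefA_zero hq]
  have hdeg : r.natDegree = d :=
    natDegree_eq_of_le_of_coeff_ne_zero (natDegree_finiteFreeAdd_le d p q) (by rw [hlead]; simp)
  have hmonic : r.Monic := by rw [Monic, leadingCoeff, hdeg, hlead]
  refine ⟨hmonic, hdeg, ?_⟩
  have hup : ∀ z : ℂ, 0 < z.im → (r.map (algebraMap ℝ ℂ)).eval z ≠ 0 := by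
    intro z hz h0
    have h1 := eval_finiteFreeAdd_map (q := q) hp.2.1.le z
    rw [← hr, h0, mul_zero] at h1
    exact apolarPairing_ne_zero (lowerRooted_map hp) (lowerRooted_map hq) (by simpa using hz) h1.symm
  refine Splits.of_splits_map (algebraMap ℝ ℂ) (IsAlgClosed.splits _) ?_
  intro z hz
  have hz0 : (r.map (algebraMap ℝ ℂ)).eval z = 0 := isRoot_of_mem_roots hz
  -- Grace's theorem excludes the upper half-plane; the coefficients are real, so conjugation
  -- excludes the lower one.
  have him : z.im = 0 := by
    rcases lt_trichotomy z.im 0 with h | h | h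
    · exfalso
      refine hup (starRingEnd ℂ z) (by simpa using h) ?_
      rw [eval_map_algebraMap] at hz0 ⊢
      rw [aeval_conj, hz0, map_zero]
    · exact h
    · exact absurd hz0 (hup z h)
  exact ⟨z.re, Complex.ext (by simp) (by simp [him])⟩

end Grace

end FiniteFree

namespace FiniteFree

open Equiv Equiv.Perm

/-! ### Calculus of expansions a + b/d + o(1/d) -/

section FirstOrder

/-- `f d = a + b / d + o(1 / d)` as `d → ∞`. -/
def FirstOrder (f : ℕ → ℝ) (a b : ℝ) : Prop :=
  Tendsto (fun d : ℕ => (d : ℝ) * (f d - a)) atTop (𝓝 b)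

theorem FirstOrder.tendsto {f : ℕ → ℝ} {a b : ℝ} (h : FirstOrder f a b) :
    Tendsto f atTop (𝓝 a) := by
  have h1 : Tendsto (fun d : ℕ => (d : ℝ)⁻¹ * ((d : ℝ) * (f d - a)) + a) atTop (𝓝 (0 * b + a)) :=
    ((tendsto_inv_atTop_nhds_zero_nat (𝕜 := ℝ)).mul h).add_const a
  rw [zero_mul, zero_add] at h1
  refine h1.congr' ?_
  filter_upwards [eventually_ge_atTop 1] with d hd
  have : (d : ℝ) ≠ 0 := by positivity
  field_simp
  ring

theorem firstOrder_const (a : ℝ) : FirstOrder (fun _ => a) a 0 := by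
  simp [FirstOrder]

theorem FirstOrder.congr' {f g : ℕ → ℝ} {a b : ℝ} (h : FirstOrder f a b) (hfg : f =ᶠ[atTop] g) :
    FirstOrder g a b := by
  refine Tendsto.congr' ?_ h
  filter_upwards [hfg] with d hd
  rw [hd]

theorem FirstOrder.add {f g : ℕ → ℝ} {a b a' b' : ℝ} (hf : FirstOrder f a b)
    (hg : FirstOrder g a' b') : FirstOrder (fun d => f d + g d) (a + a') (b + b') :=
  (Tendsto.add hf hg).congr fun d => by ring

theorem FirstOrder.mul {f g : ℕ → ℝ} {a b a' b' : ℝ} (hf : FirstOrder f a b)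
    (hg : FirstOrder g a' b') : FirstOrder (fun d => f d * g d) (a * a') (b * a' + a * b') :=
  ((Tendsto.mul hf hg.tendsto).add (Tendsto.const_mul a hg)).congr fun d => by ring

theorem FirstOrder.inv {f : ℕ → ℝ} {a b : ℝ} (hf : FirstOrder f a b) (ha : a ≠ 0) :
    FirstOrder (fun d => (f d)⁻¹) a⁻¹ (b * (-(a⁻¹ * a⁻¹))) := by
  have h1 : Tendsto (fun d : ℕ => ((d : ℝ) * (f d - a)) * (-((f d)⁻¹ * a⁻¹))) atTop
      (𝓝 (b * (-(a⁻¹ * a⁻¹)))) :=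
    Tendsto.mul hf ((hf.tendsto.inv₀ ha).mul_const a⁻¹).neg
  refine h1.congr' ?_
  filter_upwards [hf.tendsto.eventually_ne ha] with d hd
  field_simp
  ring

theorem FirstOrder.sum {ι : Type*} {s : Finset ι} {f : ι → ℕ → ℝ} {a b : ι → ℝ}
    (h : ∀ i ∈ s, FirstOrder (f i) (a i) (b i)) :
    FirstOrder (fun d => ∑ i ∈ s, f i d) (∑ i ∈ s, a i) (∑ i ∈ s, b i) := by
  refine (tendsto_finsetSum s h).congr fun d => ?_
  rw [← Finset.mul_sum, Finset.sum_sub_distrib]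

/-- The Leibniz rule; on the blocks of a partition the first-order coefficient is `partDeriv`. -/
theorem FirstOrder.prod {ι : Type*} [DecidableEq ι] {s : Finset ι} {f : ι → ℕ → ℝ} {a b : ι → ℝ}
    (h : ∀ i ∈ s, FirstOrder (f i) (a i) (b i)) :
    FirstOrder (fun d => ∏ i ∈ s, f i d) (∏ i ∈ s, a i)
      (∑ i ∈ s, b i * ∏ j ∈ s.erase i, a j) := by
  induction s using Finset.induction_on with
  | empty => simpa using firstOrder_const 1
  | insert i s hi ih =>
    have h1 := (h i (Finset.mem_insert_self i s)).mul
      (ih fun j hj => h j (Finset.mem_insert_of_mem hj))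
    simp only [Finset.prod_insert hi, Finset.sum_insert hi, Finset.erase_insert hi]
    convert h1 using 2
    rw [Finset.mul_sum]
    refine Finset.sum_congr rfl fun j hj => ?_
    have hij : i ≠ j := fun e => hi (e ▸ hj)
    rw [Finset.erase_insert_of_ne hij, Finset.prod_insert (fun h => hi (Finset.mem_of_mem_erase h))]
    ring

theorem exists_firstOrder_multiset_prod {s : Multiset ℕ} {κ : ℕ → ℕ → ℝ}
    (h : ∀ k ∈ s, ∃ a b, FirstOrder (fun d => κ d k) a b) :
    ∃ a b, FirstOrder (fun d => (s.map (κ d)).prod) a b := by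
  induction s using Multiset.induction_on with
  | empty => exact ⟨1, 0, by simpa using firstOrder_const 1⟩
  | cons k s ih =>
    obtain ⟨a, b, h1⟩ := h k (Multiset.mem_cons_self k s)
    obtain ⟨a', b', h2⟩ := ih fun j hj => h j (Multiset.mem_cons_of_mem hj)
    exact ⟨_, _, by simpa using h1.mul h2⟩

theorem exists_firstOrder_sum {ι : Type*} {s : Finset ι} {f : ι → ℕ → ℝ}
    (h : ∀ i ∈ s, ∃ a b, FirstOrder (f i) a b) :
    ∃ a b, FirstOrder (fun d => ∑ i ∈ s, f i d) a b := by
  choose! a b hab using h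
  exact ⟨_, _, FirstOrder.sum hab⟩

theorem firstOrder_neg_one_div_pow (k : ℕ) :
    ∃ b, FirstOrder (fun d : ℕ => (-1 / (d : ℝ)) ^ k) (0 ^ k) b := by
  induction k with
  | zero => exact ⟨0, by simpa using firstOrder_const 1⟩
  | succ k ih =>
    obtain ⟨b, hb⟩ := ih
    have h1 : FirstOrder (fun d : ℕ => -1 / (d : ℝ)) 0 (-1) := by
      refine (tendsto_const_nhds (x := (-1 : ℝ))).congr' ?_
      filter_upwards [eventually_ge_atTop 1] with d hd
      have : (d : ℝ) ≠ 0 := by positivity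
      field_simp
      ring
    exact ⟨_, by simpa only [pow_succ] using hb.mul h1⟩

end FirstOrder

/-! ### First-order expansion of moments and of cumulants -/

section Expansion

theorem mem_partition_parts_lt {n : ℕ} {σ : Perm (Fin n)} (h : cyc σ ≠ 1) {k : ℕ}
    (hk : k ∈ σ.partition.parts) : k < n := by
  have hsum := σ.partition.parts_sum
  obtain ⟨s, hs⟩ := Multiset.exists_cons_of_mem hk
  rw [hs, Multiset.sum_cons, Fintype.card_fin] at hsum
  rcases Nat.lt_or_ge k n with h1 | h1
  · exact h1
  · exfalso
    have h2 : s.sum = 0 := by omega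
    have h3 : s = 0 := by
      rw [Multiset.eq_zero_iff_forall_notMem]
      intro j hj
      have h4 : 0 < j := σ.partition.parts_pos (by rw [hs]; exact Multiset.mem_cons_of_mem hj)
      have h5 := Multiset.le_sum_of_mem hj
      omega
    apply h
    rw [cyc, hs, h3]
    rfl

theorem tendsto_wprod {X : Type*} [Fintype X] [DecidableEq X] {κ : ℕ → ℕ → ℝ} {r : ℕ → ℝ}
    (h : ∀ k, 1 ≤ k → Tendsto (fun d => κ d k) atTop (𝓝 (r k))) (σ : Perm X) :
    Tendsto (fun d => wprod (κ d) σ) atTop (𝓝 (wprod r σ)) :=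
  tendsto_multiset_prod _ fun _ hk => h _ (σ.partition.parts_pos hk)

theorem tendsto_annularSum {κ : ℕ → ℕ → ℝ} {r : ℕ → ℝ}
    (h : ∀ k, 1 ≤ k → Tendsto (fun d => κ d k) atTop (𝓝 (r k))) (n : ℕ) :
    Tendsto (fun d => annularSum (κ d) n) atTop (𝓝 (annularSum r n)) :=
  (tendsto_finsetSum _ fun _ _ => tendsto_finsetSum _ fun σ _ =>
    (tendsto_wprod h σ).div_const _).const_mul _

theorem firstOrder_partProd {κ : ℕ → ℕ → ℝ} {r s : ℕ → ℝ}
    (h : ∀ k, 1 ≤ k → FirstOrder (fun d => κ d k) (r k) (s k)) {n : ℕ} (π : SetPartition n) :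
    FirstOrder (fun d => partProd (κ d) π) (partProd r π) (partDeriv r s π) :=
  FirstOrder.prod fun _ hV => h _ (Finset.card_pos.mpr (π.nonempty_of_mem_parts hV))

open Classical in
/-- The contributions of order `1` and `x` to the sum over transitive pairs. -/
theorem sum_transitive_pairs_eq {n : ℕ} (hn : 1 ≤ n) (x : ℝ) (u : ℕ → ℝ) :
    1 / ((n - 1).factorial : ℝ) *
      ∑ q : Perm (Fin n) × Perm (Fin n) with joinSetoid q.1 q.2 = ⊤,
        x ^ (n + 1 - (cyc q.1 + cyc (q.1⁻¹ * q.2))) * wprod u q.1 =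
    ∑ π ∈ NC n, partProd u π + x * annularSum u n + x ^ 2 * (1 / ((n - 1).factorial : ℝ) *
      ∑ q : Perm (Fin n) × Perm (Fin n) with joinSetoid q.1 q.2 = ⊤ ∧
          cyc q.1 + cyc (q.1⁻¹ * q.2) < n,
        x ^ (n - 1 - (cyc q.1 + cyc (q.1⁻¹ * q.2))) * wprod u q.1) := by
  have hf : ((n - 1).factorial : ℝ) ≠ 0 := by positivity
  have h0 := sum_planar_pairs hn (fun m => (m.map u).prod)
  have h1 := sum_annular_pairs hn u
  have h2 : ∀ q : Perm (Fin n) × Perm (Fin n), joinSetoid q.1 q.2 = ⊤ →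
      cyc q.1 + cyc (q.1⁻¹ * q.2) ≤ n + 1 := by
    intro q hq
    have h3 := cyc_add_cyc_add_cyc_le_of_transitive hq
    have : Nonempty (Fin n) := ⟨⟨0, hn⟩⟩
    have h4 : 0 < cyc q.2 := by
      obtain ⟨m, rfl⟩ : ∃ m, n = m + 1 := ⟨n - 1, by omega⟩
      exact cyc_pos q.2
    rw [Fintype.card_fin] at h3
    omega
  have e0 : ∑ q : Perm (Fin n) × Perm (Fin n) with joinSetoid q.1 q.2 = ⊤ ∧
        cyc q.1 + cyc (q.1⁻¹ * q.2) = n + 1,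
        x ^ (n + 1 - (cyc q.1 + cyc (q.1⁻¹ * q.2))) * wprod u q.1 =
      (n - 1).factorial * ∑ π ∈ NC n, partProd u π := by
    have e : ∀ π : SetPartition n,
        partProd u π = (((π.parts.val.map Finset.card).map u).prod) := by
      intro π
      rw [Multiset.map_map]
      rfl
    simp only [e]
    rw [← h0]
    refine Finset.sum_congr rfl fun q hq => ?_
    rw [(Finset.mem_filter.mp hq).2.2, Nat.sub_self, pow_zero, one_mul]
    rfl
  have e1 : ∑ q : Perm (Fin n) × Perm (Fin n) with joinSetoid q.1 q.2 = ⊤ ∧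
        cyc q.1 + cyc (q.1⁻¹ * q.2) = n,
        x ^ (n + 1 - (cyc q.1 + cyc (q.1⁻¹ * q.2))) * wprod u q.1 =
      x * ((n - 1).factorial * annularSum u n) := by
    rw [← h1, Finset.mul_sum]
    refine Finset.sum_congr rfl fun q hq => ?_
    rw [(Finset.mem_filter.mp hq).2.2, Nat.add_sub_cancel_left, pow_one]
  have e2 : ∑ q : Perm (Fin n) × Perm (Fin n) with joinSetoid q.1 q.2 = ⊤ ∧
        cyc q.1 + cyc (q.1⁻¹ * q.2) < n,
        x ^ (n + 1 - (cyc q.1 + cyc (q.1⁻¹ * q.2))) * wprod u q.1 =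
      x ^ 2 * ∑ q : Perm (Fin n) × Perm (Fin n) with joinSetoid q.1 q.2 = ⊤ ∧
          cyc q.1 + cyc (q.1⁻¹ * q.2) < n,
        x ^ (n - 1 - (cyc q.1 + cyc (q.1⁻¹ * q.2))) * wprod u q.1 := by
    rw [Finset.mul_sum]
    refine Finset.sum_congr rfl fun q hq => ?_
    have h3 := (Finset.mem_filter.mp hq).2.2
    rw [← mul_assoc, ← pow_add]
    congr 2
    omega
  have hsplit : ∀ F : Perm (Fin n) × Perm (Fin n) → ℝ,
      ∑ q : Perm (Fin n) × Perm (Fin n) with joinSetoid q.1 q.2 = ⊤, F q =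
      ∑ q : Perm (Fin n) × Perm (Fin n) with joinSetoid q.1 q.2 = ⊤ ∧
        cyc q.1 + cyc (q.1⁻¹ * q.2) = n + 1, F q +
      ∑ q : Perm (Fin n) × Perm (Fin n) with joinSetoid q.1 q.2 = ⊤ ∧
        cyc q.1 + cyc (q.1⁻¹ * q.2) = n, F q +
      ∑ q : Perm (Fin n) × Perm (Fin n) with joinSetoid q.1 q.2 = ⊤ ∧
        cyc q.1 + cyc (q.1⁻¹ * q.2) < n, F q := by
    intro F
    simp only [Finset.sum_filter, ← Finset.sum_add_distrib]
    refine Finset.sum_congr rfl fun q _ => ?_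
    by_cases hq : joinSetoid q.1 q.2 = ⊤
    · have := h2 q hq
      simp only [hq, true_and, if_true]
      split_ifs <;> first | omega | simp
    · simp [hq]
  rw [hsplit, e0, e1, e2]
  field_simp

/-- Put x = -1/d in the exact formula. The planar part contributes through the fluctuations of the
cumulants, the annular part already has a factor -1/d and needs only their limits, and the remainder
is O(1/d²). -/
theorem firstOrder_moment {p : ℕ → ℝ[X]} (hp : ∀ d, 1 ≤ d → p d ∈ realRooted d) {r s : ℕ → ℝ}
    (h : ∀ k, 1 ≤ k → FirstOrder (fun d => finiteFreeCumulant d k (p d)) (r k) (s k))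
    {n : ℕ} (hn : 1 ≤ n) :
    FirstOrder (fun d => rootMoment d (p d) n) (∑ π ∈ NC n, partProd r π)
      (∑ π ∈ NC n, partDeriv r s π - annularSum r n) := by
  classical
  have ht : ∀ k, 1 ≤ k → Tendsto (fun d => finiteFreeCumulant d k (p d)) atTop (𝓝 (r k)) :=
    fun k hk => (h k hk).tendsto
  have hx : Tendsto (fun d : ℕ => -1 / (d : ℝ)) atTop (𝓝 0) :=
    tendsto_const_div_atTop_nhds_zero_nat (-1)
  have h1 : FirstOrder (fun d => ∑ π ∈ NC n, partProd (fun k => finiteFreeCumulant d k (p d)) π)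
      (∑ π ∈ NC n, partProd r π) (∑ π ∈ NC n, partDeriv r s π) :=
    FirstOrder.sum fun π _ => firstOrder_partProd h π
  have h2 : FirstOrder (fun d => (-1 / (d : ℝ)) *
      annularSum (fun k => finiteFreeCumulant d k (p d)) n) 0 (-annularSum r n) := by
    refine (tendsto_annularSum ht n).neg.congr' ?_
    filter_upwards [eventually_ge_atTop 1] with d hd
    have : (d : ℝ) ≠ 0 := by positivity
    field_simp
    ring
  have h3 : FirstOrder (fun d => (-1 / (d : ℝ)) ^ 2 * (1 / ((n - 1).factorial : ℝ) *
      ∑ q : Perm (Fin n) × Perm (Fin n) with joinSetoid q.1 q.2 = ⊤ ∧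
          cyc q.1 + cyc (q.1⁻¹ * q.2) < n,
        (-1 / (d : ℝ)) ^ (n - 1 - (cyc q.1 + cyc (q.1⁻¹ * q.2))) *
          wprod (fun k => finiteFreeCumulant d k (p d)) q.1)) 0 0 := by
    have h4 := hx.neg.mul ((tendsto_finsetSum (Finset.univ.filter
      fun q : Perm (Fin n) × Perm (Fin n) => joinSetoid q.1 q.2 = ⊤ ∧
          cyc q.1 + cyc (q.1⁻¹ * q.2) < n) fun q _ =>
      (hx.pow (n - 1 - (cyc q.1 + cyc (q.1⁻¹ * q.2)))).mul (tendsto_wprod ht q.1)).const_mul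
        (1 / ((n - 1).factorial : ℝ)))
    rw [neg_zero, zero_mul] at h4
    refine h4.congr' ?_
    filter_upwards [eventually_ge_atTop 1] with d hd
    have : (d : ℝ) ≠ 0 := by positivity
    rw [sub_zero, ← mul_assoc (d : ℝ)]
    congr 1
    field_simp
  have h4 := (h1.add h2).add h3
  rw [add_zero, add_zero, add_zero, ← sub_eq_add_neg] at h4
  refine h4.congr' ?_
  filter_upwards [eventually_ge_atTop n] with d hd
  rw [rootMoment_eq_sum (hp d (hn.trans hd)) hn hd, sum_transitive_pairs_eq hn]

/-- In the formula for the n-th moment κ_n occurs only for one-cycle σ, linearly and with a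
coefficient whose limit is nonzero; all other terms involve lower cumulants. Hence κ_n can be solved
for by induction. -/
theorem exists_firstOrder_cumulant {p : ℕ → ℝ[X]} (hp : ∀ d, 1 ≤ d → p d ∈ realRooted d)
    {m m' : ℕ → ℝ} (h : ∀ n, 1 ≤ n → FirstOrder (fun d => rootMoment d (p d) n) (m n) (m' n))
    (n : ℕ) (hn : 1 ≤ n) :
    ∃ a b, FirstOrder (fun d => finiteFreeCumulant d n (p d)) a b := by
  classical
  induction n using Nat.strong_induction_on with
  | _ n ih =>
  obtain ⟨a₁, b₁, h₁⟩ : ∃ a b, FirstOrder (fun d : ℕ =>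
      ∑ q : Perm (Fin n) × Perm (Fin n) with joinSetoid q.1 q.2 = ⊤ ∧ cyc q.1 ≠ 1,
        (-1 / (d : ℝ)) ^ (n + 1 - (cyc q.1 + cyc (q.1⁻¹ * q.2))) *
          wprod (fun k => finiteFreeCumulant d k (p d)) q.1) a b := by
    refine exists_firstOrder_sum fun q hq => ?_
    obtain ⟨b, hb⟩ := firstOrder_neg_one_div_pow (n + 1 - (cyc q.1 + cyc (q.1⁻¹ * q.2)))
    obtain ⟨a', b', h'⟩ := exists_firstOrder_multiset_prod (s := q.1.partition.parts)
      (κ := fun d k => finiteFreeCumulant d k (p d)) fun k hk =>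
        ih k (mem_partition_parts_lt (Finset.mem_filter.mp hq).2.2 hk)
          (q.1.partition.parts_pos hk)
    exact ⟨_, _, hb.mul h'⟩
  choose b hb using fun k => firstOrder_neg_one_div_pow k
  have h₂ := FirstOrder.sum (s := Finset.univ.filter fun q : Perm (Fin n) × Perm (Fin n) =>
    joinSetoid q.1 q.2 = ⊤ ∧ cyc q.1 = 1)
    (f := fun q d => (-1 / (d : ℝ)) ^ (n + 1 - (cyc q.1 + cyc (q.1⁻¹ * q.2))))
    fun q _ => hb (n + 1 - (cyc q.1 + cyc (q.1⁻¹ * q.2)))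
  -- The limits are all nonnegative, and the pair (γ, γ) of equal long cycles contributes 0 ^ 0 = 1.
  have hne : ∑ q : Perm (Fin n) × Perm (Fin n) with joinSetoid q.1 q.2 = ⊤ ∧ cyc q.1 = 1,
      (0 : ℝ) ^ (n + 1 - (cyc q.1 + cyc (q.1⁻¹ * q.2))) ≠ 0 := by
    have : Nonempty (Fin n) := ⟨⟨0, hn⟩⟩
    have hcyc : cyc (finRotate n) = 1 := cyc_finRotate hn
    refine (Finset.sum_pos' (fun q _ => by positivity)
      ⟨(finRotate n, finRotate n), ?_, ?_⟩).ne'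
    · simpa [hcyc] using joinSetoid_self_eq_top_iff.mpr hcyc
    · rw [inv_mul_cancel, cyc_one, hcyc, Fintype.card_fin, add_comm 1 n, Nat.sub_self, pow_zero]
      exact one_pos
  have h₃ := ((h n hn).mul (firstOrder_const ((n - 1).factorial : ℝ))).add
    ((firstOrder_const (-1)).mul h₁)
  refine ⟨_, _, (h₃.mul (h₂.inv hne)).congr' ?_⟩
  filter_upwards [h₂.tendsto.eventually_ne hne, eventually_ge_atTop n] with d hd hdn
  have hf : ((n - 1).factorial : ℝ) ≠ 0 := by positivity
  have hsplit : ∑ q : Perm (Fin n) × Perm (Fin n) with joinSetoid q.1 q.2 = ⊤,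
        (-1 / (d : ℝ)) ^ (n + 1 - (cyc q.1 + cyc (q.1⁻¹ * q.2))) *
          wprod (fun k => finiteFreeCumulant d k (p d)) q.1 =
      (∑ q : Perm (Fin n) × Perm (Fin n) with joinSetoid q.1 q.2 = ⊤ ∧ cyc q.1 = 1,
        (-1 / (d : ℝ)) ^ (n + 1 - (cyc q.1 + cyc (q.1⁻¹ * q.2)))) *
          finiteFreeCumulant d n (p d) +
      ∑ q : Perm (Fin n) × Perm (Fin n) with joinSetoid q.1 q.2 = ⊤ ∧ cyc q.1 ≠ 1,
        (-1 / (d : ℝ)) ^ (n + 1 - (cyc q.1 + cyc (q.1⁻¹ * q.2))) *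
          wprod (fun k => finiteFreeCumulant d k (p d)) q.1 := by
    rw [Finset.sum_mul, ← Finset.sum_filter_add_sum_filter_not _ (fun q => cyc q.1 = 1),
      Finset.filter_filter, Finset.filter_filter]
    congr 1
    refine Finset.sum_congr rfl fun q hq => ?_
    rw [wprod_of_cyc_eq_one _ (Finset.mem_filter.mp hq).2.2, Fintype.card_fin]
  rw [rootMoment_eq_sum (hp d (hn.trans hdn)) hn hdn, hsplit]
  rw [mul_right_comm, one_div, inv_mul_cancel₀ hf, one_mul, neg_one_mul, add_neg_cancel_right,
    mul_right_comm, mul_inv_cancel₀ hd, one_mul]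

end Expansion

/-! ### Additivity of the finite free cumulants -/

section Additivity

theorem coefA_finiteFreeAdd {d n : ℕ} (hn : n ≤ d) (p q : ℝ[X]) :
    coefA d n (finiteFreeAdd d p q) =
      ∑ i ∈ Finset.range (n + 1), (n.choose i : ℝ) * coefA d i p * coefA d (n - i) q := by
  have hc : (d.choose n : ℝ) ≠ 0 := by
    exact_mod_cast (Nat.choose_pos hn).ne'
  rw [coefA, coeff_finiteFreeAdd hn, mul_div_assoc, mul_assoc, mul_div_assoc, ← mul_assoc,
    ← mul_pow]
  field_simp
  simp

theorem finiteFreeCumulant_finiteFreeAdd {d n : ℕ} {p q : ℝ[X]} (hp : p ∈ realRooted d)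
    (hq : q ∈ realRooted d) (hn1 : 1 ≤ n) (hn : n ≤ d) :
    finiteFreeCumulant d n (finiteFreeAdd d p q) =
      finiteFreeCumulant d n p + finiteFreeCumulant d n q := by
  obtain ⟨n, rfl⟩ : ∃ m, n = m + 1 := ⟨n - 1, by omega⟩
  rw [finiteFreeCumulant_eq, finiteFreeCumulant_eq, finiteFreeCumulant_eq, ← mul_add,
    ← partitionCumulant_conv (coefA_zero hp) (coefA_zero hq)]
  congr 1
  exact partitionCumulant_congr fun k hk => coefA_finiteFreeAdd (hk.trans hn) p q

end Additivity

end FiniteFree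

namespace FiniteFree

/-! ### Limits of moment sequences are moment sequences -/

section MomentLimit

theorem abs_pow_le_one_add (x : ℝ) (n : ℕ) : |x| ^ n ≤ 1 + x ^ (2 * n) := by
  rw [mul_comm, pow_mul, ← sq_abs, abs_pow]
  nlinarith [sq_nonneg (|x| ^ n - 1)]

/-- The truncation of `x` to the interval `[-R, R]`. -/
noncomputable def clip (R x : ℝ) : ℝ := max (-R) (min R x)

theorem continuous_clip (R : ℝ) : Continuous (clip R) := by
  unfold clip; fun_prop

theorem abs_clip_le {R : ℝ} (hR : 0 ≤ R) (x : ℝ) : |clip R x| ≤ R :=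
  abs_le.mpr ⟨le_max_left _ _, max_le (by linarith) (min_le_left _ _)⟩

theorem clip_of_abs_le {R x : ℝ} (h : |x| ≤ R) : clip R x = x := by
  rw [clip, min_eq_right (abs_le.mp h).2, max_eq_right (abs_le.mp h).1]

theorem abs_clip_le_abs {R : ℝ} (hR : 0 ≤ R) (x : ℝ) : |clip R x| ≤ |x| := by
  rcases le_total |x| R with h | h
  · rw [clip_of_abs_le h]
  · exact (abs_clip_le hR x).trans h

/-- Truncation matters only where |x| ≥ R, and there one extra power of |x| pays for a factor 1/R.
The even power on the right has a moment that is bounded along the sequence. -/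
theorem abs_pow_sub_clip_pow_le {R : ℝ} (hR : 0 < R) (n : ℕ) (x : ℝ) :
    |x ^ n - clip R x ^ n| ≤ 2 / R * (1 + x ^ (2 * (n + 1))) := by
  have hpos : 0 ≤ 1 + x ^ (2 * (n + 1)) := (by positivity : 0 ≤ |x| ^ (n + 1)).trans
    (abs_pow_le_one_add x (n + 1))
  rcases le_total |x| R with h | h
  · rw [clip_of_abs_le h, sub_self, abs_zero]
    positivity
  · calc |x ^ n - clip R x ^ n| ≤ |x ^ n| + |clip R x ^ n| := abs_sub _ _
      _ ≤ |x| ^ n + |x| ^ n := by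
        rw [abs_pow, abs_pow]
        exact add_le_add_right (pow_le_pow_left₀ (abs_nonneg _) (abs_clip_le_abs hR.le x) n) _
      _ = 2 / R * (R * |x| ^ n) := by field_simp; ring
      _ ≤ 2 / R * |x| ^ (n + 1) := by
        rw [pow_succ']
        gcongr
      _ ≤ _ := by
        gcongr
        exact abs_pow_le_one_add x (n + 1)

theorem integrable_clip_pow {μ : Measure ℝ} [IsFiniteMeasure μ] {R : ℝ} (hR : 0 ≤ R) (n : ℕ) :
    Integrable (fun x => clip R x ^ n) μ := by
  refine Integrable.of_bound ((continuous_clip R).pow n).aestronglyMeasurable (R ^ n) ?_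
  refine Eventually.of_forall fun x => ?_
  rw [norm_pow, Real.norm_eq_abs]
  exact pow_le_pow_left₀ (abs_nonneg _) (abs_clip_le hR x) n

theorem abs_moment_sub_clip_le {μ : Measure ℝ} [IsProbabilityMeasure μ] (h : HasFiniteMoments μ)
    {R : ℝ} (hR : 0 < R) (n : ℕ) :
    |moment μ n - ∫ x, clip R x ^ n ∂μ| ≤ 2 / R * (1 + moment μ (2 * (n + 1))) := by
  have h1 : ∫ x, 2 / R * (1 + x ^ (2 * (n + 1))) ∂μ = 2 / R * (1 + moment μ (2 * (n + 1))) := by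
    rw [integral_const_mul, integral_add (integrable_const _) (h _)]
    simp [moment]
  rw [moment, ← integral_sub (h n) (integrable_clip_pow hR.le n), ← h1]
  refine (abs_integral_le_integral_abs).trans ?_
  refine integral_mono ((h n).sub (integrable_clip_pow hR.le n)).abs
    (((integrable_const _).add (h _)).const_mul _) fun x => abs_pow_sub_clip_pow_le hR n x

theorem tendsto_integral_clip_pow {ι : Type*} {U : Filter ι} {μ : ι → ProbabilityMeasure ℝ}
    {ρ : ProbabilityMeasure ℝ} (h : Tendsto μ U (𝓝 ρ)) {R : ℝ} (hR : 0 ≤ R) (n : ℕ) :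
    Tendsto (fun i => ∫ x, clip R x ^ n ∂(μ i : Measure ℝ)) U
      (𝓝 (∫ x, clip R x ^ n ∂(ρ : Measure ℝ))) :=
  ProbabilityMeasure.tendsto_iff_forall_integral_tendsto.mp h
    (BoundedContinuousFunction.ofNormedAddCommGroup (fun x => clip R x ^ n)
      ((continuous_clip R).pow n) (R ^ n) fun x => by
        rw [norm_pow, Real.norm_eq_abs]
        exact pow_le_pow_left₀ (abs_nonneg _) (abs_clip_le hR x) n)

/-- Chebyshev's inequality with the second moment. -/
theorem isTightMeasureSet_of_moment_two_le {S : Set (ProbabilityMeasure ℝ)} {c : ℝ}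
    (hf : ∀ μ ∈ S, HasFiniteMoments (μ : Measure ℝ))
    (hc : ∀ μ ∈ S, moment (μ : Measure ℝ) 2 ≤ c) :
    IsTightMeasureSet {((μ : ProbabilityMeasure ℝ) : Measure ℝ) | μ ∈ S} := by
  rw [isTightMeasureSet_iff_exists_isCompact_measure_compl_le]
  intro ε hε
  obtain ⟨δ, hδ, hδε⟩ : ∃ δ : ℝ, 0 < δ ∧ ENNReal.ofReal δ ≤ ε := by
    rcases eq_or_ne ε ⊤ with rfl | h
    · exact ⟨1, one_pos, le_top⟩
    · exact ⟨ε.toReal, ENNReal.toReal_pos hε.ne' h, (ENNReal.ofReal_toReal h).le⟩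
  -- Chosen so that |c| ≤ δR²; the added 1 keeps R positive when c = 0.
  set R := √(|c| / δ) + 1 with hR
  have hR0 : 0 < R := by positivity
  have hR2 : |c| / δ ≤ R ^ 2 := by
    have := Real.sq_sqrt (by positivity : 0 ≤ |c| / δ)
    nlinarith [Real.sqrt_nonneg (|c| / δ)]
  refine ⟨Metric.closedBall 0 R, isCompact_closedBall 0 R, ?_⟩
  rintro _ ⟨μ, hμ, rfl⟩
  have h1 := mul_meas_ge_le_integral_of_nonneg (μ := (μ : Measure ℝ)) (f := fun x : ℝ => x ^ 2)
    (Eventually.of_forall fun x => sq_nonneg x) (hf μ hμ 2) (R ^ 2)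
  have h2 : (Metric.closedBall (0 : ℝ) R)ᶜ ⊆ {x : ℝ | R ^ 2 ≤ x ^ 2} := by
    intro x hx
    simp only [Set.mem_compl_iff, Metric.mem_closedBall, dist_zero_right, Real.norm_eq_abs,
      not_le] at hx
    exact (sq_le_sq₀ hR0.le (abs_nonneg x)).mpr hx.le |>.trans_eq (sq_abs x)
  refine (measure_mono h2).trans (le_trans ?_ hδε)
  rw [← ENNReal.ofReal_toReal (measure_ne_top (μ : Measure ℝ) _)]
  refine ENNReal.ofReal_le_ofReal ?_
  have h3 := h1.trans ((hc μ hμ).trans (le_abs_self c))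
  have h4 : |c| ≤ δ * R ^ 2 := by
    rw [div_le_iff₀ hδ] at hR2
    linarith
  have h5 : 0 < R ^ 2 := by positivity
  have h6 := h3.trans h4
  rw [mul_comm δ] at h6
  exact le_of_mul_le_mul_left h6 h5

/-- Fatou's lemma as the truncation level N grows; the odd powers are dominated by even ones. -/
theorem hasFiniteMoments_of_clip_le {ρ : Measure ℝ} [IsProbabilityMeasure ρ] {B : ℕ → ℝ}
    (h : ∀ n (N : ℕ), ∫ x, clip N x ^ (2 * n) ∂ρ ≤ B n) :
    HasFiniteMoments ρ ∧ ∀ n, moment ρ (2 * n) ≤ B n := by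
  have key : ∀ n, ∫⁻ x, ENNReal.ofReal (x ^ (2 * n)) ∂ρ ≤ ENNReal.ofReal (B n) := by
    intro n
    have h1 : ∀ x : ℝ, liminf (fun N : ℕ => ENNReal.ofReal (clip N x ^ (2 * n))) atTop =
        ENNReal.ofReal (x ^ (2 * n)) := by
      intro x
      refine Tendsto.liminf_eq (tendsto_const_nhds.congr' ?_)
      filter_upwards [eventually_ge_atTop ⌈|x|⌉₊] with N hN
      rw [clip_of_abs_le (Nat.ceil_le.mp hN)]
    rw [← lintegral_congr h1]
    refine (lintegral_liminf_le fun N => ?_).trans ?_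
    · exact ((continuous_clip N).pow _).measurable.ennreal_ofReal
    · refine liminf_le_of_le (by isBoundedDefault) fun b hb => ?_
      obtain ⟨N, hN⟩ := hb.exists
      refine hN.trans ?_
      rw [← ofReal_integral_eq_lintegral_ofReal (integrable_clip_pow (Nat.cast_nonneg N) _)
        (Eventually.of_forall fun x => (even_two_mul n).pow_nonneg _)]
      exact ENNReal.ofReal_le_ofReal (h n N)
  have hint : ∀ n, Integrable (fun x : ℝ => x ^ (2 * n)) ρ := by
    intro n
    refine ⟨(continuous_pow _).aestronglyMeasurable, ?_⟩
    rw [hasFiniteIntegral_iff_ofReal (Eventually.of_forall fun x => (even_two_mul n).pow_nonneg _)]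
    exact (key n).trans_lt ENNReal.ofReal_lt_top
  have hB : ∀ n, 0 ≤ B n := fun n =>
    (integral_nonneg fun x => (even_two_mul n).pow_nonneg _).trans (h n 0)
  refine ⟨fun n => ?_, fun n => ?_⟩
  · refine ((integrable_const (1 : ℝ)).add (hint n)).mono'
      (continuous_pow _).aestronglyMeasurable (Eventually.of_forall fun x => ?_)
    rw [norm_pow, Real.norm_eq_abs]
    exact abs_pow_le_one_add x n
  · rw [moment, integral_eq_lintegral_of_nonneg_ae
      (Eventually.of_forall fun x => (even_two_mul n).pow_nonneg _)
      (continuous_pow _).aestronglyMeasurable]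
    exact ENNReal.toReal_le_of_le_ofReal (hB n) (key n)

/-- If all moments of a sequence of probability measures converge, then the limits are the moments
of a probability measure. -/
theorem exists_moment_eq_of_tendsto {μ : ℕ → ProbabilityMeasure ℝ}
    (hf : ∀ d, HasFiniteMoments (μ d : Measure ℝ)) {m : ℕ → ℝ}
    (hm : ∀ n, Tendsto (fun d => moment (μ d : Measure ℝ) n) atTop (𝓝 (m n))) :
    ∃ ρ : Measure ℝ, IsProbabilityMeasure ρ ∧ HasFiniteMoments ρ ∧ ∀ n, moment ρ n = m n := by
  have hbdd : ∀ n, ∃ c, ∀ d, moment (μ d : Measure ℝ) n ≤ c := by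
    intro n
    obtain ⟨c, hc⟩ := (hm n).bddAbove_range
    exact ⟨c, fun d => hc ⟨d, rfl⟩⟩
  choose c hc using hbdd
  have hcomp : IsCompact (closure (Set.range μ)) := by
    refine isCompact_closure_of_isTightMeasureSet
      (isTightMeasureSet_of_moment_two_le (c := c 2) ?_ ?_)
    · rintro _ ⟨d, rfl⟩; exact hf d
    · rintro _ ⟨d, rfl⟩; exact hc 2 d
  -- By compactness the measures converge along a free ultrafilter, so no subsequence has to be
  -- extracted.
  set U : Ultrafilter ℕ := hyperfilter ℕ
  have hU : (U : Filter ℕ) ≤ atTop := by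
    rw [← Nat.cofinite_eq_atTop]
    exact hyperfilter_le_cofinite
  obtain ⟨ρ, -, hρ⟩ := hcomp.ultrafilter_le_nhds (U.map μ) (by
    rw [le_principal_iff]
    exact (Eventually.of_forall fun d => subset_closure ⟨d, rfl⟩ :
      ∀ᶠ d in (U : Filter ℕ), μ d ∈ closure (Set.range μ)))
  have hρ' : Tendsto μ U (𝓝 ρ) := hρ
  have hclip : ∀ n (N : ℕ), ∫ x, clip N x ^ (2 * n) ∂(ρ : Measure ℝ) ≤ c (2 * n) := by
    intro n N
    refine le_of_tendsto (tendsto_integral_clip_pow hρ' (Nat.cast_nonneg N) (2 * n))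
      (Eventually.of_forall fun d => le_trans ?_ (hc (2 * n) d))
    refine integral_mono (integrable_clip_pow (Nat.cast_nonneg N) _) (hf d _) fun x => ?_
    have := pow_le_pow_left₀ (abs_nonneg _) (abs_clip_le_abs (Nat.cast_nonneg N) x) (2 * n)
    simpa [(even_two_mul n).pow_abs] using this
  obtain ⟨h1, h2⟩ := hasFiniteMoments_of_clip_le hclip
  refine ⟨ρ, inferInstance, h1, fun n => ?_⟩
  set K := 2 * (1 + c (2 * (n + 1))) with hK
  -- Truncated moments converge weakly, and truncation costs at most K/R both for the limit measure
  -- and uniformly along the sequence.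
  have h3 : ∀ R : ℝ, 0 < R → |moment (ρ : Measure ℝ) n - m n| ≤ 2 * K / R := by
    intro R hR
    have h4 := (abs_moment_sub_clip_le h1 hR n).trans
      (b := 2 / R * (1 + moment (ρ : Measure ℝ) (2 * (n + 1)))) (c := K / R) (by
        rw [hK, mul_div_right_comm]
        gcongr
        exact h2 (n + 1))
    have h5 : |m n - ∫ x, clip R x ^ n ∂(ρ : Measure ℝ)| ≤ K / R := by
      refine le_of_tendsto ((((hm n).mono_left hU).sub
        (tendsto_integral_clip_pow hρ' hR.le n)).abs) (Eventually.of_forall fun d => ?_)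
      refine (abs_moment_sub_clip_le (hf d) hR n).trans ?_
      rw [hK, mul_div_right_comm]
      gcongr
      exact hc _ d
    rw [abs_le] at h4 h5 ⊢
    have h6 : 2 * K / R = K / R + K / R := by ring
    rw [h6]
    constructor <;> linarith [h4.1, h4.2, h5.1, h5.2]
  have h4 : Tendsto (fun R : ℝ => 2 * K / R) atTop (𝓝 0) := tendsto_const_nhds.div_atTop tendsto_id
  have h5 := ge_of_tendsto h4 ((eventually_gt_atTop 0).mono h3)
  exact sub_eq_zero.mp (abs_nonpos_iff.mp h5)

end MomentLimit

/-! ### Root distributions as measures -/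

section Empirical

theorem exists_sum_dirac (M : Multiset ℝ) :
    ∃ μ : Measure ℝ, μ Set.univ = Multiset.card M ∧ HasFiniteMoments μ ∧
      ∀ n, moment μ n = (M.map fun x => x ^ n).sum := by
  induction M using Multiset.induction_on with
  | empty => exact ⟨0, by simp, fun n => integrable_zero_measure, fun n => by simp [moment]⟩
  | cons a M ih =>
    obtain ⟨μ, h1, h2, h3⟩ := ih
    have h4 : ∀ n : ℕ, Integrable (fun x : ℝ => x ^ n) (Measure.dirac a) := fun n =>
      integrable_dirac (by simp)
    refine ⟨Measure.dirac a + μ, ?_, fun n => (h4 n).add_measure (h2 n), fun n => ?_⟩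
    · simp [h1, add_comm]
    · rw [moment, integral_add_measure (h4 n) (h2 n), integral_dirac, Multiset.map_cons,
        Multiset.sum_cons, ← h3 n, moment]

theorem exists_moment_eq_rootMoment {d : ℕ} (hd : 1 ≤ d) {p : ℝ[X]} (hp : p ∈ realRooted d) :
    ∃ μ : ProbabilityMeasure ℝ, HasFiniteMoments (μ : Measure ℝ) ∧
      ∀ n, moment (μ : Measure ℝ) n = rootMoment d p n := by
  obtain ⟨μ, h1, h2, h3⟩ := exists_sum_dirac p.roots
  rw [← hp.2.2.natDegree_eq_card_roots, hp.2.1] at h1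
  have hd0 : (d : ENNReal) ≠ 0 := by exact_mod_cast (by omega : d ≠ 0)
  refine ⟨⟨(d : ENNReal)⁻¹ • μ, ⟨?_⟩⟩, fun n => ?_, fun n => ?_⟩
  · rw [Measure.smul_apply, h1, smul_eq_mul, ENNReal.inv_mul_cancel hd0 (ENNReal.natCast_ne_top d)]
  · exact (h2 n).smul_measure (ENNReal.inv_ne_top.mpr hd0)
  · change ∫ x, x ^ n ∂((d : ENNReal)⁻¹ • μ) = _
    rw [integral_smul_measure, rootMoment, ← h3 n, moment]
    simp

end Empirical

end FiniteFree

namespace FiniteFree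

/-! ### Uniqueness of free cumulants -/

section Cumulants

theorem parts_eq_singleton_univ {n : ℕ} {π : SetPartition n} (h : Finset.univ ∈ π.parts) :
    π.parts = {Finset.univ} := by
  refine Finset.eq_singleton_iff_unique_mem.mpr ⟨h, fun W hW => ?_⟩
  by_contra hne
  have hd : Disjoint W Finset.univ := π.disjoint hW h hne
  exact π.ne_bot hW (hd.eq_bot_of_le (Finset.subset_univ W))

theorem sum_NC_partProd {n : ℕ} (hn : 1 ≤ n) (u : ℕ → ℝ) :
    ∑ π ∈ NC n, partProd u π =
      u n + ∑ π ∈ (NC n).filter (fun π => ∀ V ∈ π.parts, V.card < n), partProd u π := by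
  have hne : (Finset.univ : Finset (Fin n)) ≠ ⊥ := Finset.Nonempty.ne_empty ⟨⟨0, hn⟩, Finset.mem_univ _⟩
  have hcomp : (NC n).filter (fun π => ¬ ∀ V ∈ π.parts, V.card < n) =
      {Finpartition.indiscrete hne} := by
    ext π
    simp only [Finset.mem_filter, Finset.mem_singleton]
    constructor
    · rintro ⟨-, h⟩
      push Not at h
      obtain ⟨V, hV, hVn⟩ := h
      have hVu : V = Finset.univ :=
        Finset.eq_univ_of_card _ (le_antisymm (Finset.card_le_univ V) (by simpa using hVn))
      exact Finpartition.ext (parts_eq_singleton_univ (hVu ▸ hV))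
    · rintro rfl
      refine ⟨?_, by simp⟩
      simp only [NC, Finset.mem_filter, Finset.mem_univ, true_and]
      intro a b c d _ _ _ V hV W hW _ _ _ _
      rw [Finpartition.indiscrete_parts, Finset.mem_singleton] at hV hW
      rw [hV, hW]
  rw [← Finset.sum_filter_add_sum_filter_not (NC n) (fun π => ∀ V ∈ π.parts, V.card < n), hcomp,
    Finset.sum_singleton, add_comm]
  simp [partProd]

/-- The moment-cumulant formula determines the free cumulants. -/
theorem cumulantOfMoments_unique {m u : ℕ → ℝ}
    (h : ∀ n, 1 ≤ n → m n = ∑ π ∈ NC n, partProd u π) (n : ℕ) (hn : 1 ≤ n) :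
    cumulantOfMoments m n = u n := by
  induction n using Nat.strong_induction_on with
  | _ n ih =>
  rw [cumulantOfMoments_eq, h n hn, sum_NC_partProd hn, sub_eq_iff_eq_add]
  congr 1
  refine Finset.sum_congr rfl fun π hπ => Finset.prod_congr rfl fun V hV => ?_
  exact (ih _ ((Finset.mem_filter.mp hπ).2 V hV)
    (Finset.card_pos.mpr (π.nonempty_of_mem_parts hV))).symm

end Cumulants

/-! ### Assembly of the theorem -/

section Main

variable {p q : ℕ → ℝ[X]} {μ ν ρ : Measure ℝ} {μ' ν' : ℝ[X] →ₗ[ℝ] ℝ}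

/-- The limits of the finite cumulants satisfy the moment-cumulant formula of μ, since the limiting
moments are those of μ; by uniqueness they are its free cumulants. -/
theorem HasInfinitesimalDistribution.exists_hasCumulantFluctuations
    (hp : HasInfinitesimalDistribution p μ μ') : ∃ s, HasCumulantFluctuations p μ s := by
  have h := exists_firstOrder_cumulant hp.realRooted hp.tendsto_infinitesimal
  choose! r s hrs using h
  refine ⟨s, fun n hn => ?_⟩
  have h1 : freeCumulant μ n = r n :=
    cumulantOfMoments_unique (fun k hk => tendsto_nhds_unique (hp.tendsto_moment k)
      (firstOrder_moment hp.realRooted hrs hk).tendsto) n hn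
  rw [h1]
  exact hrs n hn

theorem rootMoment_zero {d : ℕ} (hd : 1 ≤ d) {p : ℝ[X]} (hp : p ∈ realRooted d) :
    rootMoment d p 0 = 1 := by
  have hd0 : (d : ℝ) ≠ 0 := by positivity
  simp [rootMoment, ← hp.2.2.natDegree_eq_card_roots, hp.2.1, hd0]

theorem firstOrder_cumulant_finiteFreeAdd {r r' s s' : ℕ → ℝ}
    (hp : ∀ d, 1 ≤ d → p d ∈ realRooted d) (hq : ∀ d, 1 ≤ d → q d ∈ realRooted d)
    (h : ∀ k, 1 ≤ k → FirstOrder (fun d => finiteFreeCumulant d k (p d)) (r k) (s k))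
    (h' : ∀ k, 1 ≤ k → FirstOrder (fun d => finiteFreeCumulant d k (q d)) (r' k) (s' k))
    (k : ℕ) (hk : 1 ≤ k) :
    FirstOrder (fun d => finiteFreeCumulant d k (finiteFreeAdd d (p d) (q d))) (r k + r' k)
      (s k + s' k) := by
  refine ((h k hk).add (h' k hk)).congr' ?_
  filter_upwards [eventually_ge_atTop k] with d hd
  rw [finiteFreeCumulant_finiteFreeAdd (hp d (hk.trans hd)) (hq d (hk.trans hd)) hk hd]

/-- The free additive convolution of the limiting distributions exists. -/
theorem exists_isFreeAddConv (hp : HasInfinitesimalDistribution p μ μ')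
    (hq : HasInfinitesimalDistribution q ν ν') : ∃ ρ, IsFreeAddConv μ ν ρ := by
  obtain ⟨s, hs⟩ := hp.exists_hasCumulantFluctuations
  obtain ⟨s', hs'⟩ := hq.exists_hasCumulantFluctuations
  have hreal : ∀ d, 1 ≤ d → finiteFreeAdd d (p d) (q d) ∈ FiniteFree.realRooted d := fun d hd =>
    finiteFreeAdd_mem_realRooted (hp.realRooted d hd) (hq.realRooted d hd)
  have h1 := firstOrder_cumulant_finiteFreeAdd hp.realRooted hq.realRooted hs hs'
  -- The degree is shifted to d + 1 so that every term of the sequence has a root distribution of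
  -- mass one.
  choose e he₁ he₂ using fun d : ℕ =>
    exists_moment_eq_rootMoment (Nat.le_add_left 1 d) (hreal (d + 1) (Nat.le_add_left 1 d))
  set m : ℕ → ℝ := fun n => if n = 0 then 1 else
    ∑ π ∈ NC n, partProd (fun k => freeCumulant μ k + freeCumulant ν k) π with hm
  obtain ⟨ρ, h2, h3, h4⟩ := exists_moment_eq_of_tendsto (m := m) he₁ (fun n => by
    simp only [he₂]
    rcases Nat.eq_zero_or_pos n with rfl | hn
    · simp only [hm, if_pos]
      exact tendsto_const_nhds.congr fun d =>
        (rootMoment_zero (Nat.le_add_left 1 d) (hreal (d + 1) (Nat.le_add_left 1 d))).symm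
    · simp only [hm, if_neg hn.ne']
      exact (firstOrder_moment hreal h1 hn).tendsto.comp (tendsto_add_atTop_nat 1))
  refine ⟨ρ, h2, h3, fun n hn => ?_⟩
  refine cumulantOfMoments_unique (m := moment ρ)
    (u := fun k => freeCumulant μ k + freeCumulant ν k) (fun k hk => ?_) n hn
  rw [h4, hm]
  simp only [if_neg (by omega : k ≠ 0)]

/-- A linear functional on polynomials with prescribed values on the powers of `X`. -/
theorem exists_linearMap_X_pow (f : ℕ → ℝ) : ∃ φ : ℝ[X] →ₗ[ℝ] ℝ, ∀ n, φ (X ^ n) = f n := by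
  refine ⟨Polynomial.lsum fun n => f n • LinearMap.id, fun n => ?_⟩
  rw [X_pow_eq_monomial]
  simp [sum_monomial_index]

end Main

end FiniteFree

theorem mainTheorem1 (p q : ℕ → ℝ[X]) (μ ν : Measure ℝ) (μ' ν' : ℝ[X] →ₗ[ℝ] ℝ)
    (hp : FiniteFree.HasInfinitesimalDistribution p μ μ')
    (hq : FiniteFree.HasInfinitesimalDistribution q ν ν') :
    ∃ rp rq : ℕ → ℝ,
      FiniteFree.HasCumulantFluctuations p μ rp ∧
      FiniteFree.HasCumulantFluctuations q ν rq ∧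
      (∃ ρ : Measure ℝ, FiniteFree.IsFreeAddConv μ ν ρ) ∧
      ∀ ρ : Measure ℝ, FiniteFree.IsFreeAddConv μ ν ρ →
        ∃ ρ' : ℝ[X] →ₗ[ℝ] ℝ,
          FiniteFree.HasInfinitesimalDistribution
            (fun d => FiniteFree.finiteFreeAdd d (p d) (q d)) ρ ρ' ∧
          FiniteFree.HasCumulantFluctuations
            (fun d => FiniteFree.finiteFreeAdd d (p d) (q d)) ρ (fun n => rp n + rq n) ∧
          ∀ n : ℕ, 1 ≤ n →
            ρ' (X ^ n) =
              (∑ π ∈ FiniteFree.NC n,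
                FiniteFree.partDeriv (FiniteFree.freeCumulant ρ) (fun k => rp k + rq k) π)
              - FiniteFree.annularSum (FiniteFree.freeCumulant ρ) n := by
  obtain ⟨rp, hrp⟩ := hp.exists_hasCumulantFluctuations
  obtain ⟨rq, hrq⟩ := hq.exists_hasCumulantFluctuations
  refine ⟨rp, rq, hrp, hrq, FiniteFree.exists_isFreeAddConv hp hq, fun ρ hρ => ?_⟩
  have hreal : ∀ d, 1 ≤ d →
      FiniteFree.finiteFreeAdd d (p d) (q d) ∈ FiniteFree.realRooted d := fun d hd =>
    FiniteFree.finiteFreeAdd_mem_realRooted (hp.realRooted d hd) (hq.realRooted d hd)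
  have hfluc : FiniteFree.HasCumulantFluctuations
      (fun d => FiniteFree.finiteFreeAdd d (p d) (q d)) ρ (fun n => rp n + rq n) := fun n hn => by
    rw [hρ.freeCumulant_add n hn]
    exact FiniteFree.firstOrder_cumulant_finiteFreeAdd hp.realRooted hq.realRooted hrp hrq n hn
  -- The functional is defined by the claimed formula, with the value 0 at n = 0 supplying ρ'(1) =
  -- 0; it remains to see that it is the limit.
  obtain ⟨ρ', hρ'⟩ := FiniteFree.exists_linearMap_X_pow fun n => if n = 0 then 0 else
    (∑ π ∈ FiniteFree.NC n,
      FiniteFree.partDeriv (FiniteFree.freeCumulant ρ) (fun k => rp k + rq k) π)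
      - FiniteFree.annularSum (FiniteFree.freeCumulant ρ) n
  have hvalue : ∀ n : ℕ, 1 ≤ n → ρ' (X ^ n) =
      (∑ π ∈ FiniteFree.NC n,
        FiniteFree.partDeriv (FiniteFree.freeCumulant ρ) (fun k => rp k + rq k) π)
        - FiniteFree.annularSum (FiniteFree.freeCumulant ρ) n := fun n hn => by
    rw [hρ', if_neg (by omega)]
  have hmoment : ∀ n, 1 ≤ n → FiniteFree.FirstOrder
      (fun d => FiniteFree.rootMoment d (FiniteFree.finiteFreeAdd d (p d) (q d)) n)
      (FiniteFree.moment ρ n) (ρ' (X ^ n)) := fun n hn => by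
    -- Once the limiting moment is written as a sum over non-crossing partitions, the claim is the
    -- general expansion applied to the convolved polynomials.
    rw [hvalue n hn, FiniteFree.moment_eq_sum_NC (FiniteFree.moment ρ) hn]
    exact FiniteFree.firstOrder_moment hreal hfluc hn
  have := hρ.isProbabilityMeasure
  refine ⟨ρ', ⟨hreal, this, hρ.finiteMoments, fun n => ?_, ?_, hmoment⟩, hfluc, hvalue⟩
  · rcases Nat.eq_zero_or_pos n with rfl | hn
    · have h0 : FiniteFree.moment ρ 0 = 1 := by simp [FiniteFree.moment]
      rw [h0]
      refine tendsto_const_nhds.congr' ?_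
      filter_upwards [eventually_ge_atTop 1] with d hd
      exact (FiniteFree.rootMoment_zero hd (hreal d hd)).symm
    · exact (hmoment n hn).tendsto
  · simpa using hρ' 0
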